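/- Let $k$ be a field and let $U,V$ be Hopf algebras over $k$ with bijective antipodes $S_U,S_V$ and comultiplications written $m\mapsto m_1\otimes m_2$, $x\mapsto x_1\otimes x_2$. Let $\langle\,,\rangle:U\otimes V\to k$ be a pairing, i.e. $\langle mn,x\rangle=\langle m,x_1\rangle\langle n,x_2\rangle$, $\langle m,xy\rangle=\langle m_1,x\rangle\langle m_2,y\rangle$, $\langle 1,x\rangle=\varepsilon(x)$, $\langle m,1\rangle=\varepsilon(m)$. Let $U^{\rm cop}$ be $U$ with the opposite comultiplication and antipode $S_U^{-1}$ (Sweedler subscripts below always refer to $U$, not $U^{\rm cop}$, unless said otherwise). The generalized quantum double $D=D(U^{\rm cop},V)$ is the space $U\otimes V$ with unit $1\otimes 1$, counit $\varepsilon\otimes\varepsilon$ and $$(m\otimes x)(n\otimes y)=\langle n_3,x_1\rangle\langle S_U^{-1}(n_1),x_3\rangle\, mn_2\otimes x_2y,\qquad \Delta(m\otimes x)=(m_2\otimes x_1)\otimes(m_1\otimes x_2),$$ $$S(m\otimes x)=\langle m_1,x_3\rangle\langle m_3,S_V^{-1}(x_1)\rangle\, S_U^{-1}(m_2)\otimes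 S_V(x_2).$$ Let $\gamma:V\to U^{\rm cop}$ be a bialgebra map such that for all $y\in V$, $m\in U$ $$\gamma(y)m=\langle S_U^{-1}(m_1),y_3\rangle\langle m_3,y_1\rangle\, m_2\gamma(y_2).$$ Put $i:U^{\rm cop}\to D$, $i(m)=m\otimes 1$; $\pi:D\to U^{\rm cop}$, $\pi(m\otimes x)=m\gamma(x)$; $B=\{a\in D\mid a_1\otimes\pi(a_2)=a\otimes 1\}$; and $\Pi(a)=a_1\,i(S_U^{-1}(\pi(a_2)))$ for $a\in D$. Then: (1) $D$ and $U^{\rm cop}$ are Hopf algebras, and $i,\pi$ are Hopf algebra maps with $\pi i=\mathrm{id}$. (2) The map $\theta(y)=S_U(\gamma(y_2))\otimes y_1=\gamma(S_V^{-1}(y_2))\otimes y_1$ is a bijection from $V$ onto $B$, and $B$ is the image of $\Pi$. (3) Let $\underline V$ be the space $V$ with the left action and left coaction of $U^{\rm cop}$ $$m\rhd y=\langle m_1,S_V^{-1}(y_1)\rangle\, y_2\,\langle m_2,S_V^{-2}(y_3)\rangle=\langle m,S_V^{-1}(S_V^{-1}(y_3)y_1)\rangle\, y_2,\qquad \lambda(y)=\gamma(S_V^{-1}(y_3)y_1)\otimes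 y_2,$$ the unit and the counit of $V$, and $$x\cdot y=\langle\gamma(y_2),S_V(x_1)x_3\rangle\, x_2y_1,\qquad \underline\Delta(x)=\langle\gamma(S_V(x_4)x_6),S_V^{-1}(x_3)x_1\rangle\, x_2\otimes x_5,$$ $$\underline S(x)=\langle\gamma(x_4),x_1S_V(x_3)\rangle\, S_V(x_2).$$ Under $\theta$ these maps are the ones that $B$ carries as the coinvariants of the projection $\pi$: the action $m\rhd b=i(m_{(1)})\,b\,i(S_U^{-1}(m_{(2)}))$ with $m_{(1)}\otimes m_{(2)}=m_2\otimes m_1$ the comultiplication of $U^{\rm cop}$, the coaction $b\mapsto\pi(b_1)\otimes b_2$, the multiplication, unit and counit of $D$, the comultiplication $\Pi(a)\mapsto\Pi(a_1)\otimes\Pi(a_2)$ ($a\in D$), and the antipode $b\mapsto i(\pi(b_1))S_D(b_2)$. (4) $\underline V$ is a Hopf algebra in the braided monoidal category ${}^{U^{\rm cop}}_{U^{\rm cop}}\mathcal{YD}$ of left Yetter–Drinfeld modules over $U^{\rm cop}$ (with braiding $m\otimes n\mapsto m_{-1}\cdot n\otimes m_0$). (5) The Radford biproduct $\underline V\times U^{\rm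 cop}$ (the space $\underline V\otimes U$ with smash product multiplication, smash coproduct comultiplication and antipode $y\times m\mapsto(1\times S_U^{-1}(y_{-1}m))(\underline S(y_0)\times 1)$) is a Hopf algebra, and $y\times m\mapsto\theta(y)\,i(m)$ is an isomorphism of Hopf algebras $\underline V\times U^{\rm cop}\to D(U^{\rm cop},V)$. -/

import Mathlib

open scoped TensorProduct

noncomputable section

namespace DoubleBiproduct

/-! ### Sweedler notation -/

section Sweedler

variable {k C C' W : Type*} [CommSemiring k] [AddCommMonoid C] [Module k C] [Coalgebra k C]
  [AddCommMonoid C'] [Module k C'] [Coalgebra k C'] [AddCommMonoid W] [Module k W]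

/-- Sweedler notation: `sweedler n f x = ∑ f (x₁, …, xₙ₊₁)`, where `x₁ ⊗ ⋯ ⊗ xₙ₊₁` is the
`n`-fold iterated comultiplication of `x`. The Sweedler component `x_j` is the argument of `f`
with index `j - 1`. -/
def sweedler : (n : ℕ) →
    MultilinearMap k (fun _ : Fin (n + 1) => C) W →ₗ[k] C →ₗ[k] W
  | 0 => LinearMap.mk₂ k (fun f x => f (fun _ => x))
      (fun _ _ _ => rfl) (fun _ _ _ => rfl)
      (fun f x y => by
        have h := f.map_update_add (fun _ => 0) 0 x y
        have e : ∀ z : C, Function.update (fun _ : Fin (0 + 1) => (0 : C)) 0 z = fun _ => z :=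
          fun z => by ext i; fin_cases i; simp
        simpa only [e] using h)
      (fun c f x => by
        have h := f.map_update_smul (fun _ => 0) 0 c x
        have e : ∀ z : C, Function.update (fun _ : Fin (0 + 1) => (0 : C)) 0 z = fun _ => z :=
          fun z => by ext i; fin_cases i; simp
        simpa only [e] using h)
  | n + 1 =>
    { toFun := fun f =>
        TensorProduct.lift (sweedler n ∘ₗ f.curryLeft) ∘ₗ (Coalgebra.comul (R := k) (A := C))
      map_add' := fun f g => by
        rw [← LinearMap.add_comp]
        congr 1
        ext a b
        simp [show (f + g).curryLeft a = f.curryLeft a + g.curryLeft a from rfl]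
      map_smul' := fun c f => by
        rw [RingHom.id_apply, ← LinearMap.smul_comp]
        congr 1
        ext a b
        simp [show (c • f).curryLeft a = c • f.curryLeft a from rfl] }

/-- Sweedler notation in two variables: `sweedler₂ n m f x y = ∑ f (x₁, …, xₙ₊₁) (y₁, …, yₘ₊₁)`. -/
def sweedler₂ (n m : ℕ)
    (f : MultilinearMap k (fun _ : Fin (n + 1) => C)
      (MultilinearMap k (fun _ : Fin (m + 1) => C') W)) :
    C →ₗ[k] C' →ₗ[k] W :=
  sweedler m ∘ₗ sweedler n f

end Sweedler

/-! ### Hopf algebras, Yetter-Drinfeld modules and Radford biproducts -/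

section General

variable {k A B H M N P Q X Y Z W : Type*} [CommSemiring k]
  [AddCommMonoid A] [Module k A] [AddCommMonoid B] [Module k B] [AddCommMonoid H] [Module k H]
  [AddCommMonoid M] [Module k M] [AddCommMonoid N] [Module k N] [AddCommMonoid P] [Module k P]
  [AddCommMonoid Q] [Module k Q] [AddCommMonoid X] [Module k X] [AddCommMonoid Y] [Module k Y]
  [AddCommMonoid Z] [Module k Z] [AddCommMonoid W] [Module k W]

/-- `s` applied to the two middle factors. -/
def middle (s : X ⊗[k] Y →ₗ[k] Z ⊗[k] W) :
    (P ⊗[k] X) ⊗[k] (Y ⊗[k] Q) →ₗ[k] (P ⊗[k] Z) ⊗[k] (W ⊗[k] Q) :=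
  (TensorProduct.assoc k P Z (W ⊗[k] Q)).symm.toLinearMap ∘ₗ
    LinearMap.lTensor P ((TensorProduct.assoc k Z W Q).toLinearMap ∘ₗ s.rTensor Q ∘ₗ
      (TensorProduct.assoc k X Y Q).symm.toLinearMap) ∘ₗ
    (TensorProduct.assoc k P X (Y ⊗[k] Q)).toLinearMap

/-- The structure maps of a Hopf algebra (in a category of vector spaces with extra structure)
on the space `A`, without axioms. -/
structure HopfData (k A : Type*) [CommSemiring k] [AddCommMonoid A] [Module k A] where
  /-- multiplication -/
  mul : A ⊗[k] A →ₗ[k] A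
  /-- unit element -/
  one : A
  /-- comultiplication -/
  comul : A →ₗ[k] A ⊗[k] A
  /-- counit -/
  counit : A →ₗ[k] k
  /-- antipode -/
  antipode : A →ₗ[k] A

/-- The Hopf algebra axioms, where the tensor square of `A` is made into an algebra by means of
the map `c : A ⊗ A → A ⊗ A`:
`(a ⊗ b)(a' ⊗ b') = a c(b ⊗ a') b'`. -/
structure HopfData.HopfAxioms (D : HopfData k A) (c : A ⊗[k] A →ₗ[k] A ⊗[k] A) : Prop where
  mul_assoc : ∀ x y z, D.mul (D.mul (x ⊗ₜ y) ⊗ₜ z) = D.mul (x ⊗ₜ D.mul (y ⊗ₜ z))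
  one_mul : ∀ x, D.mul (D.one ⊗ₜ x) = x
  mul_one : ∀ x, D.mul (x ⊗ₜ D.one) = x
  coassoc : ∀ x, TensorProduct.assoc k A A A (D.comul.rTensor A (D.comul x)) =
    D.comul.lTensor A (D.comul x)
  counit_left : ∀ x, D.counit.rTensor A (D.comul x) = 1 ⊗ₜ x
  counit_right : ∀ x, D.counit.lTensor A (D.comul x) = x ⊗ₜ 1
  comul_mul : ∀ x y, D.comul (D.mul (x ⊗ₜ y)) =
    TensorProduct.map D.mul D.mul (middle c (D.comul x ⊗ₜ D.comul y))
  comul_one : D.comul D.one = D.one ⊗ₜ D.one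
  counit_mul : ∀ x y, D.counit (D.mul (x ⊗ₜ y)) = D.counit x * D.counit y
  counit_one : D.counit D.one = 1
  antipode_left : ∀ x, D.mul (D.antipode.rTensor A (D.comul x)) = D.counit x • D.one
  antipode_right : ∀ x, D.mul (D.antipode.lTensor A (D.comul x)) = D.counit x • D.one

/-- An (ordinary) Hopf algebra over `k`. -/
def HopfData.IsHopfAlgebra (D : HopfData k A) : Prop :=
  D.HopfAxioms (TensorProduct.comm k A A).toLinearMap

/-- `f` is a morphism of bialgebras. -/
structure IsBialgebraHom (D : HopfData k A) (E : HopfData k B) (f : A →ₗ[k] B) : Prop where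
  map_mul : ∀ x y, f (D.mul (x ⊗ₜ y)) = E.mul (f x ⊗ₜ f y)
  map_one : f D.one = E.one
  map_comul : ∀ x, E.comul (f x) = TensorProduct.map f f (D.comul x)
  map_counit : ∀ x, E.counit (f x) = D.counit x

/-- `f` is a morphism of Hopf algebras. -/
structure IsHopfAlgebraHom (D : HopfData k A) (E : HopfData k B) (f : A →ₗ[k] B) : Prop
    extends IsBialgebraHom D E f where
  map_antipode : ∀ x, f (D.antipode x) = E.antipode (f x)

/-- A left action and a left coaction of `H` on `M`, without axioms. -/
structure YDData (k H M : Type*) [CommSemiring k] [AddCommMonoid H] [Module k H]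
    [AddCommMonoid M] [Module k M] where
  /-- the left action -/
  act : H ⊗[k] M →ₗ[k] M
  /-- the left coaction -/
  coact : M →ₗ[k] H ⊗[k] M

/-- Left Yetter-Drinfeld modules over `K`. The last axiom reads
`κ₁ m₋₁ ⊗ κ₂ · m₀ = (κ₁ · m)₋₁ κ₂ ⊗ (κ₁ · m)₀`. -/
structure YDData.IsYetterDrinfeld (E : YDData k H M) (K : HopfData k H) : Prop where
  one_act : ∀ m, E.act (K.one ⊗ₜ m) = m
  mul_act : ∀ g h m, E.act (K.mul (g ⊗ₜ h) ⊗ₜ m) = E.act (g ⊗ₜ E.act (h ⊗ₜ m))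
  counit_coact : ∀ m, K.counit.rTensor M (E.coact m) = 1 ⊗ₜ m
  comul_coact : ∀ m, TensorProduct.assoc k H H M (K.comul.rTensor M (E.coact m)) =
    E.coact.lTensor H (E.coact m)
  compat : ∀ κ m,
    TensorProduct.map K.mul E.act
        (TensorProduct.tensorTensorTensorComm k H H H M (K.comul κ ⊗ₜ E.coact m)) =
      K.mul.rTensor M (TensorProduct.rightComm k H M H
        ((E.coact ∘ₗ E.act ∘ₗ (TensorProduct.mk k H M).flip m).rTensor H (K.comul κ)))

/-- The tensor product of Yetter-Drinfeld modules: `κ · (m ⊗ n) = κ₁ · m ⊗ κ₂ · n` and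
`m ⊗ n ↦ m₋₁ n₋₁ ⊗ (m₀ ⊗ n₀)`. -/
def YDData.tensor (K : HopfData k H) (E : YDData k H M) (F : YDData k H N) :
    YDData k H (M ⊗[k] N) where
  act := TensorProduct.map E.act F.act ∘ₗ
    (TensorProduct.tensorTensorTensorComm k H H M N).toLinearMap ∘ₗ K.comul.rTensor (M ⊗[k] N)
  coact := K.mul.rTensor (M ⊗[k] N) ∘ₗ
    (TensorProduct.tensorTensorTensorComm k H M H N).toLinearMap ∘ₗ
    TensorProduct.map E.coact F.coact

/-- The unit object of the category of Yetter-Drinfeld modules. -/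
def YDData.unit (K : HopfData k H) : YDData k H k where
  act := (TensorProduct.lid k k).toLinearMap ∘ₗ K.counit.rTensor k
  coact := TensorProduct.mk k H k K.one

/-- Morphisms of Yetter-Drinfeld modules. -/
structure IsYDHom (E : YDData k H M) (F : YDData k H N) (f : M →ₗ[k] N) : Prop where
  map_act : ∀ h m, f (E.act (h ⊗ₜ m)) = F.act (h ⊗ₜ f m)
  map_coact : ∀ m, F.coact (f m) = f.lTensor H (E.coact m)

/-- The braiding `m ⊗ n ↦ m₋₁ · n ⊗ m₀`. -/
def YDData.braiding (E : YDData k H M) (F : YDData k H N) : M ⊗[k] N →ₗ[k] N ⊗[k] M :=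
  F.act.rTensor M ∘ₗ (TensorProduct.rightComm k H M N).toLinearMap ∘ₗ E.coact.rTensor N

/-- `R`, together with the action and coaction `E`, is a Hopf algebra in the braided monoidal
category of left Yetter-Drinfeld modules over `K`. -/
structure IsHopfAlgebraInYD (K : HopfData k H) (E : YDData k H B) (R : HopfData k B) : Prop where
  isYetterDrinfeld : E.IsYetterDrinfeld K
  mul_hom : IsYDHom (E.tensor K E) E R.mul
  one_hom : IsYDHom (YDData.unit K) E (LinearMap.toSpanSingleton k B R.one)
  comul_hom : IsYDHom E (E.tensor K E) R.comul
  counit_hom : IsYDHom E (YDData.unit K) R.counit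
  antipode_hom : IsYDHom E E R.antipode
  hopfAxioms : R.HopfAxioms (E.braiding E)

/-- The map `h ⊗ b ↦ h₁ · b ⊗ h₂`. -/
def smashSwap (K : HopfData k H) (E : YDData k H B) : H ⊗[k] B →ₗ[k] B ⊗[k] H :=
  E.act.rTensor H ∘ₗ (TensorProduct.rightComm k H H B).toLinearMap ∘ₗ K.comul.rTensor B

/-- The map `b ⊗ h ↦ b₋₁ h ⊗ b₀`. -/
def cosmashSwap (K : HopfData k H) (E : YDData k H B) : B ⊗[k] H →ₗ[k] H ⊗[k] B :=
  K.mul.rTensor B ∘ₗ (TensorProduct.rightComm k H B H).toLinearMap ∘ₗ E.coact.rTensor H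

/-- The multiplication `(b × h)(b' × h') = b (h₁ · b') × h₂ h'` of the Radford biproduct. -/
def biproductMul (K : HopfData k H) (E : YDData k H B) (R : HopfData k B) :
    (B ⊗[k] H) ⊗[k] (B ⊗[k] H) →ₗ[k] B ⊗[k] H :=
  TensorProduct.map R.mul K.mul ∘ₗ middle (smashSwap K E)

/-- The Radford biproduct `R × K` on the space `B ⊗ H`: smash product algebra, smash coproduct
coalgebra `Δ(b × h) = (b₁ × b₂₍₋₁₎ h₁) ⊗ (b₂₍₀₎ × h₂)`, and antipode
`S(b × h) = (1 × S(b₋₁ h))(S(b₀) × 1)`. -/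
def biproduct (K : HopfData k H) (E : YDData k H B) (R : HopfData k B) :
    HopfData k (B ⊗[k] H) where
  mul := biproductMul K E R
  one := R.one ⊗ₜ K.one
  comul := middle (cosmashSwap K E) ∘ₗ TensorProduct.map R.comul K.comul
  counit := LinearMap.mul' k k ∘ₗ TensorProduct.map R.counit K.counit
  antipode := biproductMul K E R ∘ₗ
    TensorProduct.map (TensorProduct.mk k B H R.one ∘ₗ K.antipode)
      ((TensorProduct.mk k B H).flip K.one ∘ₗ R.antipode) ∘ₗ cosmashSwap K E

/-! For a Hopf algebra `D` with a projection, i.e. Hopf algebra maps `i : K → D`, `π : D → K`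
with `π ∘ i = id`. -/

/-- The coinvariants `{a | a₁ ⊗ π(a₂) = a ⊗ 1}`. -/
def coinvariants (D : HopfData k A) (K : HopfData k H) (π : A →ₗ[k] H) : Submodule k A where
  carrier := {a | π.lTensor A (D.comul a) = a ⊗ₜ K.one}
  zero_mem' := by simp
  add_mem' := fun {a b} (ha : _ = _) (hb : _ = _) => by
    simp [ha, hb, TensorProduct.add_tmul]
  smul_mem' := fun c a (ha : _ = _) => by
    simp [ha, TensorProduct.smul_tmul']

/-- The map `Π(a) = a₁ i(S(π(a₂)))`. -/
def coinvariantProj (D : HopfData k A) (K : HopfData k H) (i : H →ₗ[k] A) (π : A →ₗ[k] H) :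
    A →ₗ[k] A :=
  D.mul ∘ₗ (i ∘ₗ K.antipode ∘ₗ π).lTensor A ∘ₗ D.comul

/-- The left adjoint action `h ▹ a = i(h₁) a i(S(h₂))`. -/
def adjointAction (D : HopfData k A) (K : HopfData k H) (i : H →ₗ[k] A) :
    H ⊗[k] A →ₗ[k] A :=
  D.mul ∘ₗ TensorProduct.map (D.mul ∘ₗ i.rTensor A) (i ∘ₗ K.antipode) ∘ₗ
    (TensorProduct.rightComm k H H A).toLinearMap ∘ₗ K.comul.rTensor A

end General

/-! ### The generalized quantum double of `U^cop` and `V` -/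

section Double

variable {k U V : Type*} [Field k] [Ring U] [HopfAlgebra k U] [Ring V] [HopfAlgebra k V]

/-- The structure maps of a Hopf algebra. -/
def hopfData (k U : Type*) [Field k] [Ring U] [HopfAlgebra k U] : HopfData k U where
  mul := LinearMap.mul' k U
  one := 1
  comul := Coalgebra.comul
  counit := Coalgebra.counit
  antipode := HopfAlgebra.antipode k

/-- The inverse of a bijective antipode. -/
def antipodeInv (hU : Function.Bijective (HopfAlgebra.antipode k : U →ₗ[k] U)) : U →ₗ[k] U :=
  (LinearEquiv.ofBijective (HopfAlgebra.antipode k : U →ₗ[k] U) hU).symm.toLinearMap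

/-- The Hopf algebra `U^cop`: opposite comultiplication, antipode `S⁻¹`. -/
def copData (hU : Function.Bijective (HopfAlgebra.antipode k : U →ₗ[k] U)) : HopfData k U where
  mul := LinearMap.mul' k U
  one := 1
  comul := (TensorProduct.comm k U U).toLinearMap ∘ₗ Coalgebra.comul
  counit := Coalgebra.counit
  antipode := antipodeInv hU

/-- A pairing of the bialgebras `U` and `V`. -/
structure IsPairing (p : U →ₗ[k] V →ₗ[k] k) : Prop where
  mul_left : ∀ m n x, p (m * n) x =
    LinearMap.mul' k k (TensorProduct.map (p m) (p n) (Coalgebra.comul (R := k) x))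
  mul_right : ∀ m x y, p m (x * y) =
    LinearMap.mul' k k (TensorProduct.map (p.flip x) (p.flip y) (Coalgebra.comul (R := k) m))
  one_left : ∀ x, p 1 x = Coalgebra.counit (R := k) x
  one_right : ∀ m, p m 1 = Coalgebra.counit (R := k) m

variable (p : U →ₗ[k] V →ₗ[k] k) (γ : V →ₗ[k] U)
  (hU : Function.Bijective (HopfAlgebra.antipode k : U →ₗ[k] U))
  (hV : Function.Bijective (HopfAlgebra.antipode k : V →ₗ[k] V))

/-- The map `x ⊗ n ↦ ⟨n₃, x₁⟩ ⟨S⁻¹(n₁), x₃⟩ n₂ ⊗ x₂`. -/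
def exchange : V ⊗[k] U →ₗ[k] U ⊗[k] V :=
  TensorProduct.lift <| sweedler₂ 2 2 <|
    MultilinearMap.mk' (fun x =>
      MultilinearMap.mk' (fun n =>
        (p (n 2) (x 0) * p (antipodeInv hU (n 0)) (x 2)) • (n 1 ⊗ₜ[k] x 1))
        (by
          intro v i a b
          fin_cases i <;>
            simp [add_mul, mul_add, add_smul, TensorProduct.add_tmul])
        (by
          intro v i c a
          fin_cases i <;>
            simp [← TensorProduct.smul_tmul', smul_smul, mul_left_comm, mul_comm]))
      (by
        intro v i a b
        ext n
        fin_cases i <;>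
          simp [add_mul, mul_add, add_smul, TensorProduct.tmul_add])
      (by
        intro v i c a
        ext n
        fin_cases i <;>
          simp [smul_smul, mul_left_comm, mul_comm])

/-- The generalized quantum double `D(U^cop, V)` on `U ⊗ V`: tensor product coalgebra of `U^cop`
and `V`, multiplication
`(m ⊗ x)(n ⊗ y) = ⟨n₃, x₁⟩ ⟨S⁻¹(n₁), x₃⟩ m n₂ ⊗ x₂ y`, and antipode
`S(m ⊗ x) = ⟨m₁, x₃⟩ ⟨m₃, S⁻¹(x₁)⟩ S⁻¹(m₂) ⊗ S(x₂)`. -/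
def double : HopfData k (U ⊗[k] V) where
  mul := TensorProduct.map (LinearMap.mul' k U) (LinearMap.mul' k V) ∘ₗ middle (exchange p hU)
  one := 1 ⊗ₜ 1
  comul := middle (TensorProduct.comm k U V).toLinearMap ∘ₗ
    TensorProduct.map (copData hU).comul (hopfData k V).comul
  counit := LinearMap.mul' k k ∘ₗ TensorProduct.map Coalgebra.counit Coalgebra.counit
  antipode := TensorProduct.lift <| sweedler₂ 2 2 <|
    MultilinearMap.mk' (fun m =>
      MultilinearMap.mk' (fun x =>
        (p (m 0) (x 2) * p (m 2) (antipodeInv hV (x 0))) •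
          (antipodeInv hU (m 1) ⊗ₜ[k] HopfAlgebra.antipode k (x 1)))
        (by
          intro v i a b
          fin_cases i <;>
            simp [add_mul, mul_add, add_smul, TensorProduct.tmul_add])
        (by
          intro v i c a
          fin_cases i <;>
            simp [smul_smul, mul_assoc, mul_left_comm, mul_comm]))
      (by
        intro v i a b
        ext n
        fin_cases i <;>
          simp [add_mul, mul_add, add_smul, TensorProduct.add_tmul])
      (by
        intro v i c a
        ext n
        fin_cases i <;>
          simp [← TensorProduct.smul_tmul', smul_smul, mul_assoc, mul_left_comm, mul_comm])

/-- The inclusion `i(m) = m ⊗ 1`. -/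
def doubleIncl : U →ₗ[k] U ⊗[k] V := (TensorProduct.mk k U V).flip 1

/-- The projection `π(m ⊗ x) = m γ(x)`. -/
def doubleProj : U ⊗[k] V →ₗ[k] U := LinearMap.mul' k U ∘ₗ γ.lTensor U

/-- `γ : V → U^cop` is a bialgebra map with
`γ(y) m = ⟨S⁻¹(m₁), y₃⟩ ⟨m₃, y₁⟩ m₂ γ(y₂)`. -/
structure IsProjectionDatum : Prop where
  isBialgebraHom : IsBialgebraHom (hopfData k V) (copData hU) γ
  exchange_eq : ∀ y m, γ y * m = LinearMap.mul' k U (γ.lTensor U (exchange p hU (y ⊗ₜ m)))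

/-- `θ(y) = S(γ(y₂)) ⊗ y₁`. -/
def theta : V →ₗ[k] U ⊗[k] V :=
  sweedler 1 <| MultilinearMap.mk'
    (fun y => HopfAlgebra.antipode k (γ (y 1)) ⊗ₜ[k] y 0)
    (by
      intro v i a b
      fin_cases i <;> simp [TensorProduct.add_tmul, TensorProduct.tmul_add])
    (by
      intro v i c a
      fin_cases i <;> simp [TensorProduct.smul_tmul'])

/-- The map `y ↦ γ(S⁻¹(y₂)) ⊗ y₁`. -/
def theta' : V →ₗ[k] U ⊗[k] V :=
  sweedler 1 <| MultilinearMap.mk'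
    (fun y => γ (antipodeInv hV (y 1)) ⊗ₜ[k] y 0)
    (by
      intro v i a b
      fin_cases i <;> simp [TensorProduct.add_tmul, TensorProduct.tmul_add])
    (by
      intro v i c a
      fin_cases i <;> simp [TensorProduct.smul_tmul'])

/-- The map `m ⊗ y ↦ ⟨m₁, S⁻¹(y₁)⟩ ⟨m₂, S⁻²(y₃)⟩ y₂`. -/
def action' : U ⊗[k] V →ₗ[k] V :=
  TensorProduct.lift <| sweedler₂ 1 2 <|
    MultilinearMap.mk' (fun m =>
      MultilinearMap.mk' (fun y =>
        (p (m 0) (antipodeInv hV (y 0)) *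
          p (m 1) (antipodeInv hV (antipodeInv hV (y 2)))) • y 1)
        (by
          intro v i a b
          fin_cases i <;> simp [add_mul, mul_add, add_smul])
        (by
          intro v i c a
          fin_cases i <;> simp [smul_smul, mul_left_comm, mul_comm]))
      (by
        intro v i a b
        ext n
        fin_cases i <;> simp [add_mul, mul_add, add_smul])
      (by
        intro v i c a
        ext n
        fin_cases i <;> simp [smul_smul, mul_assoc, mul_left_comm])

/-- The action and coaction of `U^cop` on `V`:
`m ▹ y = ⟨m, S⁻¹(S⁻¹(y₃) y₁)⟩ y₂` and `y ↦ γ(S⁻¹(y₃) y₁) ⊗ y₂`. -/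
def underlineYD : YDData k U V where
  act := TensorProduct.lift <| LinearMap.flip <| sweedler 2 <| MultilinearMap.mk'
    (fun y => (p.flip (antipodeInv hV (antipodeInv hV (y 2) * y 0))).smulRight (y 1))
    (by
      intro v i a b
      ext m
      fin_cases i <;> simp [add_mul, mul_add, add_smul])
    (by
      intro v i c a
      ext m
      fin_cases i <;> simp [smul_smul, mul_comm])
  coact := sweedler 2 <| MultilinearMap.mk'
    (fun y => γ (antipodeInv hV (y 2) * y 0) ⊗ₜ[k] y 1)
    (by
      intro v i a b
      fin_cases i <;>
        simp [add_mul, mul_add, TensorProduct.add_tmul, TensorProduct.tmul_add])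
    (by
      intro v i c a
      fin_cases i <;> simp [TensorProduct.smul_tmul'])

/-- The braided Hopf algebra structure on `V`, with the unit and counit of `V` and
`x · y = ⟨γ(y₂), S(x₁) x₃⟩ x₂ y₁`,
`Δ(x) = ⟨γ(S(x₄) x₆), S⁻¹(x₃) x₁⟩ x₂ ⊗ x₅`,
`S(x) = ⟨γ(x₄), x₁ S(x₃)⟩ S(x₂)`. -/
def underlineHopf : HopfData k V where
  mul := TensorProduct.lift <| sweedler₂ 2 1 <|
    MultilinearMap.mk' (fun x =>
      MultilinearMap.mk' (fun y =>
        p (γ (y 1)) (HopfAlgebra.antipode k (x 0) * x 2) • (x 1 * y 0))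
        (by
          intro v i a b
          fin_cases i <;> simp [add_smul, mul_add])
        (by
          intro v i c a
          fin_cases i <;> simp [smul_smul, mul_comm]))
      (by
        intro v i a b
        ext n
        fin_cases i <;> simp [add_mul, mul_add, add_smul])
      (by
        intro v i c a
        ext n
        fin_cases i <;> simp [smul_smul, mul_comm])
  one := 1
  comul := sweedler 5 <| MultilinearMap.mk'
    (fun x => p (γ (HopfAlgebra.antipode k (x 3) * x 5)) (antipodeInv hV (x 2) * x 0) •
      (x 1 ⊗ₜ[k] x 4))
    (by
      intro v i a b
      fin_cases i <;>
        simp [add_mul, mul_add, add_smul, TensorProduct.add_tmul, TensorProduct.tmul_add])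
    (by
      intro v i c a
      fin_cases i <;>
        simp [← TensorProduct.smul_tmul', smul_smul, mul_comm])
  counit := Coalgebra.counit
  antipode := sweedler 3 <| MultilinearMap.mk'
    (fun x => p (γ (x 3)) (x 0 * HopfAlgebra.antipode k (x 2)) • HopfAlgebra.antipode k (x 1))
    (by
      intro v i a b
      fin_cases i <;> simp [add_mul, mul_add, add_smul])
    (by
      intro v i c a
      fin_cases i <;> simp [smul_smul, mul_comm])

/-- The map `χ(y × m) = θ(y) i(m)`. -/
def chi : V ⊗[k] U →ₗ[k] U ⊗[k] V :=
  (double p hU hV).mul ∘ₗ TensorProduct.map (theta γ) doubleIncl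

end Double

end DoubleBiproduct

end

/-!
Every element of a coalgebra is a linear combination of matrix coefficients of finite dimensional
comodules, so an identity in Sweedler notation may be checked on the entries of comatrices, where
iterated comultiplications are matrix products and the antipode is a matrix inverse.

The pairing gives the exchange map `x ⊗ n ↦ ⟨n₃, x₁⟩ ⟨S⁻¹(n₁), x₃⟩ n₂ ⊗ x₂`. It is a morphism of
coalgebras from `V ⊗ Uᶜᵒᵖ` to `Uᶜᵒᵖ ⊗ V` compatible with both multiplications, which makes the
double a Hopf algebra. The condition on `γ` says that `m ⊗ x ↦ m γ(x)` respects the exchange map,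
so it is a Hopf algebra projection. On the coinvariants of this projection `m ⊗ x ↦ ε(m) x` inverts
`θ`. Radford's theorem makes the coinvariants of a projection of Hopf algebras a braided Hopf
algebra whose biproduct is the given algebra, and applying `m ⊗ x ↦ ε(m) x` to the structure maps
of the coinvariants gives the formulas on `V`.
-/

noncomputable section

namespace DoubleBiproduct

/-! ### Comatrices -/

section Contraction

variable {k M N P : Type*} [CommSemiring k] [AddCommMonoid M] [Module k M] [AddCommMonoid N]
  [Module k N] [AddCommMonoid P] [Module k P]

theorem lid_rTensor_assoc_tmul (f : M →ₗ[k] k) (t : M ⊗[k] N) (z : P) :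
    TensorProduct.lid k (N ⊗[k] P) (f.rTensor (N ⊗[k] P) (TensorProduct.assoc k M N P (t ⊗ₜ z))) =
      TensorProduct.lid k N (f.rTensor N t) ⊗ₜ z := by
  induction t with
  | zero => simp
  | add s t hs ht => simp only [TensorProduct.add_tmul, map_add, hs, ht]
  | tmul a b => simp [TensorProduct.smul_tmul']

theorem rid_lTensor_assoc_tmul (f : P →ₗ[k] k) (t : M ⊗[k] N) (z : P) :
    ((TensorProduct.rid k N).toLinearMap ∘ₗ f.lTensor N).lTensor M
      (TensorProduct.assoc k M N P (t ⊗ₜ z)) = f z • t := by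
  induction t with
  | zero => simp
  | add s t hs ht => simp only [TensorProduct.add_tmul, map_add, smul_add, hs, ht]
  | tmul a b => simp

theorem comul_lid_rTensor [Coalgebra k N] (f : M →ₗ[k] k) (t : M ⊗[k] N) :
    Coalgebra.comul (R := k) (TensorProduct.lid k N (f.rTensor N t)) =
      TensorProduct.lid k (N ⊗[k] N) (f.rTensor (N ⊗[k] N) (Coalgebra.comul.lTensor M t)) := by
  induction t with
  | zero => simp
  | add s t hs ht => simp only [map_add, hs, ht]
  | tmul a b => simp

end Contraction

section Existence

variable {k C : Type*} [Field k] [AddCommGroup C] [Module k C] [Coalgebra k C]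

/-- A square matrix over a coalgebra that comultiplies like the matrix coefficients of a finite
dimensional comodule. Iterated comultiplications of its entries are sums over chains of indices. -/
structure IsComatrix (k : Type*) {C ι : Type*} [CommSemiring k] [AddCommMonoid C] [Module k C]
    [Coalgebra k C] [Fintype ι] [DecidableEq ι] (c : Matrix ι ι C) : Prop where
  comul_apply : ∀ i j, Coalgebra.comul (R := k) (c i j) = ∑ a, c i a ⊗ₜ[k] c a j
  counit_apply : ∀ i j, Coalgebra.counit (R := k) (c i j) = (1 : Matrix ι ι k) i j

theorem exists_finiteDimensional_coideal (x : C) : ∃ W : Submodule k C, FiniteDimensional k W ∧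
    x ∈ W ∧ ∀ w ∈ W, Coalgebra.comul (R := k) w ∈ LinearMap.range (W.subtype.lTensor C) := by
  classical
  let b := Module.Free.chooseBasis k C
  let s := TensorProduct.equivFinsuppOfBasisLeft (N := C) b (Coalgebra.comul x)
  let W := Submodule.span k (s.frange : Set C)
  have hs (i) : s i ∈ W := by
    by_cases hi : s i = 0
    · exact hi ▸ W.zero_mem
    · exact Submodule.subset_span (Finsupp.mem_frange.2 ⟨hi, i, rfl⟩)
  have comul_x : Coalgebra.comul (R := k) x = ∑ i ∈ s.support, b i ⊗ₜ s i := by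
    rw [← (TensorProduct.equivFinsuppOfBasisLeft b).symm_apply_apply (Coalgebra.comul (R := k) x),
      TensorProduct.equivFinsuppOfBasisLeft_symm_apply]
    rfl
  refine ⟨W, FiniteDimensional.span_finset k _, ?_, fun w hw => ?_⟩
  · have h := congr_arg (TensorProduct.lid k C) (Coalgebra.rTensor_counit_comul (R := k) x)
    simp only [comul_x, map_sum, LinearMap.rTensor_tmul, TensorProduct.lid_tmul, one_smul] at h
    exact h ▸ W.sum_mem fun i _ => W.smul_mem _ (hs i)
  · suffices h : ∀ j, Coalgebra.comul (R := k) (s j) ∈ LinearMap.range (W.subtype.lTensor C) by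
      refine (Submodule.span_le (p := (LinearMap.range (W.subtype.lTensor C)).comap
        Coalgebra.comul)).2 (fun v hv => ?_) hw
      obtain ⟨-, j, rfl⟩ := Finsupp.mem_frange.1 hv
      exact h j
    intro j
    have comul_s : Coalgebra.comul (R := k) (s j) = ∑ i ∈ s.support,
        TensorProduct.lid k C ((b.coord j).rTensor C (Coalgebra.comul (b i))) ⊗ₜ s i := by
      have s_j : s j = TensorProduct.lid k C ((b.coord j).rTensor C (Coalgebra.comul x)) :=
        TensorProduct.equivFinsuppOfBasisLeft_apply b _ j
      rw [s_j, comul_lid_rTensor, ← Coalgebra.coassoc_apply]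
      clear_value s
      simp only [comul_x, map_sum, LinearMap.rTensor_tmul, lid_rTensor_assoc_tmul]
    exact comul_s ▸ Submodule.sum_mem _ fun i _ => ⟨_ ⊗ₜ ⟨s i, hs i⟩, rfl⟩

theorem exists_isComatrix_of_coideal {W : Submodule k C}
    (hW : ∀ w ∈ W, Coalgebra.comul (R := k) w ∈ LinearMap.range (W.subtype.lTensor C))
    {ι : Type*} [Fintype ι] [DecidableEq ι] (w : Module.Basis ι k W) :
    ∃ c : Matrix ι ι C, IsComatrix k c ∧
      ∀ i, Coalgebra.comul (R := k) (w i : C) = ∑ j, c i j ⊗ₜ (w j : C) := by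
  choose f hf using fun j => LinearMap.exists_extend (w.coord j)
  have f_apply (i j) : f j (w i) = (1 : Matrix ι ι k) i j := by
    simpa [Finsupp.single_apply, Matrix.one_apply] using LinearMap.congr_fun (hf j) (w i)
  choose t ht using fun i => hW (w i) (w i).2
  let c : Matrix ι ι C := .of fun i j => TensorProduct.equivFinsuppOfBasisRight w (t i) j
  have comul_w (i) : Coalgebra.comul (R := k) (w i : C) = ∑ j, c i j ⊗ₜ (w j : C) := by
    rw [← ht, ← (TensorProduct.equivFinsuppOfBasisRight w).symm_apply_apply (t i),
      TensorProduct.equivFinsuppOfBasisRight_symm_apply, Finsupp.sum_fintype _ _ (by simp)]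
    simp [c]
  refine ⟨c, ⟨fun i j => ?_, fun i j => ?_⟩, comul_w⟩
  · have h := congr_arg (((TensorProduct.rid k C).toLinearMap ∘ₗ (f j).lTensor C).lTensor C)
      (Coalgebra.coassoc_apply (R := k) (w i : C))
    simpa [comul_w, rid_lTensor_assoc_tmul, f_apply, Matrix.one_apply] using h
  · have h := congr_arg (f j ∘ TensorProduct.lid k C)
      (Coalgebra.rTensor_counit_comul (R := k) (w i : C))
    simpa [comul_w, f_apply, Matrix.one_apply] using h

theorem exists_comatrix (x : C) : ∃ (n : ℕ) (c : Matrix (Fin n) (Fin n) C) (r : Fin n → Fin n → k),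
    IsComatrix k c ∧ x = ∑ i, ∑ j, r i j • c i j := by
  obtain ⟨W, _, hx, hW⟩ := exists_finiteDimensional_coideal (k := k) x
  let w := Module.finBasis k W
  obtain ⟨c, hc, comul_w⟩ := exists_isComatrix_of_coideal hW w
  refine ⟨_, c, fun i j => w.repr ⟨x, hx⟩ i * Coalgebra.counit (R := k) (w j : C), hc, ?_⟩
  have w_eq (i) : (w i : C) = ∑ j, Coalgebra.counit (R := k) (w j : C) • c i j := by
    have h := congr_arg (TensorProduct.rid k C) (Coalgebra.lTensor_counit_comul (R := k) (w i : C))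
    simpa [comul_w] using h.symm
  have x_eq := congr_arg Subtype.val (w.sum_repr ⟨x, hx⟩)
  simp only [Submodule.coe_sum, Submodule.coe_smul] at x_eq
  simp only [mul_smul, ← Finset.smul_sum, ← w_eq, x_eq]

end Existence

section Comatrix

variable {k C W : Type*} [Field k] [AddCommGroup C] [Module k C] [Coalgebra k C]
  [AddCommMonoid W] [Module k W]

theorem ext_comatrix {F G : C →ₗ[k] W}
    (h : ∀ (n : ℕ) (c : Matrix (Fin n) (Fin n) C), IsComatrix k c → ∀ i j, F (c i j) = G (c i j)) :
    F = G := by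
  ext x
  obtain ⟨n, c, r, hc, rfl⟩ := exists_comatrix (k := k) x
  simp only [map_sum, map_smul, h n c hc]

theorem ext_comatrix₂ {C' : Type*} [AddCommGroup C'] [Module k C'] [Coalgebra k C']
    {F G : C →ₗ[k] C' →ₗ[k] W}
    (h : ∀ (n : ℕ) (c : Matrix (Fin n) (Fin n) C), IsComatrix k c →
      ∀ (m : ℕ) (d : Matrix (Fin m) (Fin m) C'), IsComatrix k d →
      ∀ i j a b, F (c i j) (d a b) = G (c i j) (d a b)) :
    F = G :=
  ext_comatrix fun n c hc i j => ext_comatrix fun m d hd a b => h n c hc m d hd i j a b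

theorem sweedler_zero {k C W : Type*} [CommSemiring k] [AddCommMonoid C] [Module k C]
    [Coalgebra k C] [AddCommMonoid W] [Module k W]
    (f : MultilinearMap k (fun _ : Fin (0 + 1) => C) W) (x : C) :
    sweedler 0 f x = f fun _ => x :=
  rfl

end Comatrix

namespace IsComatrix

variable {k ι κ : Type*} [CommSemiring k] [Fintype ι] [DecidableEq ι] [Fintype κ] [DecidableEq κ]

section Coalgebra

variable {C W : Type*} [AddCommMonoid C] [Module k C] [Coalgebra k C]
  [AddCommMonoid W] [Module k W] {c : Matrix ι ι C}

theorem sweedler_succ (hc : IsComatrix k c) (n : ℕ)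
    (f : MultilinearMap k (fun _ : Fin (n + 1 + 1) => C) W) (i j : ι) :
    sweedler (n + 1) f (c i j) = ∑ a, sweedler n (f.curryLeft (c i a)) (c a j) := by
  change TensorProduct.lift (sweedler n ∘ₗ f.curryLeft) (Coalgebra.comul (R := k) (c i j)) = _
  simp only [hc.comul_apply, map_sum, TensorProduct.lift.tmul, LinearMap.comp_apply]

theorem map {C' F : Type*} [AddCommMonoid C'] [Module k C'] [Coalgebra k C'] [FunLike F C C']
    [CoalgHomClass F k C C'] (hc : IsComatrix k c) (f : F) : IsComatrix k (c.map f) where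
  comul_apply i j := by
    simp [← CoalgHomClass.map_comp_comul_apply, hc.comul_apply]
  counit_apply i j := by
    simp [hc.counit_apply]

theorem conj (hc : IsComatrix k c) {R R' : Matrix ι ι k} (hR : R * R' = 1) :
    IsComatrix k (.of fun i j => ∑ a, ∑ b, (R i a * R' b j) • c a b) where
  comul_apply i j := by
    have hR' := Matrix.ext_iff.2 (mul_eq_one_comm.1 hR)
    simp only [Matrix.mul_apply] at hR'
    have coeff (x y b d : ι) : ∑ l, R l x * R' y j * (R i b * R' d l) =
        R i b * R' y j * (1 : Matrix ι ι k) d x := by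
      rw [← hR' d x, Finset.mul_sum]
      exact Finset.sum_congr rfl fun l _ => by ring
    simp only [Matrix.of_apply, map_sum, map_smul, hc.comul_apply, TensorProduct.sum_tmul,
      TensorProduct.tmul_sum, ← TensorProduct.smul_tmul', TensorProduct.tmul_smul,
      Finset.smul_sum, smul_smul]
    rw [Finset.sum_comm_cycle]
    refine .trans ?_ (Finset.sum_comm.trans <| Finset.sum_congr rfl fun x _ =>
      Finset.sum_comm.trans <| Finset.sum_congr rfl fun y _ => Finset.sum_comm_cycle.symm).symm
    simp only [← Finset.sum_smul, coeff, Matrix.one_apply, mul_ite, mul_one, mul_zero, ite_smul,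
      zero_smul, Finset.sum_ite_eq', Finset.mem_univ, if_true]
    exact Finset.sum_congr rfl fun x _ => Finset.sum_comm
  counit_apply i j := by
    simpa [hc.counit_apply, Matrix.mul_apply, Matrix.one_apply] using Matrix.ext_iff.2 hR i j

theorem kroneckerTMul {D : Type*} [AddCommMonoid D] [Module k D] [Coalgebra k D]
    {d : Matrix κ κ D} (hc : IsComatrix k c) (hd : IsComatrix k d) :
    IsComatrix k (Matrix.kroneckerTMul k c d) where
  comul_apply i j := by
    simpa [hc.comul_apply, hd.comul_apply, Fintype.sum_prod_type, TensorProduct.sum_tmul,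
      TensorProduct.tmul_sum] using Finset.sum_comm
  counit_apply i j := by
    rw [← Matrix.one_kronecker_one]
    simp [hc.counit_apply, hd.counit_apply, mul_comm]

end Coalgebra

section Bialgebra

variable {A : Type*} [Semiring A] [Bialgebra k A] {c : Matrix ι ι A} {d : Matrix κ κ A}

open scoped Kronecker

theorem kronecker (hc : IsComatrix k c) (hd : IsComatrix k d) : IsComatrix k (c ⊗ₖ d) :=
  (hc.kroneckerTMul hd).map (Bialgebra.mulCoalgHom k A)

theorem map_comul (hc : IsComatrix k c) : c.map (Coalgebra.comul (R := k)) =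
    c.map (Algebra.TensorProduct.includeLeft (R := k) (S := k) (B := A)) *
      c.map (Algebra.TensorProduct.includeRight (R := k) (A := A)) := by
  ext i j
  simp [Matrix.mul_apply, hc.comul_apply]

end Bialgebra
end IsComatrix

section Hopf

variable {k ι A B F : Type*} [CommSemiring k] [Fintype ι] [DecidableEq ι] [Semiring A]
  [HopfAlgebra k A] [Semiring B] [FunLike F A B] {c : Matrix ι ι A}

open HopfAlgebra (antipode)

namespace IsComatrix

theorem map_antipode_mul (hc : IsComatrix k c) : c.map (antipode k) * c = 1 := by
  ext i j
  have h := HopfAlgebra.mul_antipode_rTensor_comul_apply (R := k) (c i j)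
  simpa [hc.comul_apply, hc.counit_apply, Matrix.mul_apply, Matrix.one_apply, apply_ite] using h

theorem mul_map_antipode (hc : IsComatrix k c) : c * c.map (antipode k) = 1 := by
  ext i j
  have h := HopfAlgebra.mul_antipode_lTensor_comul_apply (R := k) (c i j)
  simpa [hc.comul_apply, hc.counit_apply, Matrix.mul_apply, Matrix.one_apply, apply_ite] using h

theorem map_map_antipode_mul [RingHomClass F A B] (hc : IsComatrix k c) (f : F) :
    (c.map (antipode k)).map f * c.map f = 1 := by
  rw [← Matrix.map_mul, hc.map_antipode_mul, Matrix.map_one _ (map_zero f) (map_one f)]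

theorem map_mul_map_antipode [RingHomClass F A B] (hc : IsComatrix k c) (f : F) :
    c.map f * (c.map (antipode k)).map f = 1 := by
  rw [← Matrix.map_mul, hc.mul_map_antipode, Matrix.map_one _ (map_zero f) (map_one f)]

theorem transpose_map_antipode (hc : IsComatrix k c) :
    IsComatrix k (c.map (antipode k)).transpose where
  comul_apply i j := by
    let inl := Algebra.TensorProduct.includeLeft (R := k) (S := k) (A := A) (B := A)
    let inr := Algebra.TensorProduct.includeRight (R := k) (A := A) (B := A)
    have hR : c.map (Bialgebra.comulAlgHom k A) *
        ((c.map (antipode k)).map inr * (c.map (antipode k)).map inl) = 1 := by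
      have comul_c : c.map (Bialgebra.comulAlgHom k A) = c.map inl * c.map inr := hc.map_comul
      rw [comul_c, mul_assoc, ← mul_assoc (c.map inr), hc.map_mul_map_antipode inr, one_mul,
        hc.map_mul_map_antipode inl]
    have h := left_inv_eq_right_inv (hc.map_map_antipode_mul (Bialgebra.comulAlgHom k A)) hR
    simpa [inl, inr, Matrix.mul_apply] using Matrix.ext_iff.2 h j i
  counit_apply i j := by
    simp [hc.counit_apply, Matrix.one_apply, eq_comm]

end IsComatrix

theorem map_antipode {k A B F : Type*} [Field k] [Ring A] [HopfAlgebra k A] [Ring B]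
    [HopfAlgebra k B] [FunLike F A B] [BialgHomClass F k A B] (f : F) (x : A) :
    f (antipode k x) = antipode k (f x) := by
  suffices (f : A →ₗ[k] B) ∘ₗ antipode k = antipode k ∘ₗ (f : A →ₗ[k] B) from
    LinearMap.congr_fun this x
  refine ext_comatrix fun n c hc i j => ?_
  exact Matrix.ext_iff.2 (left_inv_eq_right_inv (hc.map_map_antipode_mul f)
    (hc.map f).mul_map_antipode) i j

end Hopf

/-! ### Hopf algebras with a projection -/

section Legs

variable {A : Type*} [Semiring A] {ι κ : Type*} [Fintype ι] [DecidableEq ι] [Fintype κ]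
  [DecidableEq κ]

/-- The matrix `c ⊗ 1`, i.e. `c` acting on the first of two tensor factors. -/
def leg₁ : Matrix ι ι A →+* Matrix (ι × κ) (ι × κ) A where
  toFun c := .of fun p q => if p.2 = q.2 then c p.1 q.1 else 0
  map_one' := by
    ext p q
    simp [Matrix.one_apply, Prod.ext_iff, and_comm (a := p.1 = q.1), ite_and]
  map_mul' _ _ := by ext; simp [Matrix.mul_apply, Fintype.sum_prod_type]
  map_zero' := by ext; simp
  map_add' _ _ := by ext; simp [← ite_add_zero]

/-- The matrix `1 ⊗ d`, i.e. `d` acting on the second of two tensor factors. Its entries need not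
commute with those of `leg₁ c`, so the order of `leg₁ c` and `leg₂ d` in a product matters. -/
def leg₂ : Matrix κ κ A →+* Matrix (ι × κ) (ι × κ) A where
  toFun d := .of fun p q => if p.1 = q.1 then d p.2 q.2 else 0
  map_one' := by ext; simp [Matrix.one_apply, Prod.ext_iff, ite_and]
  map_mul' _ _ := by ext; simp [Matrix.mul_apply, Fintype.sum_prod_type]
  map_zero' := by ext; simp
  map_add' _ _ := by ext; simp [← ite_add_zero]

theorem leg₁_apply (c : Matrix ι ι A) (p q : ι × κ) :
    leg₁ c p q = if p.2 = q.2 then c p.1 q.1 else 0 := rfl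

theorem leg₂_apply (d : Matrix κ κ A) (p q : ι × κ) :
    leg₂ d p q = if p.1 = q.1 then d p.2 q.2 else 0 := rfl

theorem leg₁_mul_leg₂_apply (c : Matrix ι ι A) (d : Matrix κ κ A) (p q : ι × κ) :
    (leg₁ c * leg₂ d : Matrix (ι × κ) (ι × κ) A) p q = c p.1 q.1 * d p.2 q.2 := by
  simp [Matrix.mul_apply, Fintype.sum_prod_type, leg₁_apply, leg₂_apply]

theorem leg₂_mul_leg₁_apply (c : Matrix ι ι A) (d : Matrix κ κ A) (p q : ι × κ) :
    (leg₂ d * leg₁ c : Matrix (ι × κ) (ι × κ) A) p q = d p.2 q.2 * c p.1 q.1 := by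
  simp [Matrix.mul_apply, Fintype.sum_prod_type, leg₁_apply, leg₂_apply]

open scoped Kronecker in
theorem kronecker_eq_leg₁_mul_leg₂ (c : Matrix ι ι A) (d : Matrix κ κ A) :
    c ⊗ₖ d = leg₁ c * leg₂ d := by
  ext p q
  simp [leg₁_mul_leg₂_apply]

end Legs

section Projection

variable {k A H : Type*} [Field k] [Ring A] [HopfAlgebra k A] [Ring H] [HopfAlgebra k H]

open HopfAlgebra (antipode)
open scoped Kronecker

/-- The projection `Π(a) = a₁ i(S(π(a₂)))` onto the coinvariants of `π`. -/
def coinvProj (i : H →ₐc[k] A) (π : A →ₐc[k] H) : A →ₗ[k] A :=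
  coinvariantProj (hopfData k A) (hopfData k H) i π

/-- The map `a ↦ i(π(a₁)) S(a₂)`, which restricts to the braided antipode of the coinvariants. -/
def coinvAntipode (i : H →ₐc[k] A) (π : A →ₐc[k] H) : A →ₗ[k] A :=
  LinearMap.mul' k A ∘ₗ
    TensorProduct.map ((i : H →ₗ[k] A) ∘ₗ (π : A →ₗ[k] H)) (antipode k) ∘ₗ Coalgebra.comul

variable {ι κ : Type*} [Fintype ι] [DecidableEq ι] [Fintype κ] [DecidableEq κ]
  {i : H →ₐc[k] A} {π : A →ₐc[k] H} {c : Matrix ι ι A} {d : Matrix κ κ H}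

theorem coinvProj_eq_mul'_lTensor (a : A) :
    coinvProj i π a = LinearMap.mul' k A (((i : H →ₗ[k] A) ∘ₗ antipode k).lTensor A
      ((π : A →ₗ[k] H).lTensor A (Coalgebra.comul a))) := by
  rw [← LinearMap.lTensor_comp_apply]
  rfl

namespace IsComatrix

theorem map_coinvProj (hc : IsComatrix k c) :
    c.map (coinvProj i π) = c * ((c.map π).map (antipode k)).map i := by
  ext p q
  simp [coinvProj_eq_mul'_lTensor, hc.comul_apply, Matrix.mul_apply]

theorem map_coinvAntipode (hc : IsComatrix k c) :
    c.map (coinvAntipode i π) = (c.map π).map i * c.map (antipode k) := by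
  ext p q
  simp [coinvAntipode, hc.comul_apply, Matrix.mul_apply]

theorem coinvProj_apply (hc : IsComatrix k c) (p q : ι) :
    coinvProj i π (c p q) = ∑ a, c p a * i (antipode k (π (c a q))) :=
  Matrix.ext_iff.2 hc.map_coinvProj p q

theorem coinvAntipode_apply (hc : IsComatrix k c) (p q : ι) :
    coinvAntipode i π (c p q) = ∑ a, i (π (c p a)) * antipode k (c a q) :=
  Matrix.ext_iff.2 hc.map_coinvAntipode p q

theorem adjointAction_apply (hd : IsComatrix k d) (p q : κ) (a : A) :
    adjointAction (hopfData k A) (hopfData k H) (i : H →ₗ[k] A) (d p q ⊗ₜ a) =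
      ∑ r, i (d p r) * a * i (antipode k (d r q)) := by
  simp [adjointAction, hopfData, hd.comul_apply, TensorProduct.sum_tmul]

theorem map_coinvProj_mul (hc : IsComatrix k c) :
    c.map (coinvProj i π) * (c.map π).map i = c := by
  rw [hc.map_coinvProj, mul_assoc, (hc.map π).map_map_antipode_mul i, mul_one]

theorem map_coinvAntipode_mul (hc : IsComatrix k c) :
    c.map (coinvAntipode i π) * c = (c.map π).map i := by
  rw [hc.map_coinvAntipode, mul_assoc, hc.map_antipode_mul, mul_one]

theorem map_coinvProj_mul_map_coinvAntipode (hc : IsComatrix k c) :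
    c.map (coinvProj i π) * c.map (coinvAntipode i π) = 1 := by
  rw [hc.map_coinvAntipode, ← mul_assoc, hc.map_coinvProj_mul, hc.mul_map_antipode]

theorem map_antipode_mul_map_coinvAntipode (hc : IsComatrix k c) :
    ((c.map π).map (antipode k)).map i * c.map (coinvAntipode i π) = c.map (antipode k) := by
  rw [hc.map_coinvAntipode, ← mul_assoc, (hc.map π).map_map_antipode_mul i, one_mul]

theorem comul_coinvProj (hc : IsComatrix k c) (p q : ι) :
    Coalgebra.comul (R := k) (coinvProj i π (c p q)) =
      ∑ a, ∑ b, (c p a * i (antipode k (π (c b q)))) ⊗ₜ[k] coinvProj i π (c a b) := by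
  have comul_antipode (s t) := ((hc.map π).transpose_map_antipode).comul_apply t s
  simp only [Matrix.transpose_apply, Matrix.map_apply] at comul_antipode
  simp only [hc.coinvProj_apply, map_sum, Bialgebra.comul_mul, hc.comul_apply,
    ← CoalgHomClass.map_comp_comul_apply, comul_antipode, TensorProduct.map_tmul,
    LinearMap.coe_coe, Finset.sum_mul_sum, Algebra.TensorProduct.tmul_mul_tmul,
    TensorProduct.tmul_sum]
  rw [Finset.sum_comm]
  exact Finset.sum_congr rfl fun a _ => Finset.sum_comm

theorem comul_coinvAntipode (hc : IsComatrix k c) (p q : ι) :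
    Coalgebra.comul (R := k) (coinvAntipode i π (c p q)) =
      ∑ a, ∑ b, (i (π (c p a)) * antipode k (c b q)) ⊗ₜ[k] coinvAntipode i π (c a b) := by
  have comul_antipode (s t) := hc.transpose_map_antipode.comul_apply t s
  simp only [Matrix.transpose_apply, Matrix.map_apply] at comul_antipode
  simp only [hc.coinvAntipode_apply, map_sum, Bialgebra.comul_mul,
    ← CoalgHomClass.map_comp_comul_apply, hc.comul_apply, comul_antipode, TensorProduct.map_tmul,
    LinearMap.coe_coe, Finset.sum_mul_sum, Algebra.TensorProduct.tmul_mul_tmul,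
    TensorProduct.tmul_sum]
  rw [Finset.sum_comm]
  exact Finset.sum_congr rfl fun a _ => Finset.sum_comm

end IsComatrix

theorem counit_coinvProj (a : A) :
    Coalgebra.counit (R := k) (coinvProj i π a) = Coalgebra.counit (R := k) a := by
  suffices Coalgebra.counit (R := k) ∘ₗ coinvProj i π = Coalgebra.counit from
    LinearMap.congr_fun this a
  refine ext_comatrix fun n c hc p q => ?_
  simp [hc.coinvProj_apply, hc.counit_apply, Matrix.one_apply]

theorem coinvProj_of_mem {a : A}
    (ha : a ∈ coinvariants (hopfData k A) (hopfData k H) (π : A →ₗ[k] H)) :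
    coinvProj i π a = a := by
  have comul_a : (π : A →ₗ[k] H).lTensor A (Coalgebra.comul a) = a ⊗ₜ 1 := ha
  simp [coinvProj_eq_mul'_lTensor, comul_a]

/-- The coinvariants are the elements on which `(id ⊗ π) ∘ Δ` agrees with `id ⊗ 1`, two algebra
maps; hence `Π` is linear over them. -/
theorem coinvProj_mul_of_mem {a : A}
    (ha : a ∈ coinvariants (hopfData k A) (hopfData k H) (π : A →ₗ[k] H)) (b : A) :
    coinvProj i π (a * b) = a * coinvProj i π b := by
  have comul_a : (π : A →ₗ[k] H).lTensor A (Coalgebra.comul a) = a ⊗ₜ 1 := ha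
  have map_mul (s t : A ⊗[k] A) : (π : A →ₗ[k] H).lTensor A (s * t) =
      (π : A →ₗ[k] H).lTensor A s * (π : A →ₗ[k] H).lTensor A t :=
    _root_.map_mul (Algebra.TensorProduct.map (AlgHom.id k A) (π : A →ₐ[k] H)) s t
  rw [coinvProj_eq_mul'_lTensor, coinvProj_eq_mul'_lTensor, Bialgebra.comul_mul, map_mul, comul_a]
  generalize (π : A →ₗ[k] H).lTensor A (Coalgebra.comul b) = t
  induction t with
  | zero => simp
  | add x y hx hy => simp only [mul_add, map_add, hx, hy]
  | tmul x y => simp [mul_assoc]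

section ProjIncl

variable (hπi : ∀ x, π (i x) = x)
include hπi

theorem map_proj_coinvProj (hc : IsComatrix k c) : (c.map (coinvProj i π)).map π = 1 := by
  rw [hc.map_coinvProj, Matrix.map_mul, Matrix.map_map, (funext hπi : ⇑π ∘ ⇑i = id), Matrix.map_id,
    (hc.map π).mul_map_antipode]

theorem map_proj_coinvAntipode (hc : IsComatrix k c) : (c.map (coinvAntipode i π)).map π = 1 := by
  rw [hc.map_coinvAntipode, Matrix.map_mul, Matrix.map_map (f := i),
    (funext hπi : ⇑π ∘ ⇑i = id), Matrix.map_id, hc.map_mul_map_antipode π]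

theorem coinvProj_mem (a : A) :
    coinvProj i π a ∈ coinvariants (hopfData k A) (hopfData k H) (π : A →ₗ[k] H) := by
  suffices (π : A →ₗ[k] H).lTensor A ∘ₗ Coalgebra.comul ∘ₗ coinvProj i π =
      (TensorProduct.mk k A H).flip 1 ∘ₗ coinvProj i π from LinearMap.congr_fun this a
  refine ext_comatrix fun n c hc p q => ?_
  have proj_coinvProj (a b) : π (coinvProj i π (c a b)) = _ :=
    Matrix.ext_iff.2 (map_proj_coinvProj hπi hc) a b
  rw [LinearMap.comp_apply, LinearMap.comp_apply, hc.comul_coinvProj]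
  simp [proj_coinvProj, Matrix.one_apply, TensorProduct.tmul_ite]
  simp [hc.coinvProj_apply, TensorProduct.sum_tmul]

theorem coinvAntipode_mem (a : A) :
    coinvAntipode i π a ∈ coinvariants (hopfData k A) (hopfData k H) (π : A →ₗ[k] H) := by
  suffices (π : A →ₗ[k] H).lTensor A ∘ₗ Coalgebra.comul ∘ₗ coinvAntipode i π =
      (TensorProduct.mk k A H).flip 1 ∘ₗ coinvAntipode i π from LinearMap.congr_fun this a
  refine ext_comatrix fun n c hc p q => ?_
  have proj_coinvAntipode (a b) : π (coinvAntipode i π (c a b)) = _ :=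
    Matrix.ext_iff.2 (map_proj_coinvAntipode hπi hc) a b
  rw [LinearMap.comp_apply, LinearMap.comp_apply, hc.comul_coinvAntipode]
  simp [proj_coinvAntipode, Matrix.one_apply, TensorProduct.tmul_ite]
  simp [hc.coinvAntipode_apply, TensorProduct.sum_tmul]

theorem range_coinvProj : LinearMap.range (coinvProj i π) =
    coinvariants (hopfData k A) (hopfData k H) (π : A →ₗ[k] H) :=
  le_antisymm (LinearMap.range_le_iff_comap.2 (eq_top_iff.2 fun a _ => coinvProj_mem hπi a))
    fun a ha => ⟨a, coinvProj_of_mem ha⟩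

theorem map_coinvProj_kronecker_incl (hc : IsComatrix k c) (hd : IsComatrix k d) :
    (c ⊗ₖ d.map i).map (coinvProj i π) = leg₁ (c.map (coinvProj i π)) := by
  have antipode_eq : (((c ⊗ₖ d.map i).map π).map (antipode k)).map i =
      leg₂ ((d.map (antipode k)).map i) * leg₁ (((c.map π).map (antipode k)).map i) := by
    ext p q
    simp [leg₂_mul_leg₁_apply, HopfAlgebra.antipode_mul_antidistrib, hπi]
  rw [(hc.kronecker (hd.map i)).map_coinvProj, antipode_eq, kronecker_eq_leg₁_mul_leg₂, mul_assoc,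
    ← mul_assoc (leg₂ _), ← map_mul leg₂, hd.map_mul_map_antipode, map_one, one_mul, ← map_mul,
    hc.map_coinvProj]

theorem map_coinvAntipode_kronecker_incl (hc : IsComatrix k c) (hd : IsComatrix k d) :
    (c ⊗ₖ d.map i).map (coinvAntipode i π) = leg₁ (c.map (coinvAntipode i π)) := by
  have proj_eq : ((c ⊗ₖ d.map i).map π).map i = leg₁ ((c.map π).map i) * leg₂ (d.map i) := by
    ext p q
    simp [leg₁_mul_leg₂_apply, hπi]
  have antipode_eq : (c ⊗ₖ d.map i).map (antipode k) =
      leg₂ ((d.map (antipode k)).map i) * leg₁ (c.map (antipode k)) := by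
    ext p q
    simp [leg₂_mul_leg₁_apply, HopfAlgebra.antipode_mul_antidistrib, map_antipode]
  rw [(hc.kronecker (hd.map i)).map_coinvAntipode, antipode_eq, proj_eq, mul_assoc,
    ← mul_assoc (leg₂ _), ← map_mul leg₂, hd.map_mul_map_antipode, map_one, one_mul, ← map_mul,
    hc.map_coinvAntipode]

theorem coinvProj_mul_incl (a : A) (x : H) :
    coinvProj i π (a * i x) = Coalgebra.counit (R := k) x • coinvProj i π a := by
  suffices ((LinearMap.mul k A).compl₂ (i : H →ₗ[k] A)).compr₂ (coinvProj i π) =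
      (LinearMap.lsmul k A).flip.compl₁₂ (coinvProj i π) Coalgebra.counit from
    LinearMap.congr_fun₂ this a x
  refine ext_comatrix₂ fun n c hc m d hd p q r s => ?_
  have h : coinvProj i π (c p q * i (d r s)) = _ :=
    Matrix.ext_iff.2 (map_coinvProj_kronecker_incl hπi hc hd) (p, r) (q, s)
  simp [h, leg₁_apply, hd.counit_apply, Matrix.one_apply]

theorem coinvAntipode_mul_incl (a : A) (x : H) :
    coinvAntipode i π (a * i x) = Coalgebra.counit (R := k) x • coinvAntipode i π a := by
  suffices ((LinearMap.mul k A).compl₂ (i : H →ₗ[k] A)).compr₂ (coinvAntipode i π) =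
      (LinearMap.lsmul k A).flip.compl₁₂ (coinvAntipode i π) Coalgebra.counit from
    LinearMap.congr_fun₂ this a x
  refine ext_comatrix₂ fun n c hc m d hd p q r s => ?_
  have h : coinvAntipode i π (c p q * i (d r s)) = _ :=
    Matrix.ext_iff.2 (map_coinvAntipode_kronecker_incl hπi hc hd) (p, r) (q, s)
  simp [h, leg₁_apply, hd.counit_apply, Matrix.one_apply]

theorem coinvProj_incl_mul (x : H) (a : A) :
    coinvProj i π (i x * a) = adjointAction (hopfData k A) (hopfData k H) (i : H →ₗ[k] A)
      (x ⊗ₜ coinvProj i π a) := by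
  suffices ((LinearMap.mul k A).comp (i : H →ₗ[k] A)).compr₂ (coinvProj i π) =
      ((TensorProduct.mk k H A).compl₂ (coinvProj i π)).compr₂
        (adjointAction (hopfData k A) (hopfData k H) (i : H →ₗ[k] A)) from
    LinearMap.congr_fun₂ this x a
  refine ext_comatrix₂ fun n d hd m c hc r s p q => ?_
  have h := ((hd.map i).kronecker hc).coinvProj_apply (i := i) (π := π) (r, p) (s, q)
  simp only [Matrix.kronecker_apply, Matrix.map_apply, Fintype.sum_prod_type, map_mul, hπi,
    HopfAlgebra.antipode_mul_antidistrib] at h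
  simp only [LinearMap.compr₂_apply, LinearMap.comp_apply, LinearMap.compl₂_apply,
    LinearMap.mul_apply', LinearMap.coe_coe, TensorProduct.mk_apply, h, hc.coinvProj_apply,
    hd.adjointAction_apply, Finset.mul_sum, Finset.sum_mul, mul_assoc]

theorem coinvAntipode_incl_mul (x : H) (a : A) :
    coinvAntipode i π (i x * a) = adjointAction (hopfData k A) (hopfData k H) (i : H →ₗ[k] A)
      (x ⊗ₜ coinvAntipode i π a) := by
  suffices ((LinearMap.mul k A).comp (i : H →ₗ[k] A)).compr₂ (coinvAntipode i π) =
      ((TensorProduct.mk k H A).compl₂ (coinvAntipode i π)).compr₂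
        (adjointAction (hopfData k A) (hopfData k H) (i : H →ₗ[k] A)) from
    LinearMap.congr_fun₂ this x a
  refine ext_comatrix₂ fun n d hd m c hc r s p q => ?_
  have h := ((hd.map i).kronecker hc).coinvAntipode_apply (i := i) (π := π) (r, p) (s, q)
  simp only [Matrix.kronecker_apply, Matrix.map_apply, Fintype.sum_prod_type, map_mul, hπi,
    HopfAlgebra.antipode_mul_antidistrib, ← map_antipode] at h
  simp only [LinearMap.compr₂_apply, LinearMap.comp_apply, LinearMap.compl₂_apply,
    LinearMap.mul_apply', LinearMap.coe_coe, TensorProduct.mk_apply, h, hc.coinvAntipode_apply,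
    hd.adjointAction_apply, Finset.mul_sum, Finset.sum_mul, mul_assoc, map_antipode]

theorem coinvAntipode_coinvProj (a : A) :
    coinvAntipode i π (coinvProj i π a) = coinvAntipode i π a := by
  suffices coinvAntipode i π ∘ₗ coinvProj i π = coinvAntipode i π from LinearMap.congr_fun this a
  refine ext_comatrix fun n c hc p q => ?_
  simp [hc.coinvProj_apply, coinvAntipode_mul_incl hπi, hc.counit_apply, Matrix.one_apply]

end ProjIncl

end Projection

/-! ### The braided Hopf algebra of coinvariants -/

section CoinvariantModel

open HopfAlgebra (antipode)

variable {k A H B : Type*} [Field k] [Ring A] [HopfAlgebra k A] [Ring H] [HopfAlgebra k H]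
  [AddCommGroup B] [Module k B]

/-- `E` and `R` are the structures which the coinvariants of `π` carry, transported to `B`: the
map `θ` identifies `B` with the coinvariants, and `ρ` is its inverse composed with `Π`. -/
structure IsCoinvariantModel (i : H →ₐc[k] A) (π : A →ₐc[k] H) (θ : B →ₗ[k] A) (ρ : A →ₗ[k] B)
    (E : YDData k H B) (R : HopfData k B) : Prop where
  proj_incl : ∀ x, π (i x) = x
  theta_rho : ∀ a, θ (ρ a) = coinvProj i π a
  rho_theta : ∀ b, ρ (θ b) = b
  theta_act : ∀ x b, θ (E.act (x ⊗ₜ b)) =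
    adjointAction (hopfData k A) (hopfData k H) (i : H →ₗ[k] A) (x ⊗ₜ θ b)
  theta_coact : ∀ b, θ.lTensor H (E.coact b) =
    (π : A →ₗ[k] H).rTensor A (Coalgebra.comul (θ b))
  theta_mul : ∀ b b', θ (R.mul (b ⊗ₜ b')) = θ b * θ b'
  theta_one : θ R.one = 1
  comul_rho : ∀ a, R.comul (ρ a) = TensorProduct.map ρ ρ (Coalgebra.comul a)
  counit_eq : ∀ b, R.counit b = Coalgebra.counit (R := k) (θ b)
  theta_antipode : ∀ b, θ (R.antipode b) = coinvAntipode i π (θ b)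

theorem IsComatrix.comul_mul_antipode {κ : Type*} [Fintype κ] [DecidableEq κ]
    {d : Matrix κ κ H} (hd : IsComatrix k d) (p l r q : κ) :
    Coalgebra.comul (R := k) (d p l * antipode k (d r q)) =
      ∑ s, ∑ t, (d p s * antipode k (d t q)) ⊗ₜ (d s l * antipode k (d r t)) := by
  have comul_antipode := hd.transpose_map_antipode.comul_apply q r
  simp only [Matrix.transpose_apply, Matrix.map_apply] at comul_antipode
  simp [hd.comul_apply, comul_antipode, Finset.sum_mul_sum]

theorem IsComatrix.sum_adjointAction_mul_incl {κ : Type*} [Fintype κ] [DecidableEq κ]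
    {d : Matrix κ κ H} (hd : IsComatrix k d) (i : H →ₐc[k] A) (r s : κ) (a : A) :
    ∑ u, adjointAction (hopfData k A) (hopfData k H) (i : H →ₗ[k] A) (d r u ⊗ₜ a) * i (d u s) =
      i (d r s) * a := by
  have cancel (v) : ∑ u, i (antipode k (d v u)) * i (d u s) = (1 : Matrix κ κ A) v s :=
    Matrix.ext_iff.2 (hd.map_map_antipode_mul i) v s
  simp only [hd.adjointAction_apply, Finset.sum_mul]
  rw [Finset.sum_comm]
  simp [mul_assoc, ← Finset.mul_sum, cancel, Matrix.one_apply]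

namespace IsCoinvariantModel

variable {i : H →ₐc[k] A} {π : A →ₐc[k] H} {θ : B →ₗ[k] A} {ρ : A →ₗ[k] B}
  {E : YDData k H B} {R : HopfData k B} (h : IsCoinvariantModel i π θ ρ E R)
include h

theorem injective_theta : Function.Injective θ :=
  Function.LeftInverse.injective h.rho_theta

theorem surjective_rho : Function.Surjective ρ :=
  Function.RightInverse.surjective h.rho_theta

theorem ext_rho {W : Type*} [AddCommGroup W] [Module k W] {F G : B →ₗ[k] W}
    (hFG : ∀ (n : ℕ) (c : Matrix (Fin n) (Fin n) A), IsComatrix k c →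
      ∀ p q, F (ρ (c p q)) = G (ρ (c p q))) : F = G :=
  (LinearMap.cancel_right h.surjective_rho).1 (ext_comatrix hFG)

theorem theta_mem (b : B) :
    θ b ∈ coinvariants (hopfData k A) (hopfData k H) (π : A →ₗ[k] H) := by
  obtain ⟨a, rfl⟩ := h.surjective_rho b
  rw [h.theta_rho]
  exact coinvProj_mem h.proj_incl a

theorem rho_coinvProj (a : A) : ρ (coinvProj i π a) = ρ a := by
  rw [← h.theta_rho, h.rho_theta]

theorem rho_mul_incl (a : A) (x : H) : ρ (a * i x) = Coalgebra.counit (R := k) x • ρ a := by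
  rw [← h.rho_coinvProj, coinvProj_mul_incl h.proj_incl, map_smul, h.rho_coinvProj]

theorem rho_incl (x : H) : ρ (i x) = Coalgebra.counit (R := k) x • ρ 1 := by
  simpa using h.rho_mul_incl 1 x

theorem theta_mul_rho (b : B) (a : A) : R.mul (b ⊗ₜ ρ a) = ρ (θ b * a) :=
  h.injective_theta <| by
    rw [h.theta_mul, h.theta_rho, h.theta_rho, coinvProj_mul_of_mem (h.theta_mem b)]

theorem one_eq_rho : R.one = ρ 1 := by
  rw [← h.theta_one, h.rho_theta]

theorem counit_rho (a : A) : R.counit (ρ a) = Coalgebra.counit (R := k) a := by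
  rw [h.counit_eq, h.theta_rho, counit_coinvProj]

theorem theta_antipode_rho (a : A) : θ (R.antipode (ρ a)) = coinvAntipode i π a := by
  rw [h.theta_antipode, h.theta_rho, coinvAntipode_coinvProj h.proj_incl]

theorem antipode_rho (a : A) : R.antipode (ρ a) = ρ (coinvAntipode i π a) := by
  rw [← h.theta_antipode_rho, h.rho_theta]

theorem act_rho (x : H) (a : A) : E.act (x ⊗ₜ ρ a) = ρ (i x * a) :=
  h.injective_theta <| by
    rw [h.theta_act, h.theta_rho, h.theta_rho, coinvProj_incl_mul h.proj_incl]

theorem coact_eq (b : B) :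
    E.coact b = TensorProduct.map (π : A →ₗ[k] H) ρ (Coalgebra.comul (θ b)) := by
  have rho_comp_theta : ρ ∘ₗ θ = LinearMap.id := LinearMap.ext h.rho_theta
  rw [← LinearMap.lTensor_comp_rTensor, LinearMap.comp_apply, ← h.theta_coact,
    ← LinearMap.lTensor_comp_apply, rho_comp_theta, LinearMap.lTensor_id, LinearMap.id_apply]

variable {ι : Type*} [Fintype ι] [DecidableEq ι] {c : Matrix ι ι A}

theorem coact_rho (hc : IsComatrix k c) (p q : ι) : E.coact (ρ (c p q)) =
    ∑ l, ∑ r, (π (c p l) * antipode k (π (c r q))) ⊗ₜ ρ (c l r) := by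
  simp [h.coact_eq, h.theta_rho, hc.comul_coinvProj, h.rho_coinvProj, h.proj_incl]

theorem comul_rho_apply (hc : IsComatrix k c) (p q : ι) :
    R.comul (ρ (c p q)) = ∑ s, ρ (c p s) ⊗ₜ ρ (c s q) := by
  simp [h.comul_rho, hc.comul_apply]

theorem coact_one : E.coact R.one = 1 ⊗ₜ R.one := by
  rw [h.coact_eq, h.theta_one, h.one_eq_rho]
  simp [Algebra.TensorProduct.one_def]

theorem counit_coact (b : B) :
    (Coalgebra.counit (R := k) (A := H)).rTensor B (E.coact b) = 1 ⊗ₜ b := by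
  suffices (Coalgebra.counit (R := k) (A := H)).rTensor B ∘ₗ E.coact =
      TensorProduct.mk k k B 1 from LinearMap.congr_fun this b
  refine h.ext_rho fun n c hc p q => ?_
  simp [h.coact_rho hc, hc.counit_apply, Matrix.one_apply, TensorProduct.ite_tmul]

theorem comul_coact (b : B) :
    TensorProduct.assoc k H H B ((Coalgebra.comul (R := k)).rTensor B (E.coact b)) =
      E.coact.lTensor H (E.coact b) := by
  suffices (TensorProduct.assoc k H H B).toLinearMap ∘ₗ
      (Coalgebra.comul (R := k)).rTensor B ∘ₗ E.coact = E.coact.lTensor H ∘ₗ E.coact from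
    LinearMap.congr_fun this b
  refine h.ext_rho fun n c hc p q => ?_
  have comul_mul_antipode := (hc.map π).comul_mul_antipode
  simp only [Matrix.map_apply] at comul_mul_antipode
  simp only [LinearMap.comp_apply, h.coact_rho hc, map_sum, LinearMap.rTensor_tmul,
    LinearMap.lTensor_tmul, comul_mul_antipode, TensorProduct.sum_tmul, TensorProduct.tmul_sum,
    LinearEquiv.coe_coe, TensorProduct.assoc_tmul]
  rw [Finset.sum_comm_cycle]
  exact Finset.sum_congr rfl fun s _ => Finset.sum_comm_cycle

theorem coact_act {κ : Type*} [Fintype κ] [DecidableEq κ] {d : Matrix κ κ H}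
    (hd : IsComatrix k d) (r u : κ) (b : B) :
    E.coact (E.act (d r u ⊗ₜ b)) = ∑ v, ∑ w,
      TensorProduct.map (LinearMap.mulLeft k (d r v) ∘ₗ LinearMap.mulRight k (antipode k (d w u)))
        (E.act ∘ₗ TensorProduct.mk k H B (d v w)) (E.coact b) := by
  suffices E.coact ∘ₗ E.act ∘ₗ TensorProduct.mk k H B (d r u) = ∑ v, ∑ w,
      TensorProduct.map
        (LinearMap.mulLeft k (d r v) ∘ₗ LinearMap.mulRight k (antipode k (d w u)))
        (E.act ∘ₗ TensorProduct.mk k H B (d v w)) ∘ₗ E.coact by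
    simpa using LinearMap.congr_fun this b
  refine h.ext_rho fun n c hc p q => ?_
  have coact_mul := h.coact_rho ((hd.map i).kronecker hc) (r, p) (u, q)
  simp only [Matrix.kronecker_apply, Matrix.map_apply, Fintype.sum_prod_type, map_mul,
    h.proj_incl, HopfAlgebra.antipode_mul_antidistrib] at coact_mul
  simp only [LinearMap.comp_apply, LinearMap.sum_apply, TensorProduct.mk_apply, h.act_rho,
    coact_mul, h.coact_rho hc, map_sum, TensorProduct.map_tmul, LinearMap.mulLeft_apply,
    LinearMap.mulRight_apply, mul_assoc]
  exact Finset.sum_congr rfl fun v _ => Finset.sum_comm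

theorem compat (κ : H) (b : B) :
    TensorProduct.map (LinearMap.mul' k H) E.act
        (TensorProduct.tensorTensorTensorComm k H H H B
          (Coalgebra.comul (R := k) κ ⊗ₜ E.coact b)) =
      (LinearMap.mul' k H).rTensor B (TensorProduct.rightComm k H B H
        ((E.coact ∘ₗ E.act ∘ₗ (TensorProduct.mk k H B).flip b).rTensor H
          (Coalgebra.comul (R := k) κ))) := by
  suffices TensorProduct.map (LinearMap.mul' k H) E.act ∘ₗ
        (TensorProduct.tensorTensorTensorComm k H H H B).toLinearMap ∘ₗ
          (TensorProduct.mk k _ _).flip (E.coact b) ∘ₗ Coalgebra.comul =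
      (LinearMap.mul' k H).rTensor B ∘ₗ (TensorProduct.rightComm k H B H).toLinearMap ∘ₗ
        (E.coact ∘ₗ E.act ∘ₗ (TensorProduct.mk k H B).flip b).rTensor H ∘ₗ Coalgebra.comul from
    LinearMap.congr_fun this κ
  refine ext_comatrix fun n d hd r s => ?_
  have cancel (w) : ∑ u, antipode k (d w u) * d u s = (1 : Matrix _ _ H) w s :=
    Matrix.ext_iff.2 hd.map_antipode_mul w s
  simp only [LinearMap.comp_apply, hd.comul_apply, map_sum, LinearMap.rTensor_tmul,
    LinearMap.flip_apply, TensorProduct.mk_apply, h.coact_act hd, LinearEquiv.coe_coe,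
    TensorProduct.sum_tmul]
  generalize E.coact b = t
  induction t with
  | zero => simp
  | add x y hx hy => simp only [map_add, TensorProduct.tmul_add, TensorProduct.add_tmul,
      Finset.sum_add_distrib, hx, hy]
  | tmul x b =>
    rw [Finset.sum_comm]
    refine Finset.sum_congr rfl fun v _ => ?_
    rw [Finset.sum_comm]
    simp [mul_assoc, ← TensorProduct.sum_tmul, ← Finset.mul_sum, cancel, Matrix.one_apply,
      TensorProduct.ite_tmul]

theorem isYetterDrinfeld : E.IsYetterDrinfeld (hopfData k H) where
  one_act b := by
    obtain ⟨a, rfl⟩ := h.surjective_rho b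
    simp [hopfData, h.act_rho]
  mul_act x y b := by
    obtain ⟨a, rfl⟩ := h.surjective_rho b
    simp [hopfData, h.act_rho, mul_assoc]
  counit_coact := h.counit_coact
  comul_coact := h.comul_coact
  compat := h.compat

theorem mul_act (x : H) (b b' : B) :
    R.mul ((E.tensor (hopfData k H) E).act (x ⊗ₜ (b ⊗ₜ b'))) = E.act (x ⊗ₜ R.mul (b ⊗ₜ b')) := by
  obtain ⟨a', rfl⟩ := h.surjective_rho b'
  suffices R.mul ∘ₗ (E.tensor (hopfData k H) E).act ∘ₗ
        (TensorProduct.mk k H (B ⊗[k] B)).flip (b ⊗ₜ ρ a') =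
      E.act ∘ₗ (TensorProduct.mk k H B).flip (R.mul (b ⊗ₜ ρ a')) from LinearMap.congr_fun this x
  refine ext_comatrix fun n d hd r s => ?_
  suffices ∑ u, ρ (θ (E.act (d r u ⊗ₜ b)) * (i (d u s) * a')) = ρ (i (d r s) * (θ b * a')) by
    simpa [YDData.tensor, hopfData, hd.comul_apply, TensorProduct.sum_tmul, h.act_rho,
      h.theta_mul_rho]
  simp only [h.theta_act, ← map_sum, ← mul_assoc, ← Finset.sum_mul,
    hd.sum_adjointAction_mul_incl]

theorem coact_mul (b b' : B) : E.coact (R.mul (b ⊗ₜ b')) =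
    R.mul.lTensor H ((E.tensor (hopfData k H) E).coact (b ⊗ₜ b')) := by
  have coact_mul_eq : E.coact (R.mul (b ⊗ₜ b')) =
      ρ.lTensor H (θ.lTensor H (E.coact b) * θ.lTensor H (E.coact b')) := by
    rw [h.theta_coact, h.theta_coact, h.coact_eq, h.theta_mul, Bialgebra.comul_mul,
      ← LinearMap.lTensor_comp_rTensor, LinearMap.comp_apply]
    exact congr_arg _ (map_mul (Algebra.TensorProduct.map (π : A →ₐ[k] H) (AlgHom.id k A)) _ _)
  rw [coact_mul_eq, YDData.tensor, LinearMap.comp_apply, LinearMap.comp_apply,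
    TensorProduct.map_tmul]
  generalize E.coact b = t
  generalize E.coact b' = t'
  induction t with
  | zero => simp
  | add x y hx hy => simp only [map_add, TensorProduct.add_tmul, add_mul, hx, hy]
  | tmul x b =>
    induction t' with
    | zero => simp
    | add x y hx hy => simp only [map_add, TensorProduct.tmul_add, mul_add, hx, hy]
    | tmul y b' => simp [hopfData, ← h.theta_mul, h.rho_theta]

theorem comul_act (x : H) (b : B) : R.comul (E.act (x ⊗ₜ b)) =
    (E.tensor (hopfData k H) E).act (x ⊗ₜ R.comul b) := by
  obtain ⟨a, rfl⟩ := h.surjective_rho b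
  rw [h.act_rho, h.comul_rho, h.comul_rho, Bialgebra.comul_mul,
    ← CoalgHomClass.map_comp_comul_apply]
  simp only [YDData.tensor, hopfData, LinearMap.comp_apply, LinearMap.rTensor_tmul]
  generalize Coalgebra.comul (R := k) x = s
  generalize Coalgebra.comul (R := k) a = t
  induction s with
  | zero => simp
  | add x y hx hy => simp only [map_add, TensorProduct.add_tmul, add_mul, hx, hy]
  | tmul x y =>
    induction t with
    | zero => simp
    | add x y hx hy => simp only [map_add, TensorProduct.tmul_add, mul_add, hx, hy]
    | tmul a a' => simp [h.act_rho]

theorem coact_comul (b : B) : (E.tensor (hopfData k H) E).coact (R.comul b) =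
    R.comul.lTensor H (E.coact b) := by
  suffices (E.tensor (hopfData k H) E).coact ∘ₗ R.comul = R.comul.lTensor H ∘ₗ E.coact from
    LinearMap.congr_fun this b
  refine h.ext_rho fun n c hc p q => ?_
  have cancel (r l) : ∑ s, antipode k (π (c r s)) * π (c s l) = (1 : Matrix _ _ H) r l :=
    Matrix.ext_iff.2 (hc.map π).map_antipode_mul r l
  calc (E.tensor (hopfData k H) E).coact (R.comul (ρ (c p q)))
    _ = ∑ s, ∑ l', ∑ r', ∑ l, ∑ r, (π (c p l) * antipode k (π (c r s)) *
          (π (c s l') * antipode k (π (c r' q)))) ⊗ₜ (ρ (c l r) ⊗ₜ ρ (c l' r')) := by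
      simp [h.comul_rho_apply hc, YDData.tensor, h.coact_rho hc, hopfData,
        TensorProduct.sum_tmul, TensorProduct.tmul_sum]
    _ = ∑ l', ∑ r', ∑ l, ∑ r, (π (c p l) * (∑ s, antipode k (π (c r s)) * π (c s l')) *
          antipode k (π (c r' q))) ⊗ₜ (ρ (c l r) ⊗ₜ ρ (c l' r')) := by
      simp only [Finset.mul_sum, Finset.sum_mul, TensorProduct.sum_tmul, mul_assoc]
      rw [Finset.sum_comm]
      refine Finset.sum_congr rfl fun l' _ => ?_
      rw [Finset.sum_comm]
      refine Finset.sum_congr rfl fun r' _ => ?_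
      rw [Finset.sum_comm]
      exact Finset.sum_congr rfl fun l _ => Finset.sum_comm
    _ = ∑ l', ∑ r', ∑ l, (π (c p l) * antipode k (π (c r' q))) ⊗ₜ
          (ρ (c l l') ⊗ₜ ρ (c l' r')) := by
      simp [cancel, Matrix.one_apply, TensorProduct.ite_tmul]
    _ = R.comul.lTensor H (E.coact (ρ (c p q))) := by
      simp only [h.coact_rho hc, map_sum, LinearMap.lTensor_tmul, h.comul_rho_apply hc,
        TensorProduct.tmul_sum]
      rw [Finset.sum_comm_cycle]
      exact Finset.sum_congr rfl fun l _ => Finset.sum_comm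

theorem counit_coact_unit (b : B) : (YDData.unit (hopfData k H)).coact (R.counit b) =
    R.counit.lTensor H (E.coact b) := by
  suffices (YDData.unit (hopfData k H)).coact ∘ₗ R.counit = R.counit.lTensor H ∘ₗ E.coact from
    LinearMap.congr_fun this b
  refine h.ext_rho fun n c hc p q => ?_
  have cancel : ∑ l, π (c p l) * antipode k (π (c l q)) = (1 : Matrix _ _ H) p q :=
    Matrix.ext_iff.2 (hc.map π).mul_map_antipode p q
  simp [YDData.unit, hopfData, h.coact_rho hc, h.counit_rho, hc.counit_apply, Matrix.one_apply,
    TensorProduct.tmul_ite, TensorProduct.ite_tmul, ← TensorProduct.sum_tmul, cancel]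

theorem antipode_act (x : H) (b : B) :
    R.antipode (E.act (x ⊗ₜ b)) = E.act (x ⊗ₜ R.antipode b) := by
  obtain ⟨a, rfl⟩ := h.surjective_rho b
  refine h.injective_theta ?_
  rw [h.act_rho, h.theta_antipode_rho, h.theta_act, h.theta_antipode_rho,
    coinvAntipode_incl_mul h.proj_incl]

theorem coact_antipode (b : B) :
    E.coact (R.antipode b) = R.antipode.lTensor H (E.coact b) := by
  suffices E.coact ∘ₗ R.antipode = R.antipode.lTensor H ∘ₗ E.coact from LinearMap.congr_fun this b
  refine h.ext_rho fun n c hc p q => ?_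
  rw [LinearMap.comp_apply, LinearMap.comp_apply, h.coact_eq, h.theta_antipode_rho,
    hc.comul_coinvAntipode]
  simp [h.coact_rho hc, h.proj_incl, h.antipode_rho, map_antipode]

theorem comul_mul (b b' : B) : R.comul (R.mul (b ⊗ₜ b')) =
    TensorProduct.map R.mul R.mul (middle (E.braiding E) (R.comul b ⊗ₜ R.comul b')) := by
  obtain ⟨a', rfl⟩ := h.surjective_rho b'
  suffices R.comul ∘ₗ R.mul ∘ₗ (TensorProduct.mk k B B).flip (ρ a') =
      TensorProduct.map R.mul R.mul ∘ₗ middle (E.braiding E) ∘ₗ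
        (TensorProduct.mk k (B ⊗[k] B) (B ⊗[k] B)).flip (R.comul (ρ a')) ∘ₗ R.comul from
    LinearMap.congr_fun this b
  refine h.ext_rho fun n c hc p q => ?_
  have cancel (l) : ∑ s, coinvProj i π (c p s) * i (π (c s l)) = c p l :=
    Matrix.ext_iff.2 hc.map_coinvProj_mul p l
  simp only [LinearMap.comp_apply, LinearMap.flip_apply, TensorProduct.mk_apply, h.theta_mul_rho,
    h.theta_rho, h.comul_rho, Bialgebra.comul_mul, hc.comul_coinvProj, hc.comul_apply]
  generalize Coalgebra.comul (R := k) a' = t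
  induction t with
  | zero => simp
  | add x y hx hy => simp only [map_add, TensorProduct.tmul_add, mul_add, hx, hy]
  | tmul x y =>
    suffices ∑ s, ∑ l, ∑ r,
        ρ (coinvProj i π (c p s) * (i (π (c s l)) * i (antipode k (π (c r q))) * x)) ⊗ₜ[k]
          ρ (coinvProj i π (c l r) * y) =
        ∑ l, ∑ r, ρ (c p l * i (antipode k (π (c r q))) * x) ⊗ₜ[k] ρ (coinvProj i π (c l r) * y) by
      simp [middle, YDData.braiding, h.coact_rho hc, TensorProduct.sum_tmul, TensorProduct.tmul_sum,
        h.act_rho, h.theta_mul_rho, h.theta_rho, Finset.sum_mul, this]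
    rw [Finset.sum_comm]
    refine Finset.sum_congr rfl fun l _ => ?_
    rw [Finset.sum_comm]
    refine Finset.sum_congr rfl fun r _ => ?_
    simp only [← TensorProduct.sum_tmul, ← map_sum, ← mul_assoc, ← Finset.sum_mul, cancel]

theorem antipode_left (b : B) :
    R.mul (R.antipode.rTensor B (R.comul b)) = R.counit b • R.one := by
  suffices R.mul ∘ₗ R.antipode.rTensor B ∘ₗ R.comul = R.counit.smulRight R.one from
    LinearMap.congr_fun this b
  refine h.ext_rho fun n c hc p q => ?_
  have cancel : ∑ s, coinvAntipode i π (c p s) * c s q = i (π (c p q)) :=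
    Matrix.ext_iff.2 hc.map_coinvAntipode_mul p q
  simp only [LinearMap.comp_apply, h.comul_rho_apply hc, map_sum, LinearMap.rTensor_tmul,
    h.theta_mul_rho, h.theta_antipode_rho]
  simp only [← map_sum, cancel, h.rho_incl, h.counit_rho, h.one_eq_rho, LinearMap.smulRight_apply,
    CoalgHomClass.counit_comp_apply]

theorem antipode_right (b : B) :
    R.mul (R.antipode.lTensor B (R.comul b)) = R.counit b • R.one := by
  suffices R.mul ∘ₗ R.antipode.lTensor B ∘ₗ R.comul = R.counit.smulRight R.one from
    LinearMap.congr_fun this b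
  refine h.ext_rho fun n c hc p q => ?_
  have cancel : ∑ s, coinvProj i π (c p s) * coinvAntipode i π (c s q) = (1 : Matrix _ _ A) p q :=
    Matrix.ext_iff.2 hc.map_coinvProj_mul_map_coinvAntipode p q
  simp only [LinearMap.comp_apply, h.comul_rho_apply hc, map_sum, LinearMap.lTensor_tmul,
    h.antipode_rho, h.theta_mul_rho, h.theta_rho]
  simp [← map_sum, cancel, h.counit_rho, hc.counit_apply, h.one_eq_rho, Matrix.one_apply,
    apply_ite ρ]

theorem hopfAxioms : R.HopfAxioms (E.braiding E) where
  mul_assoc b b' b'' := h.injective_theta <| by simp only [h.theta_mul, mul_assoc]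
  one_mul b := h.injective_theta <| by rw [h.theta_mul, h.theta_one, one_mul]
  mul_one b := h.injective_theta <| by rw [h.theta_mul, h.theta_one, mul_one]
  coassoc b := by
    suffices (TensorProduct.assoc k B B B).toLinearMap ∘ₗ R.comul.rTensor B ∘ₗ R.comul =
      R.comul.lTensor B ∘ₗ R.comul from LinearMap.congr_fun this b
    refine h.ext_rho fun n c hc p q => ?_
    simp only [LinearMap.comp_apply, LinearEquiv.coe_coe, h.comul_rho_apply hc, map_sum,
      LinearMap.rTensor_tmul, LinearMap.lTensor_tmul, TensorProduct.sum_tmul,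
      TensorProduct.tmul_sum, TensorProduct.assoc_tmul]
    exact Finset.sum_comm
  counit_left b := by
    suffices R.counit.rTensor B ∘ₗ R.comul = TensorProduct.mk k k B 1 from
      LinearMap.congr_fun this b
    refine h.ext_rho fun n c hc p q => ?_
    simp [h.comul_rho_apply hc, h.counit_rho, hc.counit_apply, Matrix.one_apply,
      TensorProduct.ite_tmul]
  counit_right b := by
    suffices R.counit.lTensor B ∘ₗ R.comul = (TensorProduct.mk k B k).flip 1 from
      LinearMap.congr_fun this b
    refine h.ext_rho fun n c hc p q => ?_
    simp [h.comul_rho_apply hc, h.counit_rho, hc.counit_apply, Matrix.one_apply,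
      TensorProduct.tmul_ite]
  comul_mul := h.comul_mul
  comul_one := by simp [h.one_eq_rho, h.comul_rho, Algebra.TensorProduct.one_def]
  counit_mul b b' := by simp [h.counit_eq, h.theta_mul]
  counit_one := by simp [h.counit_eq, h.theta_one]
  antipode_left := h.antipode_left
  antipode_right := h.antipode_right

theorem isHopfAlgebraInYD : IsHopfAlgebraInYD (hopfData k H) E R where
  isYetterDrinfeld := h.isYetterDrinfeld
  mul_hom :=
    { map_act x t := by
        induction t with
        | zero => simp
        | add s t hs ht => simp only [TensorProduct.tmul_add, map_add, hs, ht]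
        | tmul b b' => exact h.mul_act x b b'
      map_coact t := by
        induction t with
        | zero => simp
        | add s t hs ht => simp only [map_add, hs, ht]
        | tmul b b' => exact h.coact_mul b b' }
  one_hom :=
    { map_act x t := by
        simp [YDData.unit, hopfData, h.one_eq_rho, h.act_rho, h.rho_incl, smul_smul, mul_comm]
      map_coact t := by simp [YDData.unit, hopfData, h.coact_one] }
  comul_hom := ⟨h.comul_act, h.coact_comul⟩
  counit_hom :=
    { map_act x b := by
        obtain ⟨a, rfl⟩ := h.surjective_rho b
        simp [YDData.unit, hopfData, h.act_rho, h.counit_rho]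
      map_coact := h.counit_coact_unit }
  antipode_hom := ⟨h.antipode_act, h.coact_antipode⟩
  hopfAxioms := h.hopfAxioms

end IsCoinvariantModel
end CoinvariantModel

section Transport

variable {k A B : Type*} [Field k] [AddCommGroup A] [Module k A] [AddCommGroup B] [Module k B]
  {D : HopfData k A} {E : HopfData k B} {f : B →ₗ[k] A}

theorem map_map_middle_comm {m : B ⊗[k] B →ₗ[k] B} {m' : A ⊗[k] A →ₗ[k] A}
    (hm : f ∘ₗ m = m' ∘ₗ TensorProduct.map f f) (s t : B ⊗[k] B) :
    TensorProduct.map f f (TensorProduct.map m m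
      (middle (TensorProduct.comm k B B).toLinearMap (s ⊗ₜ t))) =
    TensorProduct.map m' m' (middle (TensorProduct.comm k A A).toLinearMap
      (TensorProduct.map f f s ⊗ₜ TensorProduct.map f f t)) := by
  have hm' (x y) : f (m (x ⊗ₜ y)) = m' (f x ⊗ₜ f y) := LinearMap.congr_fun hm (x ⊗ₜ y)
  induction s with
  | zero => simp
  | add x y hx hy => simp only [map_add, TensorProduct.add_tmul, hx, hy]
  | tmul x y =>
    induction t with
    | zero => simp
    | add x y hx hy => simp only [map_add, TensorProduct.tmul_add, hx, hy]
    | tmul z w => simp [middle, hm']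

namespace IsBialgebraHom

variable (hf : IsBialgebraHom E D f)
include hf

theorem comp_mul : f ∘ₗ E.mul = D.mul ∘ₗ TensorProduct.map f f :=
  TensorProduct.ext' hf.map_mul

theorem map_comp_comul : TensorProduct.map f f ∘ₗ E.comul = D.comul ∘ₗ f :=
  (LinearMap.ext hf.map_comul).symm

theorem counit_comp : D.counit ∘ₗ f = E.counit :=
  LinearMap.ext hf.map_counit

end IsBialgebraHom

namespace IsHopfAlgebraHom

variable (hf : IsHopfAlgebraHom E D f)
include hf

theorem comp_antipode : f ∘ₗ E.antipode = D.antipode ∘ₗ f :=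
  LinearMap.ext hf.map_antipode

theorem coassoc_of_injective (hfi : Function.Injective f) (hD : D.IsHopfAlgebra) (x : B) :
    TensorProduct.assoc k B B B (E.comul.rTensor B (E.comul x)) =
      E.comul.lTensor B (E.comul x) := by
  have injective_map_map : Function.Injective (TensorProduct.map f (TensorProduct.map f f)) :=
    TensorProduct.map_injective_of_flat_flat _ _ hfi
      (TensorProduct.map_injective_of_flat_flat _ _ hfi hfi)
  refine injective_map_map ?_
  calc TensorProduct.map f (TensorProduct.map f f)
        (TensorProduct.assoc k B B B (E.comul.rTensor B (E.comul x)))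
    _ = TensorProduct.assoc k A A A (D.comul.rTensor A (D.comul (f x))) := by
      rw [TensorProduct.map_map_assoc, hf.map_comul, ← LinearMap.comp_apply (LinearMap.rTensor A _),
        LinearMap.rTensor_comp_map, ← hf.map_comp_comul, ← LinearMap.map_comp_rTensor,
        LinearMap.comp_apply]
    _ = D.comul.lTensor A (D.comul (f x)) := hD.coassoc (f x)
    _ = TensorProduct.map f (TensorProduct.map f f) (E.comul.lTensor B (E.comul x)) := by
      rw [hf.map_comul, ← LinearMap.comp_apply (LinearMap.lTensor A _),
        LinearMap.lTensor_comp_map, ← hf.map_comp_comul, ← LinearMap.map_comp_lTensor,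
        LinearMap.comp_apply]

theorem counit_left_of_injective (hfi : Function.Injective f) (hD : D.IsHopfAlgebra) (x : B) :
    E.counit.rTensor B (E.comul x) = 1 ⊗ₜ x := by
  refine Module.Flat.lTensor_preserves_injective_linearMap (M := k) f hfi ?_
  have h := hD.counit_left (f x)
  rwa [hf.map_comul, ← LinearMap.comp_apply, LinearMap.rTensor_comp_map, hf.counit_comp,
    ← LinearMap.lTensor_comp_rTensor] at h

theorem counit_right_of_injective (hfi : Function.Injective f) (hD : D.IsHopfAlgebra) (x : B) :
    E.counit.lTensor B (E.comul x) = x ⊗ₜ 1 := by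
  refine Module.Flat.rTensor_preserves_injective_linearMap (M := k) f hfi ?_
  have h := hD.counit_right (f x)
  rwa [hf.map_comul, ← LinearMap.comp_apply, LinearMap.lTensor_comp_map, hf.counit_comp,
    ← LinearMap.rTensor_comp_lTensor] at h

theorem antipode_left_of_injective (hfi : Function.Injective f) (hD : D.IsHopfAlgebra) (x : B) :
    E.mul (E.antipode.rTensor B (E.comul x)) = E.counit x • E.one := by
  refine hfi ?_
  have h := hD.antipode_left (f x)
  rwa [hf.map_comul, ← LinearMap.comp_apply (D.antipode.rTensor A), LinearMap.rTensor_comp_map,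
    ← hf.comp_antipode, ← LinearMap.map_comp_rTensor, LinearMap.comp_apply,
    ← LinearMap.comp_apply D.mul, ← hf.comp_mul, hf.map_counit, ← hf.map_one, ← map_smul] at h

theorem antipode_right_of_injective (hfi : Function.Injective f) (hD : D.IsHopfAlgebra) (x : B) :
    E.mul (E.antipode.lTensor B (E.comul x)) = E.counit x • E.one := by
  refine hfi ?_
  have h := hD.antipode_right (f x)
  rwa [hf.map_comul, ← LinearMap.comp_apply (D.antipode.lTensor A), LinearMap.lTensor_comp_map,
    ← hf.comp_antipode, ← LinearMap.map_comp_lTensor, LinearMap.comp_apply,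
    ← LinearMap.comp_apply D.mul, ← hf.comp_mul, hf.map_counit, ← hf.map_one, ← map_smul] at h

theorem isHopfAlgebra_of_injective (hfi : Function.Injective f) (hD : D.IsHopfAlgebra) :
    E.IsHopfAlgebra where
  mul_assoc x y z := hfi <| by simp only [hf.map_mul, hD.mul_assoc]
  one_mul x := hfi <| by simp only [hf.map_mul, hf.map_one, hD.one_mul]
  mul_one x := hfi <| by simp only [hf.map_mul, hf.map_one, hD.mul_one]
  coassoc := hf.coassoc_of_injective hfi hD
  counit_left := hf.counit_left_of_injective hfi hD
  counit_right := hf.counit_right_of_injective hfi hD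
  comul_mul x y := TensorProduct.map_injective_of_flat_flat f f hfi hfi <| by
    rw [map_map_middle_comm hf.comp_mul, ← hf.map_comul, ← hf.map_comul, ← hf.map_comul,
      hf.map_mul, hD.comul_mul]
  comul_one := TensorProduct.map_injective_of_flat_flat f f hfi hfi <| by
    rw [← hf.map_comul, hf.map_one, hD.comul_one, TensorProduct.map_tmul, hf.map_one]
  counit_mul x y := by simp only [← hf.map_counit, hf.map_mul, hD.counit_mul]
  counit_one := by rw [← hf.map_counit, hf.map_one, hD.counit_one]
  antipode_left := hf.antipode_left_of_injective hfi hD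
  antipode_right := hf.antipode_right_of_injective hfi hD

end IsHopfAlgebraHom

end Transport

section Instance

theorem map_mul_middle_comm {k A : Type*} [CommSemiring k] [Semiring A] [Algebra k A]
    (s t : A ⊗[k] A) :
    TensorProduct.map (LinearMap.mul' k A) (LinearMap.mul' k A)
      (middle (TensorProduct.comm k A A).toLinearMap (s ⊗ₜ t)) = s * t := by
  induction s with
  | zero => simp
  | add x y hx hy => simp only [map_add, TensorProduct.add_tmul, add_mul, hx, hy]
  | tmul x y =>
    induction t with
    | zero => simp
    | add x y hx hy => simp only [map_add, TensorProduct.tmul_add, mul_add, hx, hy]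
    | tmul z w => simp [middle]

theorem isHopfAlgebra_hopfData (k A : Type*) [Field k] [Ring A] [HopfAlgebra k A] :
    (hopfData k A).IsHopfAlgebra where
  mul_assoc x y z := by simp [hopfData, mul_assoc]
  one_mul x := by simp [hopfData]
  mul_one x := by simp [hopfData]
  coassoc x := by simp [hopfData]
  counit_left x := by simp [hopfData]
  counit_right x := by simp [hopfData]
  comul_mul x y := by simp [hopfData, map_mul_middle_comm]
  comul_one := by simp [hopfData, Algebra.TensorProduct.one_def]
  counit_mul x y := by simp [hopfData]
  counit_one := by simp [hopfData]
  antipode_left x := by simp [hopfData, Algebra.algebraMap_eq_smul_one]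
  antipode_right x := by simp [hopfData, Algebra.algebraMap_eq_smul_one]

end Instance

section Biproduct

open HopfAlgebra (antipode)

variable {k A H B : Type*} [Field k] [Ring A] [HopfAlgebra k A] [Ring H] [HopfAlgebra k H]
  [AddCommGroup B] [Module k B] {i : H →ₐc[k] A} {π : A →ₐc[k] H} {θ : B →ₗ[k] A} {ρ : A →ₗ[k] B}
  {E : YDData k H B} {R : HopfData k B}

/-- The map `b × x ↦ θ(b) i(x)` from the Radford biproduct to the given Hopf algebra. -/
def biproductMap (θ : B →ₗ[k] A) (i : H →ₐc[k] A) : B ⊗[k] H →ₗ[k] A :=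
  LinearMap.mul' k A ∘ₗ TensorProduct.map θ (i : H →ₗ[k] A)

theorem biproductMap_tmul (θ : B →ₗ[k] A) (i : H →ₐc[k] A) (b : B) (x : H) :
    biproductMap θ i (b ⊗ₜ x) = θ b * i x := rfl

namespace IsCoinvariantModel

variable (h : IsCoinvariantModel i π θ ρ E R)
include h

theorem biproductMap_biproductMul_tmul (b b' : B) (x x' : H) :
    biproductMap θ i (biproductMul (hopfData k H) E R ((b ⊗ₜ x) ⊗ₜ (b' ⊗ₜ x'))) =
      θ b * i x * (θ b' * i x') := by
  suffices biproductMap θ i ∘ₗ biproductMul (hopfData k H) E R ∘ₗ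
        (TensorProduct.mk k _ _).flip (b' ⊗ₜ x') ∘ₗ TensorProduct.mk k B H b =
      LinearMap.mulLeft k (θ b) ∘ₗ LinearMap.mulRight k (θ b' * i x') ∘ₗ (i : H →ₗ[k] A) by
    simpa [mul_assoc] using LinearMap.congr_fun this x
  refine ext_comatrix fun n d hd r s => ?_
  suffices ∑ u, θ b * θ (E.act (d r u ⊗ₜ b')) * (i (d u s) * i x') =
      θ b * (i (d r s) * θ b' * i x') by
    simpa [biproductMul, middle, smashSwap, hopfData, hd.comul_apply, TensorProduct.sum_tmul,
      TensorProduct.tmul_sum, biproductMap_tmul, h.theta_mul]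
  simp only [h.theta_act, ← hd.sum_adjointAction_mul_incl, Finset.sum_mul, Finset.mul_sum,
    mul_assoc]

theorem biproductMap_biproductMul (s t : B ⊗[k] H) :
    biproductMap θ i (biproductMul (hopfData k H) E R (s ⊗ₜ t)) =
      biproductMap θ i s * biproductMap θ i t := by
  induction s with
  | zero => simp
  | add x y hx hy => simp only [map_add, TensorProduct.add_tmul, add_mul, hx, hy]
  | tmul b x =>
    induction t with
    | zero => simp
    | add x y hx hy => simp only [map_add, TensorProduct.tmul_add, mul_add, hx, hy]
    | tmul b' x' => exact h.biproductMap_biproductMul_tmul b b' x x'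

theorem cosmashSwap_rho {n : ℕ} {c : Matrix (Fin n) (Fin n) A} (hc : IsComatrix k c)
    (p q : Fin n) (x : H) : cosmashSwap (hopfData k H) E (ρ (c p q) ⊗ₜ x) =
      ∑ l, ∑ r, (π (c p l) * antipode k (π (c r q)) * x) ⊗ₜ ρ (c l r) := by
  simp [cosmashSwap, hopfData, h.coact_rho hc, TensorProduct.sum_tmul]

theorem comul_biproduct_tmul {m n : ℕ} {c : Matrix (Fin n) (Fin n) A} {d : Matrix (Fin m) (Fin m) H}
    (hc : IsComatrix k c) (hd : IsComatrix k d) (p q : Fin n) (r s : Fin m) :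
    (biproduct (hopfData k H) E R).comul (ρ (c p q) ⊗ₜ d r s) =
      ∑ u, ∑ l, ∑ v, ∑ j, (ρ (c p j) ⊗ₜ (π (c j l) * antipode k (π (c v q)) * d r u)) ⊗ₜ
        (ρ (c l v) ⊗ₜ d u s) := by
  have comul_eq : (hopfData k H).comul (d r s) = ∑ u, d r u ⊗ₜ d u s := hd.comul_apply r s
  simp only [biproduct, LinearMap.comp_apply, TensorProduct.map_tmul, h.comul_rho_apply hc,
    comul_eq, TensorProduct.sum_tmul, TensorProduct.tmul_sum, middle, LinearEquiv.coe_coe,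
    map_sum, TensorProduct.assoc_tmul, TensorProduct.assoc_symm_tmul, LinearMap.lTensor_tmul,
    LinearMap.rTensor_tmul, h.cosmashSwap_rho hc]
  exact Finset.sum_congr rfl fun u _ => Finset.sum_comm_cycle.symm

theorem comul_biproductMap (t : B ⊗[k] H) : Coalgebra.comul (R := k) (biproductMap θ i t) =
    TensorProduct.map (biproductMap θ i) (biproductMap θ i)
      ((biproduct (hopfData k H) E R).comul t) := by
  suffices Coalgebra.comul ∘ₗ biproductMap θ i =
      TensorProduct.map (biproductMap θ i) (biproductMap θ i) ∘ₗ
        (biproduct (hopfData k H) E R).comul from LinearMap.congr_fun this t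
  refine TensorProduct.ext <| h.ext_rho fun n c hc p q => ext_comatrix fun m d hd r s => ?_
  have comul_incl : Coalgebra.comul (R := k) (i (d r s)) = ∑ u, i (d r u) ⊗ₜ[k] i (d u s) :=
    (hd.map i).comul_apply r s
  have cancel (l) : ∑ j, coinvProj i π (c p j) * i (π (c j l)) = c p l :=
    Matrix.ext_iff.2 hc.map_coinvProj_mul p l
  change Coalgebra.comul (R := k) (biproductMap θ i (ρ (c p q) ⊗ₜ d r s)) =
    TensorProduct.map (biproductMap θ i) (biproductMap θ i)
      ((biproduct (hopfData k H) E R).comul (ρ (c p q) ⊗ₜ d r s))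
  simp only [h.comul_biproduct_tmul hc hd, map_sum, TensorProduct.map_tmul, biproductMap_tmul,
    h.theta_rho, map_mul, ← mul_assoc, ← TensorProduct.sum_tmul, ← Finset.sum_mul, cancel]
  simp [hc.comul_coinvProj, comul_incl, Finset.sum_mul, Finset.mul_sum]

theorem biproductMap_antipode (t : B ⊗[k] H) :
    biproductMap θ i ((biproduct (hopfData k H) E R).antipode t) =
      antipode k (biproductMap θ i t) := by
  suffices biproductMap θ i ∘ₗ (biproduct (hopfData k H) E R).antipode =
      antipode k ∘ₗ biproductMap θ i from LinearMap.congr_fun this t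
  refine TensorProduct.ext <| h.ext_rho (fun n c hc p q => LinearMap.ext fun x => ?_)
  change biproductMap θ i ((biproduct (hopfData k H) E R).antipode (ρ (c p q) ⊗ₜ x)) =
    antipode k (biproductMap θ i (ρ (c p q) ⊗ₜ x))
  have cancel (l) : ∑ j, i (antipode k (π (c p j))) * coinvAntipode i π (c j l) =
      antipode k (c p l) := Matrix.ext_iff.2 hc.map_antipode_mul_map_coinvAntipode p l
  have antipode_incl (y : H) : antipode k (i y) = i (antipode k y) := (map_antipode i y).symm
  have antipode_biproduct : (biproduct (hopfData k H) E R).antipode (ρ (c p q) ⊗ₜ x) =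
      ∑ r, ∑ l, biproductMul (hopfData k H) E R
        ((R.one ⊗ₜ antipode k (π (c p l) * antipode k (π (c r q)) * x)) ⊗ₜ
          (R.antipode (ρ (c l r)) ⊗ₜ 1)) := by
    simp only [biproduct, LinearMap.comp_apply, h.cosmashSwap_rho hc, map_sum,
      TensorProduct.map_tmul]
    rw [Finset.sum_comm]
    rfl
  simp [antipode_biproduct, h.biproductMap_biproductMul, biproductMap_tmul, h.theta_one,
    h.theta_antipode_rho, h.theta_rho, HopfAlgebra.antipode_mul_antidistrib, mul_assoc,
    ← Finset.mul_sum, cancel, hc.coinvProj_apply, antipode_incl]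

theorem isHopfAlgebraHom_biproductMap :
    IsHopfAlgebraHom (biproduct (hopfData k H) E R) (hopfData k A) (biproductMap θ i) where
  map_mul := h.biproductMap_biproductMul
  map_one := by simp [biproduct, hopfData, biproductMap_tmul, h.theta_one]
  map_comul := h.comul_biproductMap
  map_counit t := by
    induction t with
    | zero => simp
    | add x y hx hy => simp only [map_add, hx, hy]
    | tmul b x => simp [biproduct, hopfData, biproductMap_tmul, h.counit_eq]
  map_antipode := h.biproductMap_antipode

theorem biproductMap_comp_inverse :
    biproductMap θ i ∘ₗ TensorProduct.map ρ (π : A →ₗ[k] H) ∘ₗ Coalgebra.comul =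
      LinearMap.id := by
  refine ext_comatrix fun n c hc p q => ?_
  have cancel : ∑ s, coinvProj i π (c p s) * i (π (c s q)) = c p q :=
    Matrix.ext_iff.2 hc.map_coinvProj_mul p q
  simp [hc.comul_apply, biproductMap_tmul, h.theta_rho, cancel]

theorem inverse_comp_biproductMap :
    (TensorProduct.map ρ (π : A →ₗ[k] H) ∘ₗ Coalgebra.comul) ∘ₗ biproductMap θ i =
      LinearMap.id := by
  refine TensorProduct.ext <| h.ext_rho fun n c hc p q => ext_comatrix fun m d hd r s => ?_
  have comul_incl : Coalgebra.comul (R := k) (i (d r s)) = ∑ u, i (d r u) ⊗ₜ[k] i (d u s) :=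
    (hd.map i).comul_apply r s
  change TensorProduct.map ρ (π : A →ₗ[k] H) (Coalgebra.comul (R := k)
    (biproductMap θ i (ρ (c p q) ⊗ₜ d r s))) = ρ (c p q) ⊗ₜ d r s
  have proj_coinvProj (p q) : π (coinvProj i π (c p q)) = (1 : Matrix _ _ H) p q :=
    Matrix.ext_iff.2 (map_proj_coinvProj h.proj_incl hc) p q
  simp [biproductMap_tmul, h.theta_rho, hc.comul_coinvProj, comul_incl, h.rho_mul_incl,
    h.proj_incl, proj_coinvProj, Finset.sum_mul, Finset.mul_sum, hc.counit_apply, hd.counit_apply,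
    Matrix.one_apply, ite_smul, TensorProduct.ite_tmul, ite_mul, TensorProduct.tmul_ite]

theorem bijective_biproductMap : Function.Bijective (biproductMap θ i) :=
  Function.bijective_iff_has_inverse.2
    ⟨TensorProduct.map ρ (π : A →ₗ[k] H) ∘ₗ Coalgebra.comul,
      LinearMap.congr_fun h.inverse_comp_biproductMap,
      LinearMap.congr_fun h.biproductMap_comp_inverse⟩

theorem isHopfAlgebra_biproduct : (biproduct (hopfData k H) E R).IsHopfAlgebra :=
  h.isHopfAlgebraHom_biproductMap.isHopfAlgebra_of_injective h.bijective_biproductMap.injective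
    (isHopfAlgebra_hopfData k A)

end IsCoinvariantModel

end Biproduct

/-! ### Structure maps given on a retract of a Hopf algebra -/

section Retract

variable {k A H B : Type*} [Field k] [AddCommGroup A] [Module k A] [AddCommGroup H] [Module k H]
  [AddCommGroup B] [Module k B]

/-- `θ` identifies `B` with the coinvariants of the projection `π`, the map `e` is a retraction of
`θ`, and `E` and `R` are what the structure maps of the coinvariants become on `B`. The retraction
`e` is arbitrary on the elements which are not coinvariant. -/
structure IsRetractModel (D : HopfData k A) (K : HopfData k H) (i : H →ₗ[k] A) (π : A →ₗ[k] H)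
    (θ : B →ₗ[k] A) (e : A →ₗ[k] B) (E : YDData k H B) (R : HopfData k B) : Prop where
  retract : ∀ b, e (θ b) = b
  range_theta : LinearMap.range θ = coinvariants D K π
  act_eq : ∀ x b, E.act (x ⊗ₜ b) = e (adjointAction D K i (x ⊗ₜ θ b))
  coact_eq : ∀ b, E.coact b = TensorProduct.map π e (D.comul (θ b))
  mul_eq : ∀ b b', R.mul (b ⊗ₜ b') = e (D.mul (θ b ⊗ₜ θ b'))
  one_eq : R.one = e D.one
  comul_eq : ∀ b, R.comul b =
    TensorProduct.map (e ∘ₗ coinvariantProj D K i π) e (D.comul (θ b))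
  counit_eq : ∀ b, R.counit b = D.counit (θ b)
  antipode_eq : ∀ b, R.antipode b =
    e (D.mul (TensorProduct.map (i ∘ₗ π) D.antipode (D.comul (θ b))))

/-- The conclusion of Radford's theorem: the structure which `E` and `R` put on `B` is the one that
the coinvariants of `π` carry, it is a braided Hopf algebra, and its biproduct with `K` is
isomorphic to `D` by means of `b × x ↦ θ(b) i(x)`. -/
structure IsRadfordDecomposition (D : HopfData k A) (K : HopfData k H) (i : H →ₗ[k] A)
    (π : A →ₗ[k] H) (θ : B →ₗ[k] A) (E : YDData k H B) (R : HopfData k B) : Prop where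
  range_proj : LinearMap.range (coinvariantProj D K i π) = coinvariants D K π
  theta_act : ∀ x b, θ (E.act (x ⊗ₜ b)) = adjointAction D K i (x ⊗ₜ θ b)
  theta_coact : ∀ b, θ.lTensor H (E.coact b) = π.rTensor A (D.comul (θ b))
  theta_mul : ∀ b b', θ (R.mul (b ⊗ₜ b')) = D.mul (θ b ⊗ₜ θ b')
  theta_one : θ R.one = D.one
  theta_comul : ∀ b a, θ b = coinvariantProj D K i π a → TensorProduct.map θ θ (R.comul b) =
    TensorProduct.map (coinvariantProj D K i π) (coinvariantProj D K i π) (D.comul a)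
  counit_eq : ∀ b, R.counit b = D.counit (θ b)
  theta_antipode : ∀ b, θ (R.antipode b) =
    D.mul (TensorProduct.map (i ∘ₗ π) D.antipode (D.comul (θ b)))
  isHopfAlgebraInYD : IsHopfAlgebraInYD K E R
  isHopfAlgebra_biproduct : (biproduct K E R).IsHopfAlgebra
  isHopfAlgebraHom : IsHopfAlgebraHom (biproduct K E R) D (D.mul ∘ₗ TensorProduct.map θ i)
  bijective : Function.Bijective (D.mul ∘ₗ TensorProduct.map θ i)

end Retract

section HopfAlgebra

variable {k A H B : Type*} [Field k] [Ring A] [HopfAlgebra k A] [Ring H] [HopfAlgebra k H]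
  [AddCommGroup B] [Module k B]

/-- A map of Hopf algebras which respects the structure maps of bialgebras, as a bundled map. -/
def IsBialgebraHom.toBialgHom {f : A →ₗ[k] H}
    (hf : IsBialgebraHom (hopfData k A) (hopfData k H) f) : A →ₐc[k] H :=
  BialgHom.ofAlgHom (AlgHom.ofLinearMap f hf.map_one hf.map_mul)
    (AlgHom.toLinearMap_injective (LinearMap.ext hf.map_counit))
    (AlgHom.toLinearMap_injective (LinearMap.ext fun x => (hf.map_comul x).symm))

namespace IsCoinvariantModel

variable {i : H →ₐc[k] A} {π : A →ₐc[k] H} {θ : B →ₗ[k] A} {ρ : A →ₗ[k] B} {E : YDData k H B}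
  {R : HopfData k B}

theorem isRadfordDecomposition (h : IsCoinvariantModel i π θ ρ E R) :
    IsRadfordDecomposition (hopfData k A) (hopfData k H) (i : H →ₗ[k] A) (π : A →ₗ[k] H) θ E R where
  range_proj := range_coinvProj h.proj_incl
  theta_act := h.theta_act
  theta_coact := h.theta_coact
  theta_mul := h.theta_mul
  theta_one := h.theta_one
  theta_comul b a hb := by
    have theta_comp_rho : θ ∘ₗ ρ = coinvProj i π := LinearMap.ext h.theta_rho
    obtain rfl : b = ρ a := h.injective_theta (hb.trans (h.theta_rho a).symm)
    rw [h.comul_rho, ← LinearMap.comp_apply (TensorProduct.map θ θ), ← TensorProduct.map_comp,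
      theta_comp_rho]
    rfl
  counit_eq := h.counit_eq
  theta_antipode := h.theta_antipode
  isHopfAlgebraInYD := h.isHopfAlgebraInYD
  isHopfAlgebra_biproduct := h.isHopfAlgebra_biproduct
  isHopfAlgebraHom := h.isHopfAlgebraHom_biproductMap
  bijective := h.bijective_biproductMap

end IsCoinvariantModel

namespace IsRetractModel

variable {i : H →ₐc[k] A} {π : A →ₐc[k] H} {θ : B →ₗ[k] A} {e : A →ₗ[k] B} {E : YDData k H B}
  {R : HopfData k B}
  (h : IsRetractModel (hopfData k A) (hopfData k H) (i : H →ₗ[k] A) (π : A →ₗ[k] H) θ e E R)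
include h

theorem theta_mem (b : B) :
    θ b ∈ coinvariants (hopfData k A) (hopfData k H) (π : A →ₗ[k] H) :=
  h.range_theta ▸ LinearMap.mem_range_self θ b

theorem coinvProj_theta (b : B) : coinvProj i π (θ b) = θ b :=
  coinvProj_of_mem (h.theta_mem b)

theorem theta_of_mem {a : A}
    (ha : a ∈ coinvariants (hopfData k A) (hopfData k H) (π : A →ₗ[k] H)) : θ (e a) = a := by
  rw [← h.range_theta] at ha
  obtain ⟨b, rfl⟩ := ha
  rw [h.retract]

theorem theta_one : θ R.one = 1 := by
  rw [h.one_eq]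
  exact h.theta_of_mem (by simp [coinvariants, hopfData, Algebra.TensorProduct.one_def])

variable (hπi : ∀ x, π (i x) = x)
include hπi

theorem theta_coinvProj (a : A) : θ (e (coinvProj i π a)) = coinvProj i π a :=
  h.theta_of_mem (coinvProj_mem hπi a)

theorem theta_act (x : H) (b : B) : θ (E.act (x ⊗ₜ b)) =
    adjointAction (hopfData k A) (hopfData k H) (i : H →ₗ[k] A) (x ⊗ₜ θ b) := by
  rw [h.act_eq, ← h.coinvProj_theta b, ← coinvProj_incl_mul hπi, h.theta_coinvProj hπi]

theorem theta_mul (b b' : B) : θ (R.mul (b ⊗ₜ b')) = θ b * θ b' := by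
  have theta_mul_mem : θ b * θ b' = coinvProj i π (θ b * θ b') := by
    rw [coinvProj_mul_of_mem (h.theta_mem b), h.coinvProj_theta]
  have mul_eq : R.mul (b ⊗ₜ b') = e (θ b * θ b') := h.mul_eq b b'
  rw [mul_eq, theta_mul_mem, h.theta_coinvProj hπi]

theorem theta_coact (b : B) : θ.lTensor H (E.coact b) =
    (π : A →ₗ[k] H).rTensor A (Coalgebra.comul (θ b)) := by
  suffices θ.lTensor H ∘ₗ TensorProduct.map (π : A →ₗ[k] H) e ∘ₗ Coalgebra.comul ∘ₗ
      coinvProj i π = (π : A →ₗ[k] H).rTensor A ∘ₗ Coalgebra.comul ∘ₗ coinvProj i π by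
    have coact_eq : E.coact b = TensorProduct.map (π : A →ₗ[k] H) e (Coalgebra.comul (θ b)) :=
      h.coact_eq b
    simpa [h.coinvProj_theta, coact_eq] using LinearMap.congr_fun this (θ b)
  refine ext_comatrix fun n c hc p q => ?_
  simp [hc.comul_coinvProj, h.theta_coinvProj hπi]

theorem comul_coinvProj (a : A) : R.comul (e (coinvProj i π a)) =
    TensorProduct.map (e ∘ₗ coinvProj i π) (e ∘ₗ coinvProj i π) (Coalgebra.comul a) := by
  suffices R.comul ∘ₗ e ∘ₗ coinvProj i π = TensorProduct.map (e ∘ₗ coinvProj i π)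
      (e ∘ₗ coinvProj i π) ∘ₗ Coalgebra.comul from LinearMap.congr_fun this a
  refine ext_comatrix fun n c hc p q => ?_
  have comul_eq (b : B) : R.comul b =
      TensorProduct.map (e ∘ₗ coinvProj i π) e (Coalgebra.comul (θ b)) := h.comul_eq b
  simp [comul_eq, h.theta_coinvProj hπi, hc.comul_coinvProj, coinvProj_mul_incl hπi,
    hc.comul_apply, hc.counit_apply, Matrix.one_apply, ite_smul, TensorProduct.ite_tmul,
    apply_ite e]

theorem isCoinvariantModel : IsCoinvariantModel i π θ (e ∘ₗ coinvProj i π) E R where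
  proj_incl := hπi
  theta_rho := h.theta_coinvProj hπi
  rho_theta b := by rw [LinearMap.comp_apply, h.coinvProj_theta, h.retract]
  theta_act := h.theta_act hπi
  theta_coact := h.theta_coact hπi
  theta_mul := h.theta_mul hπi
  theta_one := h.theta_one
  comul_rho := h.comul_coinvProj hπi
  counit_eq := h.counit_eq
  theta_antipode b := by
    rw [h.antipode_eq]
    exact h.theta_of_mem (coinvAntipode_mem hπi (θ b))

end IsRetractModel

theorem isRadfordDecomposition_of_hopfData {i : H →ₗ[k] A} {π : A →ₗ[k] H} {θ : B →ₗ[k] A}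
    {e : A →ₗ[k] B} {E : YDData k H B} {R : HopfData k B}
    (h : IsRetractModel (hopfData k A) (hopfData k H) i π θ e E R)
    (hi : IsBialgebraHom (hopfData k H) (hopfData k A) i)
    (hπ : IsBialgebraHom (hopfData k A) (hopfData k H) π) (hπi : π ∘ₗ i = LinearMap.id) :
    IsRadfordDecomposition (hopfData k A) (hopfData k H) i π θ E R :=
  (IsRetractModel.isCoinvariantModel (i := hi.toBialgHom) (π := hπ.toBialgHom) h
    (LinearMap.congr_fun hπi)).isRadfordDecomposition

theorem IsBialgebraHom.isHopfAlgebraHom_of_hopfData {f : A →ₗ[k] H}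
    (hf : IsBialgebraHom (hopfData k A) (hopfData k H) f) :
    IsHopfAlgebraHom (hopfData k A) (hopfData k H) f :=
  { hf with map_antipode := map_antipode hf.toBialgHom }

end HopfAlgebra

/-! ### The Hopf algebra given by structure maps -/

namespace HopfData.IsHopfAlgebra

variable {k A : Type*} [Field k] [AddCommGroup A] [Module k A] {D : HopfData k A}

/-- The ring structure of a Hopf algebra given by its structure maps. -/
abbrev ring (hD : D.IsHopfAlgebra) : Ring A where
  __ := (inferInstance : AddCommGroup A)
  mul x y := D.mul (x ⊗ₜ y)
  one := D.one
  mul_assoc := hD.mul_assoc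
  one_mul := hD.one_mul
  mul_one := hD.mul_one
  left_distrib x y z := (congrArg D.mul (TensorProduct.tmul_add x y z)).trans (map_add _ _ _)
  right_distrib x y z := (congrArg D.mul (TensorProduct.add_tmul x y z)).trans (map_add _ _ _)
  zero_mul x := (congrArg D.mul (TensorProduct.zero_tmul A x)).trans (map_zero _)
  mul_zero x := (congrArg D.mul (TensorProduct.tmul_zero A x)).trans (map_zero _)

/-- The algebra structure of a Hopf algebra given by its structure maps. -/
abbrev algebra (hD : D.IsHopfAlgebra) : letI := hD.ring; Algebra k A :=
  letI := hD.ring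
  Algebra.ofModule
    (fun r x y => (congrArg D.mul (TensorProduct.smul_tmul' r x y).symm).trans (map_smul _ _ _))
    (fun r x y => (congrArg D.mul (TensorProduct.tmul_smul r x y)).trans (map_smul _ _ _))

theorem mul'_eq (hD : D.IsHopfAlgebra) :
    letI := hD.ring; letI := hD.algebra; LinearMap.mul' k A = D.mul :=
  TensorProduct.ext' fun _ _ => rfl

theorem map_mul_middle_comm_eq (hD : D.IsHopfAlgebra) (s t : A ⊗[k] A) :
    letI := hD.ring; letI := hD.algebra
    TensorProduct.map D.mul D.mul (middle (TensorProduct.comm k A A).toLinearMap (s ⊗ₜ t)) =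
      s * t := by
  let := hD.ring
  let := hD.algebra
  rw [← hD.mul'_eq]
  exact map_mul_middle_comm s t

/-- The Hopf algebra with given structure maps. -/
abbrev hopfAlgebra (hD : D.IsHopfAlgebra) : letI := hD.ring; HopfAlgebra k A :=
  letI := hD.ring
  letI := hD.algebra
  letI : Coalgebra k A :=
    { comul := D.comul
      counit := D.counit
      coassoc := LinearMap.ext hD.coassoc
      rTensor_counit_comp_comul := LinearMap.ext hD.counit_left
      lTensor_counit_comp_comul := LinearMap.ext hD.counit_right }
  letI : Bialgebra k A := Bialgebra.mk' k A hD.counit_one (fun {x y} => hD.counit_mul x y)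
    hD.comul_one (fun {x y} => (hD.comul_mul x y).trans (hD.map_mul_middle_comm_eq _ _))
  { antipode := D.antipode
    mul_antipode_rTensor_comul := by
      rw [hD.mul'_eq]
      exact LinearMap.ext fun x =>
        (hD.antipode_left x).trans (Algebra.algebraMap_eq_smul_one _).symm
    mul_antipode_lTensor_comul := by
      rw [hD.mul'_eq]
      exact LinearMap.ext fun x =>
        (hD.antipode_right x).trans (Algebra.algebraMap_eq_smul_one _).symm }

theorem hopfData_eq (hD : D.IsHopfAlgebra) : @hopfData k A _ hD.ring hD.hopfAlgebra = D := by
  cases D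
  simp only [hopfData, HopfData.mk.injEq]
  exact ⟨hD.mul'_eq, rfl, rfl, rfl, rfl⟩

end HopfData.IsHopfAlgebra

section Transfer

variable {k A H B : Type*} [Field k] [AddCommGroup A] [Module k A] [AddCommGroup H] [Module k H]
  [AddCommGroup B] [Module k B] {D : HopfData k A} {K : HopfData k H}

theorem IsBialgebraHom.isHopfAlgebraHom {f : A →ₗ[k] H} (hf : IsBialgebraHom D K f)
    (hD : D.IsHopfAlgebra) (hK : K.IsHopfAlgebra) : IsHopfAlgebraHom D K f := by
  have h := @IsBialgebraHom.isHopfAlgebraHom_of_hopfData k A H _ hD.ring hD.hopfAlgebra hK.ring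
    hK.hopfAlgebra f
  rw [hD.hopfData_eq, hK.hopfData_eq] at h
  exact h hf

theorem IsRetractModel.isRadfordDecomposition {i : H →ₗ[k] A} {π : A →ₗ[k] H} {θ : B →ₗ[k] A}
    {e : A →ₗ[k] B} {E : YDData k H B} {R : HopfData k B} (h : IsRetractModel D K i π θ e E R)
    (hD : D.IsHopfAlgebra) (hK : K.IsHopfAlgebra) (hi : IsBialgebraHom K D i)
    (hπ : IsBialgebraHom D K π) (hπi : π ∘ₗ i = LinearMap.id) :
    IsRadfordDecomposition D K i π θ E R := by
  have radford := @isRadfordDecomposition_of_hopfData k A H B _ hD.ring hD.hopfAlgebra hK.ring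
    hK.hopfAlgebra _ _ i π θ e E R
  rw [hD.hopfData_eq, hK.hopfData_eq] at radford
  exact radford h hi hπ hπi

end Transfer

/-! ### The co-opposite Hopf algebra -/

section Cop

open HopfAlgebra (antipode)

variable {k A : Type*} [Field k] [Ring A] [HopfAlgebra k A]

section AntipodeInv

variable (hA : Function.Bijective (antipode k : A →ₗ[k] A))

@[simp]
theorem antipode_antipodeInv (x : A) : antipode k (antipodeInv hA x) = x :=
  (LinearEquiv.ofBijective (antipode k : A →ₗ[k] A) hA).apply_symm_apply x

@[simp]
theorem antipodeInv_antipode (x : A) : antipodeInv hA (antipode k x) = x :=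
  (LinearEquiv.ofBijective (antipode k : A →ₗ[k] A) hA).symm_apply_apply x

@[simp]
theorem antipodeInv_one : antipodeInv hA 1 = 1 :=
  hA.1 (by simp)

theorem antipodeInv_mul (x y : A) :
    antipodeInv hA (x * y) = antipodeInv hA y * antipodeInv hA x :=
  hA.1 (by simp [HopfAlgebra.antipode_mul_antidistrib])

theorem mul_antipodeInv_rTensor_comm_comul : LinearMap.mul' k A ∘ₗ (antipodeInv hA).rTensor A ∘ₗ
    (TensorProduct.comm k A A).toLinearMap ∘ₗ Coalgebra.comul =
      Algebra.linearMap k A ∘ₗ Coalgebra.counit := by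
  refine ext_comatrix fun n c hc i j => ?_
  have h := congr_arg (antipodeInv hA) (Matrix.ext_iff.2 hc.map_antipode_mul i j)
  simpa [hc.comul_apply, hc.counit_apply, Matrix.mul_apply, antipodeInv_mul, Matrix.one_apply,
    apply_ite] using h

theorem mul_antipodeInv_lTensor_comm_comul : LinearMap.mul' k A ∘ₗ (antipodeInv hA).lTensor A ∘ₗ
    (TensorProduct.comm k A A).toLinearMap ∘ₗ Coalgebra.comul =
      Algebra.linearMap k A ∘ₗ Coalgebra.counit := by
  refine ext_comatrix fun n c hc i j => ?_
  have h := congr_arg (antipodeInv hA) (Matrix.ext_iff.2 hc.mul_map_antipode i j)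
  simpa [hc.comul_apply, hc.counit_apply, Matrix.mul_apply, antipodeInv_mul, Matrix.one_apply,
    apply_ite] using h

end AntipodeInv

/-- The coalgebra structure on `C` with the opposite comultiplication. -/
abbrev copCoalgebra (k C : Type*) [Field k] [AddCommGroup C] [Module k C] [Coalgebra k C] :
    Coalgebra k C where
  comul := (TensorProduct.comm k C C).toLinearMap ∘ₗ Coalgebra.comul
  counit := Coalgebra.counit
  coassoc := by
    refine ext_comatrix fun n c hc i j => ?_
    simp only [LinearMap.comp_apply, LinearEquiv.coe_coe, hc.comul_apply, map_sum,
      TensorProduct.comm_tmul, LinearMap.rTensor_tmul, LinearMap.lTensor_tmul,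
      TensorProduct.sum_tmul, TensorProduct.tmul_sum, TensorProduct.assoc_tmul]
    exact Finset.sum_comm
  rTensor_counit_comp_comul := by
    refine ext_comatrix fun n c hc i j => ?_
    simp [hc.comul_apply, hc.counit_apply, Matrix.one_apply, TensorProduct.ite_tmul]
  lTensor_counit_comp_comul := by
    refine ext_comatrix fun n c hc i j => ?_
    simp [hc.comul_apply, hc.counit_apply, Matrix.one_apply, TensorProduct.tmul_ite]

/-- The Hopf algebra structure on `A` with the opposite comultiplication, for `A` with bijective
antipode; its antipode is the inverse of that of `A`. -/
abbrev copHopfAlgebra (hA : Function.Bijective (antipode k : A →ₗ[k] A)) : HopfAlgebra k A where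
  __ := @Bialgebra.mk' k A _ _ _ (copCoalgebra k A)
    (Bialgebra.counit_one (R := k) (A := A)) (Bialgebra.counit_mul (R := k) (A := A) _ _)
    (map_one ((Algebra.TensorProduct.comm k A A).toAlgHom.comp (Bialgebra.comulAlgHom k A)))
    (map_mul ((Algebra.TensorProduct.comm k A A).toAlgHom.comp (Bialgebra.comulAlgHom k A)) _ _)
  antipode := antipodeInv hA
  mul_antipode_rTensor_comul := mul_antipodeInv_rTensor_comm_comul hA
  mul_antipode_lTensor_comul := mul_antipodeInv_lTensor_comm_comul hA

/-- The algebra underlying `A`, regarded as a Hopf algebra with the opposite comultiplication. -/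
def Cop (_ : Function.Bijective (antipode k : A →ₗ[k] A)) : Type _ := A

namespace Cop

variable {hA : Function.Bijective (antipode k : A →ₗ[k] A)}

instance : Ring (Cop hA) := inferInstanceAs (Ring A)

instance : HopfAlgebra k (Cop hA) := (copHopfAlgebra hA : HopfAlgebra k A)

end Cop

theorem isHopfAlgebra_copData (hA : Function.Bijective (antipode k : A →ₗ[k] A)) :
    (copData hA).IsHopfAlgebra :=
  isHopfAlgebra_hopfData k (Cop hA)

theorem IsComatrix.transpose_cop {hA : Function.Bijective (antipode k : A →ₗ[k] A)}
    {ι : Type*} [Fintype ι] [DecidableEq ι]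
    {c : Matrix ι ι A} (hc : IsComatrix k c) : IsComatrix k (C := Cop hA) c.transpose where
  comul_apply i j := by
    change TensorProduct.comm k A A (Coalgebra.comul (c j i)) = _
    rw [hc.comul_apply, map_sum]
    rfl
  counit_apply i j := by
    change Coalgebra.counit (R := k) (A := A) (c j i) = _
    simp [hc.counit_apply, Matrix.one_apply, eq_comm]

theorem IsComatrix.transpose_of_cop {hA : Function.Bijective (antipode k : A →ₗ[k] A)}
    {ι : Type*} [Fintype ι] [DecidableEq ι]
    {c : Matrix ι ι (Cop hA)} (hc : IsComatrix k c) : IsComatrix k (C := A) c.transpose where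
  comul_apply i j := by
    refine (TensorProduct.comm k A A).injective ((hc.comul_apply j i).trans ?_)
    rw [map_sum]
    rfl
  counit_apply i j := by
    refine (hc.counit_apply j i).trans ?_
    simp [Matrix.one_apply, eq_comm]

end Cop

/-! ### Twisted tensor products -/

section TwistedTensorProduct

open HopfAlgebra (antipode)

section Algebra

variable {k H K : Type*} [CommSemiring k] [Semiring H] [Algebra k H] [Semiring K] [Algebra k K]

/-- The multiplication `(m ⊗ x)(n ⊗ y) = m τ(x ⊗ n) y` on `H ⊗ K`. -/
def twistedMul (τ : K ⊗[k] H →ₗ[k] H ⊗[k] K) :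
    (H ⊗[k] K) ⊗[k] (H ⊗[k] K) →ₗ[k] H ⊗[k] K :=
  TensorProduct.map (LinearMap.mul' k H) (LinearMap.mul' k K) ∘ₗ middle τ

/-- The conditions on `τ : K ⊗ H → H ⊗ K` under which `twistedMul τ` is associative with unit
`1 ⊗ 1`. -/
structure IsExchange (τ : K ⊗[k] H →ₗ[k] H ⊗[k] K) : Prop where
  one_tmul : ∀ n, τ (1 ⊗ₜ n) = n ⊗ₜ 1
  tmul_one : ∀ x, τ (x ⊗ₜ 1) = 1 ⊗ₜ x
  mul_tmul : ∀ x y n, τ ((x * y) ⊗ₜ n) = twistedMul τ ((1 ⊗ₜ x) ⊗ₜ τ (y ⊗ₜ n))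
  tmul_mul : ∀ x m n, τ (x ⊗ₜ (m * n)) = twistedMul τ (τ (x ⊗ₜ m) ⊗ₜ (n ⊗ₜ 1))

variable {τ : K ⊗[k] H →ₗ[k] H ⊗[k] K}

theorem twistedMul_tmul (m n : H) (x y : K) :
    twistedMul τ ((m ⊗ₜ x) ⊗ₜ (n ⊗ₜ y)) = (m ⊗ₜ 1) * τ (x ⊗ₜ n) * (1 ⊗ₜ y) := by
  simp only [twistedMul, middle, LinearMap.comp_apply, LinearEquiv.coe_coe,
    TensorProduct.assoc_tmul, LinearMap.lTensor_tmul, TensorProduct.assoc_symm_tmul,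
    LinearMap.rTensor_tmul]
  induction τ (x ⊗ₜ n) with
  | zero => simp
  | add s t hs ht => simp only [map_add, TensorProduct.add_tmul, TensorProduct.tmul_add, mul_add,
      add_mul, hs, ht]
  | tmul l z => simp

theorem twistedMul_mul_right (s t : H ⊗[k] K) (y : K) :
    twistedMul τ (s ⊗ₜ (t * (1 ⊗ₜ y))) = twistedMul τ (s ⊗ₜ t) * (1 ⊗ₜ y) := by
  induction s with
  | zero => simp
  | add s s' hs hs' => simp only [map_add, TensorProduct.add_tmul, add_mul, hs, hs']
  | tmul m x =>
    induction t with
    | zero => simp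
    | add t t' ht ht' => simp only [map_add, TensorProduct.tmul_add, add_mul, ht, ht']
    | tmul n z => simp [twistedMul_tmul, mul_assoc]

theorem twistedMul_mul_left (m : H) (s t : H ⊗[k] K) :
    twistedMul τ (((m ⊗ₜ 1) * s) ⊗ₜ t) = (m ⊗ₜ 1) * twistedMul τ (s ⊗ₜ t) := by
  induction s with
  | zero => simp
  | add s s' hs hs' => simp only [map_add, TensorProduct.add_tmul, mul_add, hs, hs']
  | tmul l x =>
    induction t with
    | zero => simp
    | add t t' ht ht' => simp only [map_add, TensorProduct.tmul_add, mul_add, ht, ht']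
    | tmul n z => simp [twistedMul_tmul, ← mul_assoc]

namespace IsExchange

variable (hτ : IsExchange τ)
include hτ

theorem twistedMul_one_tmul (s : H ⊗[k] K) (y : K) :
    twistedMul τ (s ⊗ₜ (1 ⊗ₜ y)) = s * (1 ⊗ₜ y) := by
  induction s with
  | zero => simp
  | add s t hs ht => simp only [map_add, TensorProduct.add_tmul, add_mul, hs, ht]
  | tmul m x => simp [twistedMul_tmul, hτ.tmul_one]

theorem twistedMul_tmul_one (m : H) (t : H ⊗[k] K) :
    twistedMul τ ((m ⊗ₜ 1) ⊗ₜ t) = (m ⊗ₜ 1) * t := by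
  induction t with
  | zero => simp
  | add s t hs ht => simp only [map_add, TensorProduct.tmul_add, mul_add, hs, ht]
  | tmul n y => simp [twistedMul_tmul, hτ.one_tmul]

theorem twistedMul_mul_one_tmul (t : H ⊗[k] K) (y : K) (n : H) :
    twistedMul τ ((t * (1 ⊗ₜ y)) ⊗ₜ (n ⊗ₜ 1)) = twistedMul τ (t ⊗ₜ τ (y ⊗ₜ n)) := by
  induction t with
  | zero => simp
  | add s t hs ht => simp only [map_add, TensorProduct.add_tmul, add_mul, hs, ht]
  | tmul m x =>
    have h := twistedMul_mul_left (τ := τ) m (1 ⊗ₜ x) (τ (y ⊗ₜ n))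
    rw [← hτ.mul_tmul, Algebra.TensorProduct.tmul_mul_tmul, mul_one, one_mul] at h
    rw [h, Algebra.TensorProduct.tmul_mul_tmul, mul_one, twistedMul_tmul,
      ← Algebra.TensorProduct.one_def, mul_one]

theorem twistedMul_tmul_one_mul (x : K) (n : H) (s : H ⊗[k] K) :
    twistedMul τ ((1 ⊗ₜ x) ⊗ₜ ((n ⊗ₜ 1) * s)) = twistedMul τ (τ (x ⊗ₜ n) ⊗ₜ s) := by
  induction s with
  | zero => simp
  | add s t hs ht => simp only [map_add, TensorProduct.tmul_add, mul_add, hs, ht]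
  | tmul l z =>
    have h := twistedMul_mul_right (τ := τ) (τ (x ⊗ₜ n)) (l ⊗ₜ 1) z
    rw [← hτ.tmul_mul, Algebra.TensorProduct.tmul_mul_tmul, mul_one, one_mul] at h
    rw [h, Algebra.TensorProduct.tmul_mul_tmul, one_mul, twistedMul_tmul,
      ← Algebra.TensorProduct.one_def, one_mul]

theorem twistedMul_assoc (r s t : H ⊗[k] K) :
    twistedMul τ (twistedMul τ (r ⊗ₜ s) ⊗ₜ t) = twistedMul τ (r ⊗ₜ twistedMul τ (s ⊗ₜ t)) := by
  induction r with
  | zero => simp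
  | add r r' hr hr' => simp only [map_add, TensorProduct.add_tmul, hr, hr']
  | tmul m x =>
  induction s with
  | zero => simp
  | add s s' hs hs' => simp only [map_add, TensorProduct.add_tmul, TensorProduct.tmul_add, hs, hs']
  | tmul n y =>
  induction t with
  | zero => simp
  | add t t' ht ht' => simp only [map_add, TensorProduct.tmul_add, ht, ht']
  | tmul l z =>
  have split_left : m ⊗ₜ[k] x = (m ⊗ₜ 1) * (1 ⊗ₜ x) := by simp
  have split_right : l ⊗ₜ[k] z = (l ⊗ₜ 1) * (1 ⊗ₜ z) := by simp
  calc twistedMul τ (twistedMul τ ((m ⊗ₜ x) ⊗ₜ (n ⊗ₜ y)) ⊗ₜ (l ⊗ₜ z))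
    _ = (m ⊗ₜ 1) * (twistedMul τ ((τ (x ⊗ₜ n) * (1 ⊗ₜ y)) ⊗ₜ (l ⊗ₜ 1)) * (1 ⊗ₜ z)) := by
      rw [twistedMul_tmul, mul_assoc, twistedMul_mul_left, split_right, twistedMul_mul_right]
    _ = (m ⊗ₜ 1) * (twistedMul τ ((1 ⊗ₜ x) ⊗ₜ ((n ⊗ₜ 1) * τ (y ⊗ₜ l))) * (1 ⊗ₜ z)) := by
      rw [hτ.twistedMul_mul_one_tmul, hτ.twistedMul_tmul_one_mul]
    _ = twistedMul τ ((m ⊗ₜ x) ⊗ₜ twistedMul τ ((n ⊗ₜ y) ⊗ₜ (l ⊗ₜ z))) := by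
      rw [twistedMul_tmul n, twistedMul_mul_right, split_left, twistedMul_mul_left, mul_assoc]

end IsExchange
end Algebra

theorem middle_comm {k X Y Z W : Type*} [CommSemiring k] [AddCommMonoid X] [Module k X]
    [AddCommMonoid Y] [Module k Y] [AddCommMonoid Z] [Module k Z] [AddCommMonoid W] [Module k W] :
    middle (P := X) (Q := W) (TensorProduct.comm k Y Z).toLinearMap =
      (TensorProduct.tensorTensorTensorComm k X Y Z W).toLinearMap := by
  ext
  simp [middle]

section Hopf

variable {k H K : Type*} [Field k] [Ring H] [HopfAlgebra k H] [Ring K] [HopfAlgebra k K]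

/-- `twistedMul τ` as a morphism of coalgebras. -/
def twistedMulCoalgHom (τ : K ⊗[k] H →ₗc[k] H ⊗[k] K) :
    (H ⊗[k] K) ⊗[k] (H ⊗[k] K) →ₗc[k] H ⊗[k] K :=
  (Coalgebra.TensorProduct.map (Bialgebra.mulCoalgHom k H) (Bialgebra.mulCoalgHom k K)).comp <|
    (Coalgebra.TensorProduct.assoc k k H H (K ⊗[k] K)).symm.toCoalgHom.comp <|
    (Coalgebra.TensorProduct.map (CoalgHom.id k H)
      ((Coalgebra.TensorProduct.assoc k k H K K).toCoalgHom.comp <|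
        (Coalgebra.TensorProduct.map τ (CoalgHom.id k K)).comp
          (Coalgebra.TensorProduct.assoc k k K H K).symm.toCoalgHom)).comp
      (Coalgebra.TensorProduct.assoc k k H K (H ⊗[k] K)).toCoalgHom

/-- The structure maps of the Hopf algebra `H ⊗ K` with multiplication `twistedMul τ`, the tensor
product coalgebra structure and antipode `m ⊗ x ↦ τ(S(x) ⊗ S(m))`. -/
def twistedHopfData (τ : K ⊗[k] H →ₗ[k] H ⊗[k] K) : HopfData k (H ⊗[k] K) where
  mul := twistedMul τ
  one := 1
  comul := Coalgebra.comul
  counit := Coalgebra.counit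
  antipode := τ ∘ₗ TensorProduct.map (antipode k) (antipode k) ∘ₗ
    (TensorProduct.comm k H K).toLinearMap

namespace IsExchange

section Linear

variable {τ : K ⊗[k] H →ₗ[k] H ⊗[k] K} (hτ : IsExchange τ)
include hτ

theorem mul_antipode_rTensor_comul_tmul (m : H) (x : K) :
    twistedMul τ ((twistedHopfData τ).antipode.rTensor _ (Coalgebra.comul (R := k) (m ⊗ₜ x))) =
      Coalgebra.counit (R := k) (m ⊗ₜ[k] x) • 1 := by
  have contract_left (x y : K) (s : H ⊗[k] H) : twistedMul τ ((twistedHopfData τ).antipode.rTensor _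
      (TensorProduct.tensorTensorTensorComm k H H K K (s ⊗ₜ (x ⊗ₜ y)))) =
      τ (antipode k x ⊗ₜ LinearMap.mul' k H ((antipode k).rTensor H s)) * (1 ⊗ₜ y) := by
    induction s with
    | zero => simp
    | add s t hs ht => simp only [map_add, TensorProduct.add_tmul, TensorProduct.tmul_add, add_mul,
        hs, ht]
    | tmul m n =>
      have h := twistedMul_mul_right (τ := τ) (τ (antipode k x ⊗ₜ antipode k m)) (n ⊗ₜ 1) y
      simpa [twistedHopfData, hτ.tmul_mul] using h
  have contract_right (t : K ⊗[k] K) : twistedMul τ ((twistedHopfData τ).antipode.rTensor _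
      (TensorProduct.tensorTensorTensorComm k H H K K (Coalgebra.comul m ⊗ₜ t))) =
      Coalgebra.counit (R := k) m • 1 ⊗ₜ LinearMap.mul' k K ((antipode k).rTensor K t) := by
    induction t with
    | zero => simp
    | add s t hs ht => simp only [map_add, TensorProduct.tmul_add, smul_add, hs, ht]
    | tmul x y =>
      simp [contract_left, Algebra.algebraMap_eq_smul_one, hτ.tmul_one]
  rw [TensorProduct.comul_tmul, TensorProduct.counit_tmul]
  refine (contract_right _).trans ?_
  simp [Algebra.algebraMap_eq_smul_one, smul_smul, mul_comm, Algebra.TensorProduct.one_def]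

theorem mul_antipode_lTensor_comul_tmul (m : H) (x : K) :
    twistedMul τ ((twistedHopfData τ).antipode.lTensor _ (Coalgebra.comul (R := k) (m ⊗ₜ x))) =
      Coalgebra.counit (R := k) (m ⊗ₜ[k] x) • 1 := by
  have contract_right (m n : H) (t : K ⊗[k] K) : twistedMul τ
      ((twistedHopfData τ).antipode.lTensor _
        (TensorProduct.tensorTensorTensorComm k H H K K ((m ⊗ₜ n) ⊗ₜ t))) =
      (m ⊗ₜ 1) * τ (LinearMap.mul' k K ((antipode k).lTensor K t) ⊗ₜ antipode k n) := by
    induction t with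
    | zero => simp
    | add s t hs ht => simp only [map_add, TensorProduct.add_tmul, TensorProduct.tmul_add, mul_add,
        hs, ht]
    | tmul x y =>
      have h := twistedMul_mul_left (τ := τ) m (1 ⊗ₜ x) (τ (antipode k y ⊗ₜ antipode k n))
      simpa [twistedHopfData, hτ.mul_tmul] using h
  have contract_left (s : H ⊗[k] H) : twistedMul τ ((twistedHopfData τ).antipode.lTensor _
      (TensorProduct.tensorTensorTensorComm k H H K K (s ⊗ₜ Coalgebra.comul x))) =
      Coalgebra.counit (R := k) x • LinearMap.mul' k H ((antipode k).lTensor H s) ⊗ₜ 1 := by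
    induction s with
    | zero => simp
    | add s t hs ht => simp only [map_add, TensorProduct.add_tmul, smul_add, hs, ht]
    | tmul m n =>
      simp [contract_right, Algebra.algebraMap_eq_smul_one, hτ.one_tmul, ← TensorProduct.smul_tmul']
  rw [TensorProduct.comul_tmul, TensorProduct.counit_tmul]
  refine (contract_left _).trans ?_
  simp [Algebra.algebraMap_eq_smul_one, smul_smul, ← TensorProduct.smul_tmul',
    Algebra.TensorProduct.one_def]

end Linear

variable {τ : K ⊗[k] H →ₗc[k] H ⊗[k] K} (hτ : IsExchange τ.toLinearMap)
include hτ

theorem isHopfAlgebra_twistedHopfData : (twistedHopfData τ.toLinearMap).IsHopfAlgebra where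
  mul_assoc := hτ.twistedMul_assoc
  one_mul t := (hτ.twistedMul_tmul_one 1 t).trans (one_mul t)
  mul_one t := (hτ.twistedMul_one_tmul t 1).trans (mul_one t)
  coassoc := Coalgebra.coassoc_apply
  counit_left := Coalgebra.rTensor_counit_comul
  counit_right := Coalgebra.lTensor_counit_comul
  comul_mul s t := by
    rw [middle_comm]
    exact (CoalgHomClass.map_comp_comul_apply (twistedMulCoalgHom τ) (s ⊗ₜ t)).symm
  comul_one := Bialgebra.comul_one
  counit_mul s t := (CoalgHomClass.counit_comp_apply (twistedMulCoalgHom τ) (s ⊗ₜ t)).trans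
    ((TensorProduct.counit_tmul _ _).trans (mul_comm _ _))
  counit_one := Bialgebra.counit_one
  antipode_left t := by
    induction t with
    | zero => simp
    | add s t hs ht => simp only [map_add, add_smul, hs, ht]
    | tmul m x => exact hτ.mul_antipode_rTensor_comul_tmul m x
  antipode_right t := by
    induction t with
    | zero => simp
    | add s t hs ht => simp only [map_add, add_smul, hs, ht]
    | tmul m x => exact hτ.mul_antipode_lTensor_comul_tmul m x

end IsExchange

theorem isBialgebraHom_tmul_one {τ : K ⊗[k] H →ₗ[k] H ⊗[k] K} (hτ : IsExchange τ) :
    IsBialgebraHom (hopfData k H) (twistedHopfData τ) ((TensorProduct.mk k H K).flip 1) where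
  map_mul m n := by
    change (m * n) ⊗ₜ[k] (1 : K) = twistedMul τ ((m ⊗ₜ 1) ⊗ₜ (n ⊗ₜ 1))
    simp [hτ.twistedMul_tmul_one]
  map_one := rfl
  map_comul m := by
    change Coalgebra.comul (R := k) (m ⊗ₜ[k] (1 : K)) = TensorProduct.map _ _ (Coalgebra.comul m)
    rw [TensorProduct.comul_tmul, Bialgebra.comul_one, Algebra.TensorProduct.one_def]
    induction Coalgebra.comul (R := k) m with
    | zero => simp
    | add s t hs ht => simp only [map_add, TensorProduct.add_tmul, hs, ht]
    | tmul l n => rfl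
  map_counit m := by
    simp [twistedHopfData, hopfData]

theorem isBialgebraHom_mul {L : Type*} [Ring L] [HopfAlgebra k L] {τ : K ⊗[k] H →ₗ[k] H ⊗[k] K}
    {f : H →ₐc[k] L} {g : K →ₐc[k] L} (hfg : ∀ x n, g x * f n =
      LinearMap.mul' k L (TensorProduct.map (f : H →ₗ[k] L) (g : K →ₗ[k] L) (τ (x ⊗ₜ n)))) :
    IsBialgebraHom (twistedHopfData τ) (hopfData k L)
      (LinearMap.mul' k L ∘ₗ TensorProduct.map (f : H →ₗ[k] L) (g : K →ₗ[k] L)) where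
  map_mul s t := by
    have mul_sandwich (m : H) (u : H ⊗[k] K) (y : K) :
        LinearMap.mul' k L (TensorProduct.map (f : H →ₗ[k] L) (g : K →ₗ[k] L)
          ((m ⊗ₜ 1) * u * (1 ⊗ₜ y))) =
        f m * LinearMap.mul' k L (TensorProduct.map (f : H →ₗ[k] L) (g : K →ₗ[k] L) u) * g y := by
      induction u with
      | zero => simp
      | add u v hu hv => simp only [mul_add, add_mul, map_add, hu, hv]
      | tmul n x => simp [mul_assoc]
    change LinearMap.mul' k L (TensorProduct.map (f : H →ₗ[k] L) (g : K →ₗ[k] L)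
      (twistedMul τ (s ⊗ₜ t))) = LinearMap.mul' k L
        (TensorProduct.map (f : H →ₗ[k] L) (g : K →ₗ[k] L) s) *
        LinearMap.mul' k L (TensorProduct.map (f : H →ₗ[k] L) (g : K →ₗ[k] L) t)
    induction s with
    | zero => simp
    | add s s' hs hs' => simp only [map_add, TensorProduct.add_tmul, add_mul, hs, hs']
    | tmul m x =>
      induction t with
      | zero => simp
      | add t t' ht ht' => simp only [map_add, TensorProduct.tmul_add, mul_add, ht, ht']
      | tmul n y =>
        rw [twistedMul_tmul, mul_sandwich, ← hfg]
        simp [mul_assoc]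
  map_one := by
    simp [twistedHopfData, hopfData, Algebra.TensorProduct.one_def]
  map_comul t := (CoalgHomClass.map_comp_comul_apply ((Bialgebra.mulCoalgHom k L).comp
    (Coalgebra.TensorProduct.map (f : H →ₗc[k] L) (g : K →ₗc[k] L))) t).symm
  map_counit t := CoalgHomClass.counit_comp_apply ((Bialgebra.mulCoalgHom k L).comp
    (Coalgebra.TensorProduct.map (f : H →ₗc[k] L) (g : K →ₗc[k] L))) t

end Hopf

end TwistedTensorProduct

/-! ### Pairings of Hopf algebras -/

theorem sum_comm₂ {α β γ δ M : Type*} [Fintype α] [Fintype β] [Fintype γ] [Fintype δ]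
    [AddCommMonoid M] (f : α → β → γ → δ → M) :
    ∑ a, ∑ b, ∑ c, ∑ d, f a b c d = ∑ c, ∑ d, ∑ a, ∑ b, f a b c d := by
  simpa only [Fintype.sum_prod_type] using
    Finset.sum_comm (s := .univ) (t := .univ)
      (f := fun (u : α × β) (v : γ × δ) => f u.1 u.2 v.1 v.2)

section Hit

variable {k ι C : Type*} [CommSemiring k] [Fintype ι] [DecidableEq ι] [AddCommMonoid C]
  [Module k C] [Coalgebra k C]

/-- The map `x ↦ α(x₁) x₂`: the right action of the dual algebra. -/
def leftContract (α : C →ₗ[k] k) : C →ₗ[k] C :=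
  TensorProduct.lid k C ∘ₗ α.rTensor C ∘ₗ Coalgebra.comul

/-- The map `x ↦ x₁ β(x₂)`: the left action of the dual algebra. -/
def rightContract (β : C →ₗ[k] k) : C →ₗ[k] C :=
  TensorProduct.rid k C ∘ₗ β.lTensor C ∘ₗ Coalgebra.comul

variable {c : Matrix ι ι C} (hc : IsComatrix k c)
include hc

theorem IsComatrix.leftContract_apply (α : C →ₗ[k] k) (i j : ι) :
    leftContract α (c i j) = ∑ a, α (c i a) • c a j := by
  simp [leftContract, hc.comul_apply]

theorem IsComatrix.rightContract_apply (β : C →ₗ[k] k) (i j : ι) :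
    rightContract β (c i j) = ∑ a, β (c a j) • c i a := by
  simp [rightContract, hc.comul_apply]

end Hit

@[simp]
theorem leftContract_one {k A : Type*} [CommSemiring k] [Semiring A] [Bialgebra k A]
    (α : A →ₗ[k] k) : leftContract α 1 = α 1 • 1 := by
  simp [leftContract, Algebra.TensorProduct.one_def]

@[simp]
theorem rightContract_one {k A : Type*} [CommSemiring k] [Semiring A] [Bialgebra k A]
    (β : A →ₗ[k] k) : rightContract β 1 = β 1 • 1 := by
  simp [rightContract, Algebra.TensorProduct.one_def]

section HitMul

variable {k ι A : Type*} [Field k] [Fintype ι] [Ring A] [Bialgebra k A]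

theorem leftContract_mul {α : A →ₗ[k] k} {α₁ α₂ : ι → A →ₗ[k] k}
    (hα : ∀ x y, α (x * y) = ∑ w, α₁ w x * α₂ w y) (x y : A) :
    leftContract α (x * y) = ∑ w, leftContract (α₁ w) x * leftContract (α₂ w) y := by
  suffices (LinearMap.mul k A).compr₂ (leftContract α) =
      ∑ w, (LinearMap.mul k A).compl₁₂ (leftContract (α₁ w)) (leftContract (α₂ w)) by
    simpa using LinearMap.congr_fun₂ this x y
  refine ext_comatrix₂ fun r c hc s d hd i j a b => ?_
  have h := (hc.kronecker hd).leftContract_apply α (i, a) (j, b)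
  simp only [Matrix.kroneckerMap_apply, Fintype.sum_prod_type, hα, Finset.sum_smul] at h
  simp only [LinearMap.compr₂_apply, LinearMap.mul_apply', h, LinearMap.sum_apply,
    LinearMap.compl₁₂_apply, hc.leftContract_apply, hd.leftContract_apply, Finset.sum_mul_sum,
    smul_mul_smul_comm]
  exact Finset.sum_comm_cycle

theorem rightContract_mul {β : A →ₗ[k] k} {β₁ β₂ : ι → A →ₗ[k] k}
    (hβ : ∀ x y, β (x * y) = ∑ w, β₁ w x * β₂ w y) (x y : A) :
    rightContract β (x * y) = ∑ w, rightContract (β₁ w) x * rightContract (β₂ w) y := by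
  suffices (LinearMap.mul k A).compr₂ (rightContract β) =
      ∑ w, (LinearMap.mul k A).compl₁₂ (rightContract (β₁ w)) (rightContract (β₂ w)) by
    simpa using LinearMap.congr_fun₂ this x y
  refine ext_comatrix₂ fun r c hc s d hd i j a b => ?_
  have h := (hc.kronecker hd).rightContract_apply β (i, a) (j, b)
  simp only [Matrix.kroneckerMap_apply, Fintype.sum_prod_type, hβ, Finset.sum_smul] at h
  simp only [LinearMap.compr₂_apply, LinearMap.mul_apply', h, LinearMap.sum_apply,
    LinearMap.compl₁₂_apply, hc.rightContract_apply, hd.rightContract_apply, Finset.sum_mul_sum,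
    smul_mul_smul_comm]
  exact Finset.sum_comm_cycle

end HitMul

section Pairing

open HopfAlgebra (antipode)

variable {k U V : Type*} [Field k] [Ring U] [HopfAlgebra k U] [Ring V] [HopfAlgebra k V]
  {p : U →ₗ[k] V →ₗ[k] k}
  (hU : Function.Bijective (antipode k : U →ₗ[k] U))
  (hV : Function.Bijective (antipode k : V →ₗ[k] V))
  {ι κ : Type*} [Fintype ι] [DecidableEq ι] [Fintype κ] [DecidableEq κ]
  {x : Matrix ι ι V} {n : Matrix κ κ U}

section Comatrix

variable (hn : IsComatrix k n)
include hn

theorem IsComatrix.sum_antipodeInv_mul (a b : κ) :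
    ∑ c, antipodeInv hU (n c b) * n a c = (1 : Matrix κ κ U) a b :=
  (Matrix.ext_iff.2 (hn.transpose_cop (hA := hU)).map_antipode_mul b a).trans <|
    congr_fun₂ Matrix.transpose_one a b

theorem IsComatrix.sum_mul_antipodeInv (a b : κ) :
    ∑ c, n c b * antipodeInv hU (n a c) = (1 : Matrix κ κ U) a b :=
  (Matrix.ext_iff.2 (hn.transpose_cop (hA := hU)).mul_map_antipode b a).trans <|
    congr_fun₂ Matrix.transpose_one a b

theorem IsComatrix.transpose_map_antipodeInv : IsComatrix k (n.map (antipodeInv hU)).transpose := by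
  have h := (hn.transpose_cop (hA := hU)).transpose_map_antipode
  refine ⟨fun i j => (TensorProduct.comm k U U).injective ((h.comul_apply j i).trans ?_),
    fun i j => (h.counit_apply j i).trans (congr_fun₂ Matrix.transpose_one i j)⟩
  simp only [map_sum, TensorProduct.comm_tmul]
  rfl

end Comatrix

namespace IsPairing

variable (hp : IsPairing p)
include hp

theorem mul_left_comatrix (hx : IsComatrix k x) (m m' : U) (i j : ι) :
    p (m * m') (x i j) = ∑ a, p m (x i a) * p m' (x a j) := by
  simp [hp.mul_left, hx.comul_apply]

theorem mul_right_comatrix (hn : IsComatrix k n) (y y' : V) (i j : κ) :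
    p (n i j) (y * y') = ∑ a, p (n i a) y * p (n a j) y' := by
  simp [hp.mul_right, hn.comul_apply]

theorem antipode_left (m : U) (y : V) : p (antipode k m) y = p m (antipode k y) := by
  suffices p.comp (antipode k) = p.compl₂ (antipode k) from LinearMap.congr_fun₂ this m y
  refine ext_comatrix₂ fun r n hn s x hx i j a b => ?_
  let M : Matrix (Fin r × Fin s) (Fin r × Fin s) k := .of fun u v => p (n u.1 v.1) (x u.2 v.2)
  let L : Matrix (Fin r × Fin s) (Fin r × Fin s) k := .of fun u v =>
    p (antipode k (n u.1 v.1)) (x u.2 v.2)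
  let N : Matrix (Fin r × Fin s) (Fin r × Fin s) k := .of fun u v =>
    p (n u.1 v.1) (antipode k (x u.2 v.2))
  have left_inv : L * M = 1 := by
    ext u v
    have h := Matrix.ext_iff.2 hn.map_antipode_mul u.1 v.1
    simp only [Matrix.mul_apply, Matrix.map_apply] at h
    simp only [L, M, Matrix.mul_apply, Matrix.of_apply, Fintype.sum_prod_type,
      ← hp.mul_left_comatrix hx, ← LinearMap.sum_apply, ← map_sum, h]
    by_cases h : u.1 = v.1 <;>
      simp [h, hp.one_left, hx.counit_apply, Prod.ext_iff, Matrix.one_apply]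
  have right_inv : M * N = 1 := by
    ext u v
    have h := Matrix.ext_iff.2 hx.mul_map_antipode u.2 v.2
    simp only [Matrix.mul_apply, Matrix.map_apply] at h
    simp only [N, M, Matrix.mul_apply, Matrix.of_apply, Fintype.sum_prod_type_right,
      ← hp.mul_right_comatrix hn, ← map_sum, h]
    by_cases h : u.2 = v.2 <;>
      simp [h, hp.one_right, hn.counit_apply, Prod.ext_iff, Matrix.one_apply]
  have h : L = N := left_inv_eq_right_inv left_inv right_inv
  exact congr_fun₂ h (i, a) (j, b)

theorem antipodeInv_left (m : U) (y : V) : p (antipodeInv hU m) y = p m (antipodeInv hV y) := by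
  rw [← antipode_antipodeInv hV y, ← hp.antipode_left, antipode_antipodeInv, antipode_antipodeInv]

end IsPairing

variable (p) in
theorem exchange_comatrix (hx : IsComatrix k x) (hn : IsComatrix k n) (i j : ι) (a b : κ) :
    exchange p hU (x i j ⊗ₜ n a b) = ∑ i', ∑ j', ∑ a', ∑ b',
      (p (n b' b) (x i i') * p (antipodeInv hU (n a a')) (x j' j)) • (n a' b' ⊗ₜ[k] x i' j') := by
  simp only [exchange, TensorProduct.lift.tmul, sweedler₂, LinearMap.comp_apply, hx.sweedler_succ,
    map_sum, LinearMap.sum_apply, hn.sweedler_succ, sweedler_zero]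
  rfl

variable (p) in
theorem exchange_tmul_comatrix (hn : IsComatrix k n) (x : V) (a b : κ) :
    exchange p hU (x ⊗ₜ n a b) = ∑ a', ∑ b', n a' b' ⊗ₜ[k]
      rightContract (p (antipodeInv hU (n a a'))) (leftContract (p (n b' b)) x) := by
  suffices exchange p hU ∘ₗ (TensorProduct.mk k V U).flip (n a b) = ∑ a', ∑ b',
      TensorProduct.mk k U V (n a' b') ∘ₗ
        rightContract (p (antipodeInv hU (n a a'))) ∘ₗ leftContract (p (n b' b)) by
    simpa using LinearMap.congr_fun this x
  refine ext_comatrix fun r x hx i j => ?_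
  refine (exchange_comatrix p hU hx hn i j a b).trans ?_
  simp only [LinearMap.sum_apply, LinearMap.comp_apply, hx.leftContract_apply, map_sum, map_smul,
    hx.rightContract_apply, TensorProduct.mk_apply, smul_smul, Finset.smul_sum]
  exact sum_comm₂ _

variable (p) in
theorem exchange_comatrix_tmul (hx : IsComatrix k x) (n : U) (i j : ι) :
    exchange p hU (x i j ⊗ₜ n) = ∑ i', ∑ j',
      rightContract (p.flip (x i i'))
        (leftContract (p.flip (x j' j) ∘ₗ antipodeInv hU) n) ⊗ₜ[k] x i' j' := by
  suffices exchange p hU ∘ₗ TensorProduct.mk k V U (x i j) = ∑ i', ∑ j',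
      (TensorProduct.mk k U V).flip (x i' j') ∘ₗ rightContract (p.flip (x i i')) ∘ₗ
        leftContract (p.flip (x j' j) ∘ₗ antipodeInv hU) by
    simpa using LinearMap.congr_fun this n
  refine ext_comatrix fun r n hn a b => ?_
  refine (exchange_comatrix p hU hx hn i j a b).trans ?_
  simp only [LinearMap.sum_apply, LinearMap.comp_apply, hn.leftContract_apply, map_sum, map_smul,
    hn.rightContract_apply, TensorProduct.mk_apply, LinearMap.flip_apply, smul_smul,
    Finset.smul_sum]
  simp only [mul_comm]

theorem exchange_mul_tmul (hp : IsPairing p) (x y : V) (n : U) :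
    exchange p hU ((x * y) ⊗ₜ n) =
    twistedMul (exchange p hU) ((1 ⊗ₜ x) ⊗ₜ exchange p hU (y ⊗ₜ n)) := by
  suffices exchange p hU ∘ₗ TensorProduct.mk k V U (x * y) =
      twistedMul (exchange p hU) ∘ₗ TensorProduct.mk k _ _ (1 ⊗ₜ x) ∘ₗ
        exchange p hU ∘ₗ TensorProduct.mk k V U y from
    LinearMap.congr_fun this n
  refine ext_comatrix fun r n hn a b => ?_
  have antipodeInv_mul_right (u v : Fin r) (y y' : V) : p (antipodeInv hU (n u v)) (y * y') =
      ∑ w, p (antipodeInv hU (n w v)) y * p (antipodeInv hU (n u w)) y' :=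
    hp.mul_right_comatrix (hn.transpose_map_antipodeInv hU) y y' v u
  change exchange p hU ((x * y) ⊗ₜ n a b) =
    twistedMul (exchange p hU) ((1 ⊗ₜ x) ⊗ₜ exchange p hU (y ⊗ₜ n a b))
  simp only [exchange_tmul_comatrix p hU hn, leftContract_mul (hp.mul_right_comatrix hn · · _ _),
    map_sum, rightContract_mul (antipodeInv_mul_right _ _), TensorProduct.tmul_sum,
    twistedMul_tmul]
  simp only [← Algebra.TensorProduct.one_def, one_mul, Finset.sum_mul,
    Algebra.TensorProduct.tmul_mul_tmul, mul_one]
  rw [sum_comm₂]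
  exact Finset.sum_comm

theorem exchange_tmul_mul (hp : IsPairing p) (x : V) (m n : U) :
    exchange p hU (x ⊗ₜ (m * n)) =
    twistedMul (exchange p hU) (exchange p hU (x ⊗ₜ m) ⊗ₜ (n ⊗ₜ 1)) := by
  suffices exchange p hU ∘ₗ (TensorProduct.mk k V U).flip (m * n) = twistedMul (exchange p hU) ∘ₗ
      (TensorProduct.mk k _ _).flip (n ⊗ₜ 1) ∘ₗ exchange p hU ∘ₗ
        (TensorProduct.mk k V U).flip m from
    LinearMap.congr_fun this x
  refine ext_comatrix fun r x hx i j => ?_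
  have mul_left (u v : Fin r) (m m' : U) : p.flip (x u v) (m * m') =
      ∑ w, p.flip (x u w) m * p.flip (x w v) m' :=
    hp.mul_left_comatrix hx m m' u v
  have antipodeInv_mul_left (u v : Fin r) (m m' : U) :
      (p.flip (x u v) ∘ₗ antipodeInv hU) (m * m') = ∑ w,
        (p.flip (x w v) ∘ₗ antipodeInv hU) m * (p.flip (x u w) ∘ₗ antipodeInv hU) m' := by
    simp only [LinearMap.comp_apply, antipodeInv_mul, mul_left, mul_comm]
  change exchange p hU (x i j ⊗ₜ (m * n)) =
    twistedMul (exchange p hU) (exchange p hU (x i j ⊗ₜ m) ⊗ₜ (n ⊗ₜ 1))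
  simp only [exchange_comatrix_tmul p hU hx]
  simp only [leftContract_mul (antipodeInv_mul_left _ _), map_sum, rightContract_mul (mul_left _ _),
    TensorProduct.sum_tmul, twistedMul_tmul, exchange_comatrix_tmul p hU hx, Finset.mul_sum,
    Algebra.TensorProduct.tmul_mul_tmul, one_mul]
  simp only [← Algebra.TensorProduct.one_def, mul_one]
  rw [sum_comm₂, Finset.sum_comm]

theorem exchange_one_tmul (hp : IsPairing p) (n : U) : exchange p hU (1 ⊗ₜ n) = n ⊗ₜ 1 := by
  suffices exchange p hU ∘ₗ TensorProduct.mk k V U 1 = (TensorProduct.mk k U V).flip 1 from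
    LinearMap.congr_fun this n
  refine ext_comatrix fun r n hn a b => ?_
  have antipodeInv_one_right (u v : Fin r) :
      p (antipodeInv hU (n u v)) 1 = (1 : Matrix (Fin r) (Fin r) k) u v := by
    refine (hp.one_right _).trans <| ((hn.transpose_map_antipodeInv hU).counit_apply v u).trans ?_
    exact congr_fun₂ Matrix.transpose_one u v
  refine (exchange_tmul_comatrix p hU hn 1 a b).trans ?_
  simp only [leftContract_one, map_smul, rightContract_one, hp.one_right (n _ _), hn.counit_apply,
    antipodeInv_one_right]
  simp [Matrix.one_apply, TensorProduct.tmul_ite]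

theorem exchange_tmul_one (hp : IsPairing p) (x : V) : exchange p hU (x ⊗ₜ 1) = 1 ⊗ₜ x := by
  suffices exchange p hU ∘ₗ (TensorProduct.mk k V U).flip 1 = TensorProduct.mk k U V 1 from
    LinearMap.congr_fun this x
  refine ext_comatrix fun r x hx i j => (exchange_comatrix_tmul p hU hx 1 i j).trans ?_
  simp only [leftContract_one, map_smul, rightContract_one, LinearMap.flip_apply,
    LinearMap.comp_apply, antipodeInv_one, hp.one_left, hx.counit_apply]
  simp [Matrix.one_apply, TensorProduct.ite_tmul]

theorem isExchange_exchange (hp : IsPairing p) : IsExchange (exchange p hU) where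
  one_tmul := exchange_one_tmul hU hp
  tmul_one := exchange_tmul_one hU hp
  mul_tmul := exchange_mul_tmul hU hp
  tmul_mul := exchange_tmul_mul hU hp

theorem isComatrix_exchange (hp : IsPairing p) (hx : IsComatrix k x) (hn : IsComatrix k n) :
    IsComatrix k (C := Cop hU ⊗[k] V) (ι := κ × ι)
      (.of fun u v => exchange p hU (x u.2 v.2 ⊗ₜ n v.1 u.1)) := by
  let R : Matrix (κ × ι) (κ × ι) k := .of fun u v => p (n v.1 u.1) (x u.2 v.2)
  let R' : Matrix (κ × ι) (κ × ι) k := .of fun u v => p (antipodeInv hU (n v.1 u.1)) (x u.2 v.2)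
  have inv : R * R' = 1 := by
    ext u v
    simp only [R, R', Matrix.mul_apply, Matrix.of_apply, Fintype.sum_prod_type,
      ← hp.mul_left_comatrix hx, ← LinearMap.sum_apply, ← map_sum, hn.sum_mul_antipodeInv hU]
    by_cases h : u.1 = v.1 <;>
      simp [h, Ne.symm, hp.one_left, hx.counit_apply, Prod.ext_iff, Matrix.one_apply]
  convert ((hn.transpose_cop (hA := hU)).kroneckerTMul hx).conj inv using 1
  ext u v
  simp only [Matrix.of_apply, exchange_comatrix p hU hx hn, R, R', Fintype.sum_prod_type]
  exact (sum_comm₂ _).trans <| Finset.sum_comm.trans <| Finset.sum_congr rfl fun _ _ =>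
    Finset.sum_comm

/-- The exchange map of a pairing as a morphism of coalgebras. -/
def exchangeCoalgHom (hp : IsPairing p) : V ⊗[k] Cop hU →ₗc[k] Cop hU ⊗[k] V where
  __ := exchange p hU
  counit_comp := by
    refine TensorProduct.ext <| ext_comatrix₂ fun r x hx s n hn i j a b => ?_
    refine ((isComatrix_exchange hU hp hx hn.transpose_of_cop).counit_apply (a, i) (b, j)).trans ?_
    change _ = Coalgebra.counit (R := k) (x i j ⊗ₜ[k] n a b)
    rw [← Matrix.one_kronecker_one]
    simp [hx.counit_apply, hn.counit_apply, mul_comm]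
  map_comp_comul := by
    refine TensorProduct.ext <| ext_comatrix₂ fun r x hx s n hn i j a b => ?_
    let τ : V ⊗[k] Cop hU →ₗ[k] Cop hU ⊗[k] V := exchange (U := U) p hU
    have comul_τ := (isComatrix_exchange hU hp hx hn.transpose_of_cop).comul_apply (a, i) (b, j)
    have comul_tmul := (hx.kroneckerTMul hn).comul_apply (i, a) (j, b)
    refine (congrArg (TensorProduct.map τ τ) comul_tmul).trans <| .trans ?_ comul_τ.symm
    simp only [map_sum, Fintype.sum_prod_type]
    exact Finset.sum_comm

theorem double_antipode (hp : IsPairing p) : (double p hU hV).antipode = exchange p hU ∘ₗ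
    TensorProduct.map (antipode k) (antipodeInv hU) ∘ₗ (TensorProduct.comm k U V).toLinearMap := by
  refine TensorProduct.ext <| ext_comatrix₂ fun r m hm s x hx a b i j => ?_
  have exchange_eq := exchange_comatrix p hU hx.transpose_map_antipode
    (hm.transpose_map_antipodeInv hU) j i b a
  have antipodeInv_antipode (m : U) (x : V) : p (antipodeInv hU m) (antipode k x) = p m x := by
    rw [← hp.antipode_left, antipode_antipodeInv]
  simp only [Matrix.transpose_apply, Matrix.map_apply, antipodeInv_antipode,
    hp.antipodeInv_left hU hV] at exchange_eq
  have antipode_eq : (double p hU hV).antipode (m a b ⊗ₜ x i j) = ∑ a', ∑ b', ∑ i', ∑ j',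
      (p (m a a') (x j' j) * p (m b' b) (antipodeInv hV (x i i'))) •
        (antipodeInv hU (m a' b') ⊗ₜ[k] antipode k (x i' j')) := by
    simp only [double, TensorProduct.lift.tmul, sweedler₂, LinearMap.comp_apply, hx.sweedler_succ,
      sweedler_zero, map_sum, LinearMap.sum_apply, hm.sweedler_succ]
    rfl
  refine antipode_eq.trans (.trans ?_ exchange_eq.symm)
  rw [sum_comm₂, Finset.sum_comm]
  exact Finset.sum_congr rfl fun _ _ => Finset.sum_congr rfl fun _ _ => Finset.sum_comm

variable (p) in
theorem double_comul :
    (double p hU hV).comul = Coalgebra.comul (R := k) (A := Cop hU ⊗[k] V) := by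
  refine TensorProduct.ext <| LinearMap.ext₂ fun m x => ?_
  change middle (TensorProduct.comm k U V).toLinearMap _ = _
  rw [middle_comm]
  rfl

variable (p) in
theorem double_counit :
    (double p hU hV).counit = Coalgebra.counit (R := k) (A := Cop hU ⊗[k] V) :=
  TensorProduct.ext <| LinearMap.ext₂ fun _ _ => mul_comm _ _

theorem double_eq_twistedHopfData (hp : IsPairing p) : double p hU hV =
    twistedHopfData (exchangeCoalgHom hU hp).toLinearMap :=
  (HopfData.mk.injEq ..).mpr
    ⟨rfl, rfl, double_comul p hU hV, double_counit p hU hV, double_antipode hU hV hp⟩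

theorem isHopfAlgebra_double (hp : IsPairing p) : (double p hU hV).IsHopfAlgebra :=
  (congrArg HopfData.IsHopfAlgebra (double_eq_twistedHopfData hU hV hp)).mpr <|
    IsExchange.isHopfAlgebra_twistedHopfData (isExchange_exchange hU hp)

end Pairing

/-! ### The projection of the double -/

section Projection

open HopfAlgebra (antipode)

variable {k U V : Type*} [Field k] [Ring U] [HopfAlgebra k U] [Ring V] [HopfAlgebra k V]
  {p : U →ₗ[k] V →ₗ[k] k} {γ : V →ₗ[k] U}
  {hU : Function.Bijective (antipode k : U →ₗ[k] U)}
  {hV : Function.Bijective (antipode k : V →ₗ[k] V)}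
  {ι : Type*} [Fintype ι] [DecidableEq ι] {x : Matrix ι ι V}

namespace IsProjectionDatum

/-- The map `γ` of a projection datum as a morphism of bialgebras to the co-opposite of `U`. -/
def toBialgHom (hγ : IsProjectionDatum p γ hU) : V →ₐc[k] Cop hU :=
  IsBialgebraHom.toBialgHom (H := Cop hU) hγ.isBialgebraHom

variable (hγ : IsProjectionDatum p γ hU)
include hγ

theorem map_mul (x y : V) : γ (x * y) = γ x * γ y :=
  hγ.isBialgebraHom.map_mul x y

theorem map_one : γ 1 = 1 :=
  hγ.isBialgebraHom.map_one

theorem counit_map (x : V) : Coalgebra.counit (R := k) (γ x) = Coalgebra.counit (R := k) x :=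
  hγ.isBialgebraHom.map_counit x

theorem map_antipode (y : V) : γ (antipode k y) = antipodeInv hU (γ y) :=
  DoubleBiproduct.map_antipode hγ.toBialgHom y

theorem map_antipodeInv (y : V) : γ (antipodeInv hV y) = antipode k (γ y) := by
  conv_rhs => rw [← antipode_antipodeInv hV y, hγ.map_antipode, antipode_antipodeInv]

theorem isComatrix_transpose_map (hx : IsComatrix k x) : IsComatrix k (x.map γ).transpose :=
  (hx.map hγ.toBialgHom).transpose_of_cop

theorem isComatrix_map_antipode (hx : IsComatrix k x) :
    IsComatrix k ((x.map γ).map (antipode k)) :=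
  (hγ.isComatrix_transpose_map hx).transpose_map_antipode

end IsProjectionDatum

theorem isBialgebraHom_doubleIncl (hp : IsPairing p) :
    IsBialgebraHom (copData hU) (double p hU hV) doubleIncl := by
  rw [double_eq_twistedHopfData hU hV hp]
  exact isBialgebraHom_tmul_one (H := Cop hU) (isExchange_exchange hU hp)

theorem isBialgebraHom_doubleProj (hp : IsPairing p) (hγ : IsProjectionDatum p γ hU) :
    IsBialgebraHom (double p hU hV) (copData hU) (doubleProj γ) := by
  rw [double_eq_twistedHopfData hU hV hp]
  exact isBialgebraHom_mul (f := BialgHom.id k (Cop hU)) (g := hγ.toBialgHom) hγ.exchange_eq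

theorem doubleProj_comp_doubleIncl (hγ : IsProjectionDatum p γ hU) :
    doubleProj γ ∘ₗ doubleIncl = LinearMap.id :=
  LinearMap.ext fun m => (congrArg (m * ·) hγ.map_one).trans (mul_one m)

end Projection

/-! ### The coinvariants of the projection -/

section Coinvariants

open HopfAlgebra (antipode)

variable {k U V : Type*} [Field k] [Ring U] [HopfAlgebra k U] [Ring V] [HopfAlgebra k V]
  {p : U →ₗ[k] V →ₗ[k] k} {γ : V →ₗ[k] U}
  {hU : Function.Bijective (antipode k : U →ₗ[k] U)}
  {hV : Function.Bijective (antipode k : V →ₗ[k] V)}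
  {ι κ : Type*} [Fintype ι] [DecidableEq ι] {x : Matrix ι ι V}
  [Fintype κ] [DecidableEq κ] {n : Matrix κ κ U}

variable (p hU hV) in
theorem double_mul_tmul (m n : U) (x y : V) : (double p hU hV).mul ((m ⊗ₜ x) ⊗ₜ (n ⊗ₜ y)) =
    (m ⊗ₜ 1) * exchange p hU (x ⊗ₜ n) * (1 ⊗ₜ y) :=
  twistedMul_tmul m n x y

theorem double_mul_doubleIncl (hp : IsPairing p) (m : U) (t : U ⊗[k] V) :
    (double p hU hV).mul (doubleIncl m ⊗ₜ t) = (m ⊗ₜ 1) * t :=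
  (isExchange_exchange hU hp).twistedMul_tmul_one m t

variable (p hU hV) in
theorem double_comul_comatrix (hn : IsComatrix k n) (hx : IsComatrix k x) (a b : κ) (i j : ι) :
    (double p hU hV).comul (n a b ⊗ₜ x i j) =
      ∑ c, ∑ l, (n c b ⊗ₜ[k] x i l) ⊗ₜ[k] (n a c ⊗ₜ[k] x l j) := by
  rw [double_comul, ← Fintype.sum_prod_type']
  exact ((hn.transpose_cop (hA := hU)).kroneckerTMul hx).comul_apply (b, i) (a, j)

variable (k U V) in
/-- The map `m ⊗ x ↦ ε(m) x`, a retraction of `theta`. -/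
def doubleRetract : U ⊗[k] V →ₐ[k] V :=
  (Algebra.TensorProduct.lid k V).toAlgHom.comp
    (Algebra.TensorProduct.map (Bialgebra.counitAlgHom k U) (AlgHom.id k V))

theorem doubleRetract_tmul (m : U) (x : V) :
    doubleRetract k U V (m ⊗ₜ x) = Coalgebra.counit (R := k) m • x :=
  rfl

theorem doubleRetract_exchange (hV : Function.Bijective (antipode k : V →ₗ[k] V))
    (hp : IsPairing p) (hx : IsComatrix k x) (i j : ι) (n : U) :
    doubleRetract k U V (exchange p hU (x i j ⊗ₜ n)) =
      ∑ a, ∑ b, p n (antipodeInv hV (x b j) * x i a) • x a b := by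
  suffices (doubleRetract k U V).toLinearMap ∘ₗ exchange p hU ∘ₗ TensorProduct.mk k V U (x i j) =
      ∑ a, ∑ b, (p.flip (antipodeInv hV (x b j) * x i a)).smulRight (x a b) by
    simpa [LinearMap.sum_apply] using LinearMap.congr_fun this n
  refine ext_comatrix fun r n hn a b => ?_
  simp only [LinearMap.comp_apply, TensorProduct.mk_apply, exchange_comatrix p hU hx hn, map_sum,
    map_smul, AlgHom.toLinearMap_apply, doubleRetract_tmul, hn.counit_apply, LinearMap.sum_apply,
    LinearMap.smulRight_apply, LinearMap.flip_apply, hp.mul_right_comatrix hn,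
    hp.antipodeInv_left hU hV, Finset.sum_smul]
  simp [ite_smul, Matrix.one_apply, mul_comm]

theorem doubleRetract_mul (t : U ⊗[k] V) (n : U) (z : V) :
    doubleRetract k U V ((double p hU hV).mul (t ⊗ₜ (n ⊗ₜ z))) =
      doubleRetract k U V (exchange p hU (doubleRetract k U V t ⊗ₜ n)) * z := by
  induction t with
  | zero => simp
  | add s t hs ht => simp only [map_add, TensorProduct.add_tmul, hs, ht, add_mul]
  | tmul m x =>
    simp [double_mul_tmul, map_mul, doubleRetract_tmul, ← TensorProduct.smul_tmul']

theorem doubleRetract_doubleIncl_mul (hp : IsPairing p) (m : U) (t : U ⊗[k] V) :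
    doubleRetract k U V ((double p hU hV).mul (doubleIncl m ⊗ₜ t)) =
      Coalgebra.counit (R := k) m • doubleRetract k U V t := by
  rw [double_mul_doubleIncl hp, map_mul, doubleRetract_tmul, smul_one_mul]

theorem theta_comatrix (hx : IsComatrix k x) (i j : ι) :
    theta γ (x i j) = ∑ a, antipode k (γ (x a j)) ⊗ₜ[k] x i a := by
  simp only [theta, hx.sweedler_succ, sweedler_zero]
  rfl

theorem theta'_comatrix (hx : IsComatrix k x) (i j : ι) :
    theta' γ hV (x i j) = ∑ a, γ (antipodeInv hV (x a j)) ⊗ₜ[k] x i a := by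
  simp only [theta', hx.sweedler_succ, sweedler_zero]
  rfl

theorem theta_eq_theta' (hγ : IsProjectionDatum p γ hU) : theta γ = theta' γ hV := by
  refine ext_comatrix fun r x hx i j => ?_
  simp only [theta_comatrix hx, theta'_comatrix hx, hγ.map_antipodeInv]

theorem doubleRetract_theta (hγ : IsProjectionDatum p γ hU) (y : V) :
    doubleRetract k U V (theta γ y) = y := by
  suffices (doubleRetract k U V).toLinearMap ∘ₗ theta γ = LinearMap.id from
    LinearMap.congr_fun this y
  refine ext_comatrix fun r x hx i j => ?_
  simp [theta_comatrix hx, doubleRetract_tmul, hγ.counit_map, hx.counit_apply, Matrix.one_apply]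

theorem double_counit_theta (hγ : IsProjectionDatum p γ hU) (y : V) :
    (double p hU hV).counit (theta γ y) = Coalgebra.counit (R := k) y := by
  suffices (double p hU hV).counit ∘ₗ theta γ = Coalgebra.counit from LinearMap.congr_fun this y
  refine ext_comatrix fun r x hx i j => ?_
  simp [double, theta_comatrix hx, hγ.counit_map, hx.counit_apply, Matrix.one_apply]

theorem double_comul_theta (hγ : IsProjectionDatum p γ hU) (hx : IsComatrix k x) (i j : ι) :
    (double p hU hV).comul (theta γ (x i j)) =
      ∑ a, ∑ u, ∑ g, (antipode k (γ (x u j)) ⊗ₜ[k] x i g) ⊗ₜ[k]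
        (antipode k (γ (x a u)) ⊗ₜ[k] x g a) := by
  rw [theta_comatrix hx, map_sum]
  exact Finset.sum_congr rfl fun a _ =>
    double_comul_comatrix p hU hV (hγ.isComatrix_map_antipode hx) hx a j i a

theorem theta_mem_coinvariants (hV : Function.Bijective (antipode k : V →ₗ[k] V))
    (hγ : IsProjectionDatum p γ hU) (y : V) :
    theta γ y ∈ coinvariants (double p hU hV) (copData hU) (doubleProj γ) := by
  suffices (doubleProj γ).lTensor _ ∘ₗ (double p hU hV).comul ∘ₗ theta γ =
      (TensorProduct.mk k _ U).flip 1 ∘ₗ theta γ from LinearMap.congr_fun this y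
  refine ext_comatrix fun r x hx i j => ?_
  have antipode_mul (u g : Fin r) : ∑ a, antipode k (γ (x a u)) * γ (x g a) =
      (1 : Matrix (Fin r) (Fin r) U) g u := by
    simp only [← hγ.map_antipodeInv (hV := hV), ← hγ.map_mul, ← map_sum, hx.sum_antipodeInv_mul]
    simp [Matrix.one_apply, apply_ite γ, hγ.map_one]
  calc (doubleProj γ).lTensor _ ((double p hU hV).comul (theta γ (x i j)))
    _ = ∑ a, ∑ u, ∑ g, (antipode k (γ (x u j)) ⊗ₜ[k] x i g) ⊗ₜ[k]
          (antipode k (γ (x a u)) * γ (x g a)) := by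
      simp only [double_comul_theta hγ hx, map_sum]
      rfl
    _ = ∑ u, ∑ g, (antipode k (γ (x u j)) ⊗ₜ[k] x i g) ⊗ₜ[k]
          (1 : Matrix (Fin r) (Fin r) U) g u := by
      simp only [← antipode_mul, TensorProduct.tmul_sum]
      exact Finset.sum_comm_cycle.symm
    _ = theta γ (x i j) ⊗ₜ 1 := by
      simp [Matrix.one_apply, TensorProduct.tmul_ite, theta_comatrix hx, TensorProduct.sum_tmul]

theorem theta_doubleRetract_of_mem_coinvariants (hV : Function.Bijective (antipode k : V →ₗ[k] V))
    (hγ : IsProjectionDatum p γ hU) {t : U ⊗[k] V}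
    (ht : t ∈ coinvariants (double p hU hV) (copData hU) (doubleProj γ)) :
    theta γ (doubleRetract k U V t) = t := by
  let F : (U ⊗[k] V) ⊗[k] U →ₗ[k] U ⊗[k] V :=
    LinearMap.mul' k _ ∘ₗ (TensorProduct.comm k _ _).toLinearMap ∘ₗ
      TensorProduct.map (theta γ ∘ₗ (doubleRetract k U V).toLinearMap) doubleIncl
  have F_tmul (s : U ⊗[k] V) (m : U) :
      F (s ⊗ₜ m) = (m ⊗ₜ 1) * theta γ (doubleRetract k U V s) :=
    rfl
  have F_comp : F ∘ₗ (doubleProj γ).lTensor _ ∘ₗ (double p hU hV).comul = LinearMap.id := by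
    refine TensorProduct.ext <| ext_comatrix₂ fun r n hn s x hx a b i j => ?_
    calc F ((doubleProj γ).lTensor _ ((double p hU hV).comul (n a b ⊗ₜ x i j)))
      _ = ∑ c, ∑ l, ((n a c * γ (x l j)) ⊗ₜ 1) *
            theta γ (doubleRetract k U V (n c b ⊗ₜ x i l)) := by
        simp only [double_comul_comatrix p hU hV hn hx, map_sum]
        rfl
      _ = ∑ l, ∑ g, (n a b * (γ (x l j) * antipode k (γ (x g l)))) ⊗ₜ x i g := by
        rw [Finset.sum_comm]
        simp [doubleRetract_tmul, hn.counit_apply, Matrix.one_apply, apply_ite (theta γ),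
          theta_comatrix hx, Finset.mul_sum, mul_assoc]
      _ = ∑ g, (n a b * γ ((1 : Matrix (Fin s) (Fin s) V) g j)) ⊗ₜ x i g := by
        rw [Finset.sum_comm]
        simp only [← TensorProduct.sum_tmul, ← Finset.mul_sum, ← map_sum,
          ← hγ.map_antipodeInv (hV := hV), ← hγ.map_mul, hx.sum_mul_antipodeInv]
      _ = n a b ⊗ₜ x i j := by
        simp [Matrix.one_apply, apply_ite γ, hγ.map_one, TensorProduct.ite_tmul]
  calc theta γ (doubleRetract k U V t)
    _ = F (t ⊗ₜ 1) := by rw [F_tmul, ← Algebra.TensorProduct.one_def, one_mul]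
    _ = F ((doubleProj γ).lTensor _ ((double p hU hV).comul t)) := congrArg F ht.symm
    _ = t := LinearMap.congr_fun F_comp t

theorem range_theta (hγ : IsProjectionDatum p γ hU) :
    LinearMap.range (theta γ) = coinvariants (double p hU hV) (copData hU) (doubleProj γ) := by
  refine le_antisymm ?_ fun t ht => ⟨_, theta_doubleRetract_of_mem_coinvariants hV hγ ht⟩
  rintro _ ⟨y, rfl⟩
  exact theta_mem_coinvariants hV hγ y

end Coinvariants

/-! ### The braided Hopf algebra of the double -/

section Underline

open HopfAlgebra (antipode)

variable {k U V : Type*} [Field k] [Ring U] [HopfAlgebra k U] [Ring V] [HopfAlgebra k V]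
  {p : U →ₗ[k] V →ₗ[k] k} {γ : V →ₗ[k] U}
  {hU : Function.Bijective (antipode k : U →ₗ[k] U)}
  {hV : Function.Bijective (antipode k : V →ₗ[k] V)}
  {ι κ : Type*} [Fintype ι] [DecidableEq ι] {x : Matrix ι ι V}
  [Fintype κ] [DecidableEq κ]

theorem underlineYD_act_comatrix (hx : IsComatrix k x) (m : U) (i j : ι) :
    (underlineYD p γ hV).act (m ⊗ₜ x i j) =
      ∑ a, ∑ b, p m (antipodeInv hV (antipodeInv hV (x b j) * x i a)) • x a b := by
  simp only [underlineYD, TensorProduct.lift.tmul, LinearMap.flip_apply, hx.sweedler_succ,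
    sweedler_zero, LinearMap.sum_apply]
  rfl

theorem action'_comatrix {n : Matrix κ κ U} (hn : IsComatrix k n) (hx : IsComatrix k x)
    (u v : κ) (i j : ι) :
    action' p hV (n u v ⊗ₜ x i j) =
      ∑ w, ∑ a, ∑ b, (p (n u w) (antipodeInv hV (x i a)) *
        p (n w v) (antipodeInv hV (antipodeInv hV (x b j)))) • x a b := by
  simp only [action', TensorProduct.lift.tmul, sweedler₂, LinearMap.comp_apply, hx.sweedler_succ,
    sweedler_zero, map_sum, LinearMap.sum_apply, hn.sweedler_succ]
  rfl

theorem underlineYD_act_eq_action' (hp : IsPairing p) :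
    (underlineYD p γ hV).act = action' p hV := by
  refine TensorProduct.ext <| ext_comatrix₂ fun r n hn s x hx u v i j => ?_
  change (underlineYD p γ hV).act (n u v ⊗ₜ x i j) = action' p hV (n u v ⊗ₜ x i j)
  simp only [underlineYD_act_comatrix hx, action'_comatrix hn hx, antipodeInv_mul,
    hp.mul_right_comatrix hn, Finset.sum_smul]
  exact Finset.sum_comm_cycle

theorem underlineYD_coact_comatrix (hx : IsComatrix k x) (i j : ι) :
    (underlineYD p γ hV).coact (x i j) =
      ∑ a, ∑ b, γ (antipodeInv hV (x b j) * x i a) ⊗ₜ[k] x a b := by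
  simp only [underlineYD, hx.sweedler_succ, sweedler_zero]
  rfl

theorem underlineHopf_mul_comatrix {y : Matrix κ κ V} (hx : IsComatrix k x) (hy : IsComatrix k y)
    (i j : ι) (u v : κ) :
    (underlineHopf p γ hV).mul (x i j ⊗ₜ y u v) =
      ∑ a, ∑ b, ∑ w, p (γ (y w v)) (antipode k (x i a) * x b j) • (x a b * y u w) := by
  simp only [underlineHopf, TensorProduct.lift.tmul, sweedler₂, LinearMap.comp_apply,
    hx.sweedler_succ, sweedler_zero, map_sum, LinearMap.sum_apply, hy.sweedler_succ]
  rfl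

theorem underlineHopf_comul_comatrix (hx : IsComatrix k x) (i j : ι) :
    (underlineHopf p γ hV).comul (x i j) = ∑ a, ∑ b, ∑ c, ∑ d, ∑ e,
      p (γ (antipode k (x c d) * x e j)) (antipodeInv hV (x b c) * x i a) •
        (x a b ⊗ₜ[k] x d e) := by
  simp only [underlineHopf, hx.sweedler_succ, sweedler_zero]
  rfl

theorem underlineHopf_antipode_comatrix (hx : IsComatrix k x) (i j : ι) :
    (underlineHopf p γ hV).antipode (x i j) = ∑ a, ∑ b, ∑ c,
      p (γ (x c j)) (x i a * antipode k (x b c)) • antipode k (x a b) := by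
  simp only [underlineHopf, hx.sweedler_succ, sweedler_zero]
  rfl

theorem underlineYD_act_eq (hp : IsPairing p) (hγ : IsProjectionDatum p γ hU) (m : U) (y : V) :
    (underlineYD p γ hV).act (m ⊗ₜ y) = doubleRetract k U V
      (adjointAction (double p hU hV) (copData hU) doubleIncl (m ⊗ₜ theta γ y)) := by
  suffices (underlineYD p γ hV).act = (doubleRetract k U V).toLinearMap ∘ₗ
      adjointAction (double p hU hV) (copData hU) doubleIncl ∘ₗ (theta γ).lTensor U from
    LinearMap.congr_fun this (m ⊗ₜ y)
  refine TensorProduct.ext <| ext_comatrix₂ fun r n hn s x hx u v i j => ?_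
  have retract_mul_mul (m m' : U) : doubleRetract k U V ((double p hU hV).mul
      ((double p hU hV).mul (doubleIncl m ⊗ₜ theta γ (x i j)) ⊗ₜ doubleIncl m')) =
      Coalgebra.counit (R := k) m • doubleRetract k U V (exchange p hU (x i j ⊗ₜ m')) := by
    refine (doubleRetract_mul _ m' 1).trans ?_
    rw [doubleRetract_doubleIncl_mul hp, mul_one, doubleRetract_theta hγ,
      ← TensorProduct.smul_tmul', map_smul, map_smul]
  change (underlineYD p γ hV).act (n u v ⊗ₜ x i j) = doubleRetract k U V
    (adjointAction (double p hU hV) (copData hU) doubleIncl (n u v ⊗ₜ theta γ (x i j)))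
  simp only [underlineYD_act_comatrix hx, adjointAction, LinearMap.comp_apply,
    LinearMap.rTensor_tmul, copData, hn.comul_apply, map_sum, TensorProduct.sum_tmul,
    LinearEquiv.coe_coe, TensorProduct.comm_tmul, TensorProduct.rightComm_tmul,
    TensorProduct.map_tmul, retract_mul_mul, hn.counit_apply, doubleRetract_exchange hV hp hx,
    hp.antipodeInv_left hU hV]
  simp [Matrix.one_apply]

theorem underlineYD_coact_eq (hγ : IsProjectionDatum p γ hU) (y : V) :
    (underlineYD p γ hV).coact y =
      TensorProduct.map (doubleProj γ) (doubleRetract k U V).toLinearMap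
        ((double p hU hV).comul (theta γ y)) := by
  suffices (underlineYD p γ hV).coact =
      TensorProduct.map (doubleProj γ) (doubleRetract k U V).toLinearMap ∘ₗ
        (double p hU hV).comul ∘ₗ theta γ from LinearMap.congr_fun this y
  refine ext_comatrix fun r x hx i j => ?_
  calc (underlineYD p γ hV).coact (x i j)
    _ = ∑ a, ∑ u, ∑ g, (antipode k (γ (x u j)) * γ (x i g)) ⊗ₜ[k]
          ((1 : Matrix (Fin r) (Fin r) k) a u • x g a) := by
      rw [underlineYD_coact_comatrix hx, Finset.sum_comm, ← Finset.sum_comm_cycle]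
      simp [hγ.map_mul, hγ.map_antipodeInv, Matrix.one_apply, TensorProduct.tmul_ite]
    _ = TensorProduct.map (doubleProj γ) (doubleRetract k U V).toLinearMap
          ((double p hU hV).comul (theta γ (x i j))) := by
      simp only [double_comul_theta hγ hx, map_sum, TensorProduct.map_tmul,
        AlgHom.toLinearMap_apply, doubleRetract_tmul, HopfAlgebra.counit_antipode, hγ.counit_map,
        hx.counit_apply]
      rfl

theorem underlineHopf_mul_eq (hp : IsPairing p) (hγ : IsProjectionDatum p γ hU) (x y : V) :
    (underlineHopf p γ hV).mul (x ⊗ₜ y) =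
      doubleRetract k U V ((double p hU hV).mul (theta γ x ⊗ₜ theta γ y)) := by
  suffices (underlineHopf p γ hV).mul =
      (doubleRetract k U V).toLinearMap ∘ₗ (double p hU hV).mul ∘ₗ
        TensorProduct.map (theta γ) (theta γ) from LinearMap.congr_fun this (x ⊗ₜ y)
  refine TensorProduct.ext <| ext_comatrix₂ fun r x hx s y hy i j u v => ?_
  change (underlineHopf p γ hV).mul (x i j ⊗ₜ y u v) =
    doubleRetract k U V ((double p hU hV).mul (theta γ (x i j) ⊗ₜ theta γ (y u v)))
  simp only [underlineHopf_mul_comatrix hx hy, theta_comatrix hy, TensorProduct.tmul_sum, map_sum,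
    doubleRetract_mul, doubleRetract_theta hγ, doubleRetract_exchange hV hp hx, hp.antipode_left,
    HopfAlgebra.antipode_mul_antidistrib, antipode_antipodeInv, Finset.sum_mul, smul_mul_assoc]
  exact Finset.sum_comm_cycle

theorem doubleRetract_coinvariantProj (hp : IsPairing p) (hx : IsComatrix k x) (m : U) (i j : ι) :
    doubleRetract k U V (coinvariantProj (double p hU hV) (copData hU) doubleIncl (doubleProj γ)
      (m ⊗ₜ x i j)) = ∑ g, ∑ a, ∑ b,
        p (m * γ (x g j)) (antipodeInv hV (antipodeInv hV (x b g) * x i a)) • x a b := by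
  suffices (doubleRetract k U V).toLinearMap ∘ₗ coinvariantProj (double p hU hV) (copData hU)
      doubleIncl (doubleProj γ) ∘ₗ (TensorProduct.mk k U V).flip (x i j) =
      ∑ g, ∑ a, ∑ b, (p.flip (antipodeInv hV (antipodeInv hV (x b g) * x i a)) ∘ₗ
        LinearMap.mulRight k (γ (x g j))).smulRight (x a b) by
    simpa [LinearMap.sum_apply] using LinearMap.congr_fun this m
  refine ext_comatrix fun r n hn u v => ?_
  have retract_mul (c : Fin r) (l : ι) : doubleRetract k U V ((double p hU hV).mul
      ((n c v ⊗ₜ x i l) ⊗ₜ doubleIncl (antipodeInv hU (n u c * γ (x l j))))) =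
      (1 : Matrix (Fin r) (Fin r) k) c v • ∑ a, ∑ b, p (n u c * γ (x l j))
        (antipodeInv hV (antipodeInv hV (x b l) * x i a)) • x a b := by
    refine (doubleRetract_mul _ _ 1).trans ?_
    rw [doubleRetract_tmul, hn.counit_apply, ← TensorProduct.smul_tmul', map_smul, map_smul,
      mul_one, doubleRetract_exchange hV hp hx]
    simp only [hp.antipodeInv_left hU hV]
  calc doubleRetract k U V (coinvariantProj (double p hU hV) (copData hU) doubleIncl (doubleProj γ)
        (n u v ⊗ₜ x i j))
    _ = ∑ c, ∑ l, doubleRetract k U V ((double p hU hV).mul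
          ((n c v ⊗ₜ x i l) ⊗ₜ doubleIncl (antipodeInv hU (n u c * γ (x l j))))) := by
      simp only [coinvariantProj, LinearMap.comp_apply, double_comul_comatrix p hU hV hn hx,
        map_sum]
      rfl
    _ = ∑ l, ∑ a, ∑ b, p (n u v * γ (x l j))
          (antipodeInv hV (antipodeInv hV (x b l) * x i a)) • x a b := by
      rw [Finset.sum_comm]
      simp [retract_mul, Matrix.one_apply]
    _ = _ := by simp [LinearMap.sum_apply]

theorem underlineHopf_comul_eq (hp : IsPairing p) (hγ : IsProjectionDatum p γ hU) (y : V) :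
    (underlineHopf p γ hV).comul y = TensorProduct.map
      ((doubleRetract k U V).toLinearMap ∘ₗ
        coinvariantProj (double p hU hV) (copData hU) doubleIncl (doubleProj γ))
      (doubleRetract k U V).toLinearMap ((double p hU hV).comul (theta γ y)) := by
  suffices (underlineHopf p γ hV).comul = TensorProduct.map
      ((doubleRetract k U V).toLinearMap ∘ₗ
        coinvariantProj (double p hU hV) (copData hU) doubleIncl (doubleProj γ))
      (doubleRetract k U V).toLinearMap ∘ₗ (double p hU hV).comul ∘ₗ theta γ from
    LinearMap.congr_fun this y
  refine ext_comatrix fun r x hx i j => ?_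
  have pairing_eq (a b c d e : Fin r) : p (antipode k (γ (x e j)) * γ (x c d))
      (antipodeInv hV (antipodeInv hV (x b c) * x i a)) =
      p (γ (antipode k (x c d) * x e j)) (antipodeInv hV (x b c) * x i a) := by
    rw [← hp.antipodeInv_left hU, ← hγ.map_antipodeInv (hV := hV), ← hγ.map_mul,
      ← hγ.map_antipode, HopfAlgebra.antipode_mul_antidistrib, antipode_antipodeInv]
  simp only [LinearMap.comp_apply, double_comul_theta hγ hx, map_sum, TensorProduct.map_tmul,
    AlgHom.toLinearMap_apply, doubleRetract_coinvariantProj hp hx, doubleRetract_tmul,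
    HopfAlgebra.counit_antipode, hγ.counit_map, hx.counit_apply, Matrix.one_apply,
    underlineHopf_comul_comatrix hx, pairing_eq, TensorProduct.sum_tmul,
    ite_smul, one_smul, zero_smul, TensorProduct.tmul_ite,
    Finset.sum_ite_irrel, Finset.sum_const_zero, Finset.sum_ite_eq,
    Finset.mem_univ, if_true, TensorProduct.smul_tmul']
  exact Finset.sum_comm_cycle.trans <| .trans
    (Finset.sum_congr rfl fun _ _ => (sum_comm₂ _).trans Finset.sum_comm)
    Finset.sum_comm_cycle.symm

theorem underlineHopf_antipode_eq (hp : IsPairing p) (hγ : IsProjectionDatum p γ hU) (y : V) :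
    (underlineHopf p γ hV).antipode y = doubleRetract k U V ((double p hU hV).mul
      (TensorProduct.map (doubleIncl ∘ₗ doubleProj γ) (double p hU hV).antipode
        ((double p hU hV).comul (theta γ y)))) := by
  suffices (underlineHopf p γ hV).antipode = (doubleRetract k U V).toLinearMap ∘ₗ
      (double p hU hV).mul ∘ₗ TensorProduct.map (doubleIncl ∘ₗ doubleProj γ)
        (double p hU hV).antipode ∘ₗ (double p hU hV).comul ∘ₗ theta γ from
    LinearMap.congr_fun this y
  refine ext_comatrix fun r x hx i j => ?_
  have retract_antipode (a u g : Fin r) : doubleRetract k U V ((double p hU hV).antipode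
      (antipode k (γ (x a u)) ⊗ₜ x g a)) =
      ∑ c, ∑ d, p (γ (x a u)) (x g d * antipode k (x c a)) • antipode k (x d c) := by
    rw [double_antipode hU hV hp]
    have exchange_eq := doubleRetract_exchange hV hp (hU := hU) hx.transpose_map_antipode a g
      (γ (x a u))
    simp only [Matrix.transpose_apply, Matrix.map_apply, antipodeInv_antipode] at exchange_eq
    simp only [LinearMap.comp_apply, LinearEquiv.coe_coe, TensorProduct.comm_tmul,
      TensorProduct.map_tmul, antipodeInv_antipode, exchange_eq]
  have counit_doubleProj (u g : Fin r) :
      Coalgebra.counit (R := k) (doubleProj γ (antipode k (γ (x u j)) ⊗ₜ x i g)) =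
        (1 : Matrix (Fin r) (Fin r) k) u j * (1 : Matrix (Fin r) (Fin r) k) i g := by
    simp only [doubleProj, LinearMap.comp_apply, LinearMap.lTensor_tmul, LinearMap.mul'_apply,
      Bialgebra.counit_mul, HopfAlgebra.counit_antipode, hγ.counit_map, hx.counit_apply]
  calc (underlineHopf p γ hV).antipode (x i j)
    _ = ∑ a, ∑ c, ∑ d,
          p (γ (x a j)) (x i d * antipode k (x c a)) • antipode k (x d c) := by
      rw [underlineHopf_antipode_comatrix hx, Finset.sum_comm_cycle]
      exact Finset.sum_congr rfl fun _ _ => Finset.sum_comm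
    _ = ∑ a, ∑ u, ∑ g, Coalgebra.counit (R := k)
            (doubleProj γ (antipode k (γ (x u j)) ⊗ₜ x i g)) •
          doubleRetract k U V ((double p hU hV).antipode (antipode k (γ (x a u)) ⊗ₜ x g a)) := by
      simp [counit_doubleProj, retract_antipode, Matrix.one_apply]
    _ = _ := by
      simp only [LinearMap.comp_apply, double_comul_theta hγ hx, map_sum, TensorProduct.map_tmul,
        AlgHom.toLinearMap_apply, doubleRetract_doubleIncl_mul hp]

theorem isRetractModel_underline (hp : IsPairing p) (hγ : IsProjectionDatum p γ hU) :
    IsRetractModel (double p hU hV) (copData hU) doubleIncl (doubleProj γ) (theta γ)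
      (doubleRetract k U V).toLinearMap (underlineYD p γ hV) (underlineHopf p γ hV) where
  retract := doubleRetract_theta hγ
  range_theta := range_theta hγ
  act_eq := underlineYD_act_eq hp hγ
  coact_eq := underlineYD_coact_eq hγ
  mul_eq := underlineHopf_mul_eq hp hγ
  one_eq := (map_one (doubleRetract k U V)).symm
  comul_eq := underlineHopf_comul_eq hp hγ
  counit_eq y := (double_counit_theta hγ y).symm
  antipode_eq := underlineHopf_antipode_eq hp hγ

end Underline

end DoubleBiproduct

end

open DoubleBiproduct in
theorem mainTheorem2 {k U V : Type*} [Field k] [Ring U] [HopfAlgebra k U]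
    [Ring V] [HopfAlgebra k V]
    (hU : Function.Bijective (HopfAlgebra.antipode k : U →ₗ[k] U))
    (hV : Function.Bijective (HopfAlgebra.antipode k : V →ₗ[k] V))
    (p : U →ₗ[k] V →ₗ[k] k) (hp : IsPairing p)
    (γ : V →ₗ[k] U) (hγ : IsProjectionDatum p γ hU) :
    -- the double is a Hopf algebra with projection
    ((double p hU hV).IsHopfAlgebra ∧
      (copData hU).IsHopfAlgebra ∧
      IsHopfAlgebraHom (copData hU) (double p hU hV) doubleIncl ∧
      IsHopfAlgebraHom (double p hU hV) (copData hU) (doubleProj γ) ∧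
      doubleProj γ ∘ₗ doubleIncl = LinearMap.id) ∧
    -- `θ` is a bijection of `V` onto the coinvariants
    (theta γ = theta' γ hV ∧
      Function.Injective (theta γ) ∧
      LinearMap.range (theta γ) =
        coinvariants (double p hU hV) (copData hU) (doubleProj γ) ∧
      LinearMap.range (coinvariantProj (double p hU hV) (copData hU) doubleIncl (doubleProj γ)) =
        coinvariants (double p hU hV) (copData hU) (doubleProj γ)) ∧
    -- the explicit structure on `V` is the one carried over from the coinvariants by `θ`
    ((underlineYD p γ hV).act = action' p hV ∧
      (∀ m y, theta γ ((underlineYD p γ hV).act (m ⊗ₜ y)) =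
        adjointAction (double p hU hV) (copData hU) doubleIncl (m ⊗ₜ theta γ y)) ∧
      (∀ y, (theta γ).lTensor U ((underlineYD p γ hV).coact y) =
        (doubleProj γ).rTensor (U ⊗[k] V) ((double p hU hV).comul (theta γ y))) ∧
      (∀ x y, theta γ ((underlineHopf p γ hV).mul (x ⊗ₜ y)) =
        (double p hU hV).mul (theta γ x ⊗ₜ theta γ y)) ∧
      theta γ (underlineHopf p γ hV).one = (double p hU hV).one ∧
      (∀ x a,
        theta γ x =
          coinvariantProj (double p hU hV) (copData hU) doubleIncl (doubleProj γ) a →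
        TensorProduct.map (theta γ) (theta γ) ((underlineHopf p γ hV).comul x) =
          TensorProduct.map
            (coinvariantProj (double p hU hV) (copData hU) doubleIncl (doubleProj γ))
            (coinvariantProj (double p hU hV) (copData hU) doubleIncl (doubleProj γ))
            ((double p hU hV).comul a)) ∧
      (∀ x, (underlineHopf p γ hV).counit x = (double p hU hV).counit (theta γ x)) ∧
      (∀ x, theta γ ((underlineHopf p γ hV).antipode x) =
        (double p hU hV).mul
          (TensorProduct.map (doubleIncl ∘ₗ doubleProj γ) (double p hU hV).antipode
            ((double p hU hV).comul (theta γ x))))) ∧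
    -- it makes `V` a Hopf algebra in the category of left Yetter-Drinfeld modules over `U^cop`
    IsHopfAlgebraInYD (copData hU) (underlineYD p γ hV) (underlineHopf p γ hV) ∧
    -- the double is isomorphic to the Radford biproduct
    ((biproduct (copData hU) (underlineYD p γ hV) (underlineHopf p γ hV)).IsHopfAlgebra ∧
      IsHopfAlgebraHom (biproduct (copData hU) (underlineYD p γ hV) (underlineHopf p γ hV))
        (double p hU hV) (chi p γ hU hV) ∧
      Function.Bijective (chi p γ hU hV)) := by
  have hD := isHopfAlgebra_double hU hV hp
  have hK := isHopfAlgebra_copData hU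
  have hi := isBialgebraHom_doubleIncl (hU := hU) (hV := hV) hp
  have hπ := isBialgebraHom_doubleProj (hV := hV) hp hγ
  have hπi := doubleProj_comp_doubleIncl hγ
  have radford := (isRetractModel_underline hp hγ).isRadfordDecomposition hD hK hi hπ hπi
  exact ⟨⟨hD, hK, hi.isHopfAlgebraHom hK hD, hπ.isHopfAlgebraHom hD hK, hπi⟩,
    ⟨theta_eq_theta' hγ, Function.LeftInverse.injective (doubleRetract_theta hγ), range_theta hγ,
      radford.range_proj⟩,
    ⟨underlineYD_act_eq_action' hp, radford.theta_act, radford.theta_coact, radford.theta_mul,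
      radford.theta_one, radford.theta_comul, radford.counit_eq, radford.theta_antipode⟩,
    radford.isHopfAlgebraInYD,
    radford.isHopfAlgebra_biproduct, radford.isHopfAlgebraHom, radford.bijective⟩
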